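/- Let $Q$ be a smooth manifold. A \emph{Lagrangian torus fibration} over $Q$ is a compact symplectic manifold $(X,\omega)$ with a smooth surjective submersion $\pi\colon X\to Q$ whose fibres $F_q$ are connected and Lagrangian (hence tori). Its lattice $T^*_{\mathbb Z}Q\subset T^*Q$ is the family of subgroups of the spaces $T^*_qQ$ given by the images of $H_1(F_q;\mathbb Z)$ under the map $H_1(F_q;\mathbb Z)\to T^*_qQ$ sending a loop $\gamma$ in $F_q$ to the covector $v\mapsto\int_\gamma\omega(\tilde v,\cdot)$, where $\tilde v$ is any lift of $v\in T_qQ$ along $F_q$. Let $\operatorname{Aff}$ be the sheaf on $Q$ of smooth functions whose differential lies in $T^*_{\mathbb Z}Q$ at every point (integral affine functions). Let $\{P_i\}_{i=1}^m$ be a finite open cover of $Q$ all of whose nonempty iterated intersections are contractible (a good cover). Suppose we are given fibrewise symplectomorphisms $\tau_i\colon X_{P_i}=\pi^{-1}(P_i)\to T^*P_i/T^*_{\mathbb Z}P_i$ over $P_i$ and, for $i<j$, smooth functions $f_{ij}$ on $P_i\cap P_j$ such that $\tau_j\circ\tau_i^{-1}$ is fibrewise addition of $df_{ij}$. The functions $\alpha_X(ijk)=f_{ij}+f_{jk}-f_{ik}$,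 for $i<j<k$, form a \v{C}ech $2$-cocycle with values in $\operatorname{Aff}$, whose class is denoted $[\alpha_X]\in \check H^2(\{P_i\};\operatorname{Aff})=H^2(Q,\operatorname{Aff})$. \textbf{Proposition.} A Lagrangian torus fibration $X$ is determined up to fibrewise symplectomorphism by the triple $(Q,T^*_{\mathbb Z}Q,[\alpha_X])$. Precisely, let $X$ and $X'$ be Lagrangian torus fibrations over $Q$. \begin{enumerate} \item If $X$ and $X'$ induce the same lattice $T^*_{\mathbb Z}Q$, then there is a finite good cover of $Q$ on which choices $(\tau_i,f_{ij})$ as above exist for both $X$ and $X'$. (In particular, taking $X'=X$, every $X$ has a class $[\alpha_X]$.) \item For every finite good cover of $Q$ and all choices $(\tau_i,f_{ij})$ for $X$ and $(\tau'_i,f'_{ij})$ for $X'$ on it, there is a diffeomorphism $\varphi\colon X\to X'$ with $\pi'\circ\varphi=\pi$ and $\varphi^*\omega'=\omega$ if and only if $X$ and $X'$ induce the same lattice $T^*_{\mathbb Z}Q$ and $[\alpha_X]=[\alpha_{X'}]$. (In particular $[\alpha_X]$ does not depend on the choices.) \end{enumerate} -/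

import Mathlib

open scoped Manifold ContDiff Topology
open TopologicalSpace Bundle

noncomputable section

namespace LagrangianFibrations

/-! ### Differential forms on manifolds -/

section Forms

variable {E H : Type*} [NormedAddCommGroup E] [NormedSpace ℝ E] [TopologicalSpace H]
  (I : ModelWithCorners ℝ E H) (M : Type*) [TopologicalSpace M] [ChartedSpace H M]
  {E' H' : Type*} [NormedAddCommGroup E'] [NormedSpace ℝ E'] [TopologicalSpace H']
  (I' : ModelWithCorners ℝ E' H') {M' : Type*} [TopologicalSpace M'] [ChartedSpace H' M']

/-- A (not necessarily continuous) differential `k`-form on `M`. -/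
abbrev DiffForm (k : ℕ) : Type _ := ∀ x : M, (TangentSpace I x) [⋀^Fin k]→L[ℝ] ℝ

variable {M}

/-- The expression of a form in the preferred chart at `x₀`, that is, its pullback to the model
vector space under the inverse of the chart (meaningful on the target of the chart). -/
def DiffForm.inChart {k : ℕ} (η : DiffForm I M k) (x₀ : M) (y : E) : E [⋀^Fin k]→L[ℝ] ℝ :=
  (η ((extChartAt I x₀).symm y)).compContinuousLinearMap
    (mfderivWithin 𝓘(ℝ, E) I (extChartAt I x₀).symm (Set.range I) y)

/-- A form is smooth if its expressions in charts are smooth. -/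
def DiffForm.IsSmooth {k : ℕ} (η : DiffForm I M k) : Prop :=
  ∀ x₀ : M, ContDiffOn ℝ ∞ (DiffForm.inChart I η x₀) (extChartAt I x₀).target

/-- The exterior derivative, computed at `x` in the preferred chart at `x`; the tangent space at
`x` is identified with the model vector space through that same chart. -/
def DiffForm.extDeriv {k : ℕ} (η : DiffForm I M k) : DiffForm I M (k + 1) := fun x =>
  (extDerivWithin (DiffForm.inChart I η x) (Set.range I) (extChartAt I x x) :
    E [⋀^Fin (k + 1)]→L[ℝ] ℝ)

/-- A form is closed if its exterior derivative vanishes. -/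
def DiffForm.IsClosed {k : ℕ} (η : DiffForm I M k) : Prop :=
  ∀ x : M, DiffForm.extDeriv I η x = 0

/-- The value at `x` of the pullback `f^* η`. -/
def DiffForm.pullback {k : ℕ} (η : DiffForm I' M' k) (f : M → M') : DiffForm I M k := fun x =>
  (η (f x)).compContinuousLinearMap (mfderiv I I' f x)

end Forms

/-! ### The cotangent bundle and its canonical symplectic form -/

section Cotangent

variable (E : Type*) [NormedAddCommGroup E] [NormedSpace ℝ E]
  (Q : Type*) [TopologicalSpace Q] [ChartedSpace E Q]

/-- The cotangent space `T^*_q Q`. -/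
abbrev CotangentSpace {Q : Type*} [TopologicalSpace Q] [ChartedSpace E Q] (q : Q) : Type _ :=
  TangentSpace 𝓘(ℝ, E) q →L[ℝ] ℝ

/-- The total space of the cotangent bundle `T^*Q`. -/
abbrev CotangentBundle : Type _ :=
  TotalSpace (E →L[ℝ] ℝ) (fun q : Q => TangentSpace 𝓘(ℝ, E) q →L[ℝ] ℝ)

/-- The model with corners of the cotangent bundle. -/
abbrev cotangentModel : ModelWithCorners ℝ (E × (E →L[ℝ] ℝ)) (ModelProd E (E →L[ℝ] ℝ)) :=
  𝓘(ℝ, E).prod 𝓘(ℝ, E →L[ℝ] ℝ)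

variable [IsManifold 𝓘(ℝ, E) ∞ Q]

/-- The Liouville (tautological) `1`-form on `T^*Q`: at the point `(q, ξ)` its value on a tangent
vector `w` is `ξ (dπ w)`, where `π` is the projection to `Q`. -/
def liouvilleForm : DiffForm (cotangentModel E) (CotangentBundle E Q) 1 := fun z =>
  ContinuousAlternatingMap.ofSubsingleton ℝ _ ℝ (0 : Fin 1)
    (z.snd.comp (mfderiv (cotangentModel E) 𝓘(ℝ, E) (fun y : CotangentBundle E Q => y.proj) z))

/-- The canonical symplectic form of `T^*Q`, the exterior derivative of the Liouville form. -/
def canonicalForm : DiffForm (cotangentModel E) (CotangentBundle E Q) 2 :=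
  DiffForm.extDeriv (cotangentModel E) (liouvilleForm E Q)

end Cotangent

/-! ### Lagrangian torus fibrations -/

section Fibrations

variable (E : Type*) [NormedAddCommGroup E] [NormedSpace ℝ E]
  (F : Type*) [NormedAddCommGroup F] [NormedSpace ℝ F]
  (F' : Type*) [NormedAddCommGroup F'] [NormedSpace ℝ F']
  (Q : Type*) [TopologicalSpace Q] [ChartedSpace E Q]
  (X : Type*) [TopologicalSpace X] [ChartedSpace F X]
  (X' : Type*) [TopologicalSpace X'] [ChartedSpace F' X']

/-- A symplectic form on `X` together with a smooth surjective submersion `X → Q` whose fibres are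
connected and Lagrangian. When `X` is compact the fibres are tori. -/
structure LagrangianTorusFibration where
  /-- the symplectic form -/
  form : DiffForm 𝓘(ℝ, F) X 2
  isSmooth_form : DiffForm.IsSmooth 𝓘(ℝ, F) form
  isClosed_form : DiffForm.IsClosed 𝓘(ℝ, F) form
  nondegenerate : ∀ (x : X) (u : TangentSpace 𝓘(ℝ, F) x),
    (∀ w : TangentSpace 𝓘(ℝ, F) x, form x ![u, w] = 0) → u = 0
  /-- the projection to the base -/
  proj : X → Q
  contMDiff_proj : ContMDiff 𝓘(ℝ, F) 𝓘(ℝ, E) ∞ proj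
  submersion : ∀ x : X, Function.Surjective (mfderiv 𝓘(ℝ, F) 𝓘(ℝ, E) proj x)
  connected_fibre : ∀ q : Q, IsConnected (proj ⁻¹' {q})
  /-- The tangent space of the fibre, `ker dπ`, equals its orthogonal with respect to the form. -/
  lagrangian_fibre : ∀ (x : X) (u : TangentSpace 𝓘(ℝ, F) x),
    mfderiv 𝓘(ℝ, F) 𝓘(ℝ, E) proj x u = 0 ↔
      ∀ w : TangentSpace 𝓘(ℝ, F) x, mfderiv 𝓘(ℝ, F) 𝓘(ℝ, E) proj x w = 0 → form x ![u, w] = 0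

/-- A family of subgroups of the cotangent spaces of `Q`. -/
abbrev LatticeField : Type _ := ∀ q : Q, AddSubgroup (CotangentSpace E q)

variable {E F F' Q X X'}

namespace LagrangianTorusFibration

/-- `L.IsPeriod q c` says that the covector `c ∈ T^*_q Q` is the image of the class of a smooth
loop `γ` in the fibre over `q` under `H_1(F_q; ℤ) → H_1(F_q; ℝ) ≅ T^*_q Q`: for `v ∈ T_q Q`,
the number `c v` is the integral over `γ` of the `1`-form `ω(W, ·)`, where `W` is a lift of
`v` along the fibre (the integrand does not depend on the lift, the fibre being Lagrangian). -/
def IsPeriod (L : LagrangianTorusFibration E F Q X) (q : Q) (c : CotangentSpace E q) : Prop :=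
  ∃ γ : ℝ → X, ContMDiff 𝓘(ℝ, ℝ) 𝓘(ℝ, F) ∞ γ ∧ Function.Periodic γ 1 ∧ (∀ t, L.proj (γ t) = q) ∧
    ∀ (v : E) (W : ∀ t : ℝ, TangentSpace 𝓘(ℝ, F) (γ t)),
      (∀ t, (mfderiv 𝓘(ℝ, F) 𝓘(ℝ, E) L.proj (γ t) (W t) : E) = v) →
        (c : E →L[ℝ] ℝ) v =
          ∫ t in (0 : ℝ)..1, L.form (γ t) ![W t, mfderiv 𝓘(ℝ, ℝ) 𝓘(ℝ, F) γ t (1 : ℝ)]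

/-- The integral affine lattice `T^*_ℤ Q ⊂ T^*Q` of the fibration: over `q` it is the image of
`H_1(F_q; ℤ)`, that is, the subgroup generated by the periods of loops in the fibre. -/
def periodLattice (L : LagrangianTorusFibration E F Q X) : LatticeField E Q := fun q =>
  AddSubgroup.closure {c | L.IsPeriod q c}

/-- A fibrewise symplectomorphism: a diffeomorphism of total spaces which covers the identity of
the base and matches the symplectic forms. -/
structure FibrewiseSymplectomorphism (L : LagrangianTorusFibration E F Q X)
    (L' : LagrangianTorusFibration E F' Q X') where
  toDiffeomorph : Diffeomorph 𝓘(ℝ, F) 𝓘(ℝ, F') X X' ∞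
  proj_comp : ∀ x, L'.proj (toDiffeomorph x) = L.proj x
  pullback_form : DiffForm.pullback 𝓘(ℝ, F) 𝓘(ℝ, F') L'.form toDiffeomorph = L.form

variable [IsManifold 𝓘(ℝ, E) ∞ Q]

/-- A fibrewise symplectic identification of `T^*P / T^*_ℤ P` with `X_P = π⁻¹(P)`, for `P` open in
`Q`. It is given as a smooth symplectic map from `T^*P` onto `X_P` over `P`, two points over `q`
having the same image exactly when they differ by an element of the lattice. (Being symplectic
between manifolds of the same dimension, it is a local diffeomorphism; so it induces a
symplectomorphism from the quotient.) The values outside `T^*P` are irrelevant. -/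
structure LocalTrivialisation (L : LagrangianTorusFibration E F Q X) (P : Opens Q) where
  toFun : CotangentBundle E Q → X
  contMDiffOn : ContMDiffOn (cotangentModel E) 𝓘(ℝ, F) ∞ toFun {z | z.proj ∈ P}
  proj_comp : ∀ z : CotangentBundle E Q, z.proj ∈ P → L.proj (toFun z) = z.proj
  symplectic : ∀ z : CotangentBundle E Q, z.proj ∈ P →
    DiffForm.pullback (cotangentModel E) 𝓘(ℝ, F) L.form toFun z = canonicalForm E Q z
  surjective : ∀ x : X, L.proj x ∈ P → ∃ z : CotangentBundle E Q, z.proj ∈ P ∧ toFun z = x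
  eq_iff : ∀ q ∈ P, ∀ ξ ξ' : CotangentSpace E q,
    toFun ⟨q, ξ⟩ = toFun ⟨q, ξ'⟩ ↔ ξ - ξ' ∈ L.periodLattice q

end LagrangianTorusFibration

end Fibrations

/-! ### Integral affine functions and Čech cohomology -/

section Cech

variable {E : Type*} [NormedAddCommGroup E] [NormedSpace ℝ E]
  {Q : Type*} [TopologicalSpace Q] [ChartedSpace E Q]

/-- The extension by zero of a function on an open subset. -/
def zeroExt {U : Opens Q} (f : U → ℝ) : Q → ℝ :=
  Function.extend Subtype.val f (fun _ => 0)

/-- Smoothness of a function on an open subset. -/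
def IsSmoothFun (E : Type*) [NormedAddCommGroup E] [NormedSpace ℝ E] {Q : Type*}
    [TopologicalSpace Q] [ChartedSpace E Q] {U : Opens Q} (f : U → ℝ) : Prop :=
  ContMDiffOn 𝓘(ℝ, E) 𝓘(ℝ, ℝ) ∞ (zeroExt f) U

/-- The differential at `x ∈ U` of a function on the open subset `U`, as an element of
`T^*_x Q`. -/
def differential (E : Type*) [NormedAddCommGroup E] [NormedSpace ℝ E] {Q : Type*}
    [TopologicalSpace Q] [ChartedSpace E Q] {U : Opens Q} (f : U → ℝ) (x : U) :
    CotangentSpace E (x : Q) :=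
  mfderiv 𝓘(ℝ, E) 𝓘(ℝ, ℝ) (zeroExt f) (x : Q)

/-- Restriction of functions to a smaller open set. -/
def restrict {U V : Opens Q} (h : V ≤ U) (f : U → ℝ) : V → ℝ := fun x => f ⟨x, h x.2⟩

theorem zeroExt_apply {U : Opens Q} (f : U → ℝ) (x : U) : zeroExt f x = f x :=
  Subtype.val_injective.extend_apply f (fun _ : Q => (0 : ℝ)) x

theorem zeroExt_eq_zero {U : Opens Q} (f : U → ℝ) {x : Q} (hx : x ∉ U) : zeroExt f x = 0 := by
  refine Function.extend_apply' f (fun _ : Q => (0 : ℝ)) x ?_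
  rintro ⟨y, rfl⟩
  exact hx y.2

theorem zeroExt_zero {U : Opens Q} : zeroExt (0 : U → ℝ) = 0 := by
  funext x
  by_cases hx : x ∈ U
  · exact zeroExt_apply _ ⟨x, hx⟩
  · exact zeroExt_eq_zero _ hx

theorem zeroExt_add {U : Opens Q} (f g : U → ℝ) : zeroExt (f + g) = zeroExt f + zeroExt g := by
  funext x
  by_cases hx : x ∈ U
  · have h1 := zeroExt_apply (f + g) ⟨x, hx⟩
    have h2 := zeroExt_apply f ⟨x, hx⟩
    have h3 := zeroExt_apply g ⟨x, hx⟩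
    simp only [Pi.add_apply] at *
    rw [h1, h2, h3]
  · simp [zeroExt_eq_zero _ hx]

theorem zeroExt_neg {U : Opens Q} (f : U → ℝ) : zeroExt (-f) = -zeroExt f := by
  funext x
  by_cases hx : x ∈ U
  · have h1 := zeroExt_apply (-f) ⟨x, hx⟩
    have h2 := zeroExt_apply f ⟨x, hx⟩
    simp only [Pi.neg_apply] at *
    rw [h1, h2]
  · simp [zeroExt_eq_zero _ hx]

theorem zeroExt_restrict_eventuallyEq {U V : Opens Q} (h : V ≤ U) (f : U → ℝ) (x : V) :
    zeroExt (restrict h f) =ᶠ[𝓝 (x : Q)] zeroExt f := by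
  filter_upwards [V.isOpen.mem_nhds x.2] with y hy
  exact (zeroExt_apply (restrict h f) ⟨y, hy⟩).trans (zeroExt_apply f ⟨y, h hy⟩).symm

theorem IsSmoothFun.mdifferentiableAt {U : Opens Q} {f : U → ℝ} (hf : IsSmoothFun E f) (x : U) :
    MDifferentiableAt 𝓘(ℝ, E) 𝓘(ℝ, ℝ) (zeroExt f) (x : Q) :=
  (hf.contMDiffAt (U.isOpen.mem_nhds x.2)).mdifferentiableAt (by simp)

theorem IsSmoothFun.restrict {U V : Opens Q} (h : V ≤ U) {f : U → ℝ} (hf : IsSmoothFun E f) :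
    IsSmoothFun E (restrict h f) := fun x hx =>
  ((hf.contMDiffAt (U.isOpen.mem_nhds (h hx))).congr_of_eventuallyEq
    (zeroExt_restrict_eventuallyEq h f ⟨x, hx⟩)).contMDiffWithinAt

theorem IsSmoothFun.add {U : Opens Q} {f g : U → ℝ} (hf : IsSmoothFun E f)
    (hg : IsSmoothFun E g) : IsSmoothFun E (f + g) := by
  unfold IsSmoothFun at *
  rw [zeroExt_add]
  exact ContMDiffOn.add hf hg

theorem IsSmoothFun.neg {U : Opens Q} {f : U → ℝ} (hf : IsSmoothFun E f) :
    IsSmoothFun E (-f) := by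
  unfold IsSmoothFun at *
  rw [zeroExt_neg]
  exact ContMDiffOn.neg hf

theorem differential_restrict {U V : Opens Q} (h : V ≤ U) (f : U → ℝ) (x : V) :
    differential E (restrict h f) x = differential E f ⟨x, h x.2⟩ :=
  (zeroExt_restrict_eventuallyEq h f x).mfderiv_eq

theorem differential_add {U : Opens Q} {f g : U → ℝ} (hf : IsSmoothFun E f)
    (hg : IsSmoothFun E g) (x : U) :
    differential E (f + g) x = differential E f x + differential E g x := by
  unfold differential
  rw [zeroExt_add]
  exact mfderiv_add (hf.mdifferentiableAt x) (hg.mdifferentiableAt x)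

theorem differential_neg {U : Opens Q} (f : U → ℝ) (x : U) :
    differential E (-f) x = -differential E f x := by
  unfold differential
  rw [zeroExt_neg]
  exact mfderiv_neg

/-- The group `Aff(U)` of integral affine functions on `U`, the sections over `U` of the sheaf
`Aff`: smooth functions whose differential lies in the lattice at every point. -/
def Aff (Λ : LatticeField E Q) (U : Opens Q) : AddSubgroup (U → ℝ) where
  carrier := {f | IsSmoothFun E f ∧ ∀ x : U, differential E f x ∈ Λ x}
  zero_mem' := by
    refine ⟨?_, fun x => ?_⟩
    · unfold IsSmoothFun
      rw [zeroExt_zero]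
      exact contMDiffOn_const
    · have : differential E (0 : U → ℝ) x = 0 := by
        unfold differential
        rw [zeroExt_zero]
        exact mfderiv_const
      rw [this]
      exact zero_mem _
  add_mem' := fun {f g} hf hg => ⟨hf.1.add hg.1, fun x => by
    rw [differential_add hf.1 hg.1]
    exact add_mem (hf.2 x) (hg.2 x)⟩
  neg_mem' := fun {f} hf => ⟨hf.1.neg, fun x => by
    rw [differential_neg]
    exact neg_mem (hf.2 x)⟩

/-- Restriction of integral affine functions. -/
def Aff.res (Λ : LatticeField E Q) {U V : Opens Q} (h : V ≤ U) : Aff Λ U →+ Aff Λ V where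
  toFun f := ⟨restrict h f, f.2.1.restrict h, fun x => by
    rw [differential_restrict]
    exact f.2.2 ⟨x, h x.2⟩⟩
  map_zero' := rfl
  map_add' _ _ := rfl

variable {m : ℕ}

/-- A finite open cover of `Q` all of whose nonempty iterated intersections are contractible. -/
structure IsGoodCover (P : Fin m → Opens Q) : Prop where
  covers : ∀ q : Q, ∃ i, q ∈ P i
  contractible : ∀ s : Finset (Fin m), s.Nonempty → (⋂ i ∈ s, (P i : Set Q)).Nonempty →
    ContractibleSpace (⋂ i ∈ s, (P i : Set Q) : Set Q)

variable (Λ : LatticeField E Q) (P : Fin m → Opens Q)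

/-- Increasing pairs of indices. -/
abbrev Pairs (m : ℕ) : Type := {p : Fin m × Fin m // p.1 < p.2}

/-- Increasing triples of indices. -/
abbrev Triples (m : ℕ) : Type := {p : Fin m × Fin m × Fin m // p.1 < p.2.1 ∧ p.2.1 < p.2.2}

/-- Increasing quadruples of indices. -/
abbrev Quadruples (m : ℕ) : Type :=
  {p : Fin m × Fin m × Fin m × Fin m // p.1 < p.2.1 ∧ p.2.1 < p.2.2.1 ∧ p.2.2.1 < p.2.2.2}

/-- The intersection `P i ∩ P j` for a pair `(i, j)`. -/
abbrev inter2 (s : Pairs m) : Opens Q := P s.1.1 ⊓ P s.1.2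

/-- The intersection `P i ∩ P j ∩ P k` for a triple `(i, j, k)`. -/
abbrev inter3 (s : Triples m) : Opens Q := P s.1.1 ⊓ P s.1.2.1 ⊓ P s.1.2.2

/-- The intersection `P i ∩ P j ∩ P k ∩ P l` for a quadruple `(i, j, k, l)`. -/
abbrev inter4 (s : Quadruples m) : Opens Q :=
  P s.1.1 ⊓ P s.1.2.1 ⊓ P s.1.2.2.1 ⊓ P s.1.2.2.2

/-- Čech `1`-cochains with values in `Aff`. -/
abbrev CechC1 : Type _ := ∀ s : Pairs m, Aff Λ (inter2 P s)

/-- Čech `2`-cochains with values in `Aff`. -/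
abbrev CechC2 : Type _ := ∀ s : Triples m, Aff Λ (inter3 P s)

/-- Čech `3`-cochains with values in `Aff`. -/
abbrev CechC3 : Type _ := ∀ s : Quadruples m, Aff Λ (inter4 P s)

section Inclusions

variable {P} {i j k l : Fin m}

theorem le_ij : P i ⊓ P j ⊓ P k ≤ P i ⊓ P j := inf_le_left

theorem le_jk : P i ⊓ P j ⊓ P k ≤ P j ⊓ P k := inf_le_inf_right _ inf_le_right

theorem le_ik : P i ⊓ P j ⊓ P k ≤ P i ⊓ P k := inf_le_inf_right _ inf_le_left

theorem le_ijk : P i ⊓ P j ⊓ P k ⊓ P l ≤ P i ⊓ P j ⊓ P k := inf_le_left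

theorem le_ijl : P i ⊓ P j ⊓ P k ⊓ P l ≤ P i ⊓ P j ⊓ P l := inf_le_inf_right _ inf_le_left

theorem le_ikl : P i ⊓ P j ⊓ P k ⊓ P l ≤ P i ⊓ P k ⊓ P l := inf_le_inf_right _ le_ik

theorem le_jkl : P i ⊓ P j ⊓ P k ⊓ P l ≤ P j ⊓ P k ⊓ P l := inf_le_inf_right _ le_jk

end Inclusions

/-- The Čech differential `(d b)_{ijk} = b_{jk} - b_{ik} + b_{ij}`. -/
def cechD1 : CechC1 Λ P →+ CechC2 Λ P where
  toFun b := fun s =>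
    Aff.res Λ le_jk (b ⟨(s.1.2.1, s.1.2.2), s.2.2⟩)
      - Aff.res Λ le_ik (b ⟨(s.1.1, s.1.2.2), s.2.1.trans s.2.2⟩)
      + Aff.res Λ le_ij (b ⟨(s.1.1, s.1.2.1), s.2.1⟩)
  map_zero' := by
    funext s
    simp
  map_add' b c := by
    funext s
    simp only [Pi.add_apply, map_add]
    abel

/-- The Čech differential `(d a)_{ijkl} = a_{jkl} - a_{ikl} + a_{ijl} - a_{ijk}`. -/
def cechD2 : CechC2 Λ P →+ CechC3 Λ P where
  toFun a := fun s =>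
    Aff.res Λ le_jkl (a ⟨(s.1.2.1, s.1.2.2.1, s.1.2.2.2), s.2.2.1, s.2.2.2⟩)
      - Aff.res Λ le_ikl (a ⟨(s.1.1, s.1.2.2.1, s.1.2.2.2), s.2.1.trans s.2.2.1, s.2.2.2⟩)
      + Aff.res Λ le_ijl (a ⟨(s.1.1, s.1.2.1, s.1.2.2.2), s.2.1, s.2.2.1.trans s.2.2.2⟩)
      - Aff.res Λ le_ijk (a ⟨(s.1.1, s.1.2.1, s.1.2.2.1), s.2.1, s.2.2.1⟩)
  map_zero' := by
    funext s
    simp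
  map_add' a c := by
    funext s
    simp only [Pi.add_apply, map_add]
    abel

/-- The Čech cohomology group `H^2(Q, Aff)` of the cover: cocycles modulo coboundaries. -/
abbrev CechH2 : Type _ := (cechD2 Λ P).ker ⧸ (cechD1 Λ P).range.addSubgroupOf (cechD2 Λ P).ker

end Cech

/-! ### The class of a Lagrangian torus fibration -/

section ObstructionClass

variable {E : Type*} [NormedAddCommGroup E] [NormedSpace ℝ E]
  {F : Type*} [NormedAddCommGroup F] [NormedSpace ℝ F]
  {Q : Type*} [TopologicalSpace Q] [ChartedSpace E Q] [IsManifold 𝓘(ℝ, E) ∞ Q]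
  {X : Type*} [TopologicalSpace X] [ChartedSpace F X] {m : ℕ}

/-- The choices which enter the definition of the class of a fibration relative to a cover: a
trivialisation over each `P i`, and, for `i < j`, a smooth function `f_{ij}` on the intersection
such that the change of trivialisation is fibrewise addition of the closed `1`-form `d f_{ij}`. -/
structure TrivialisationData (L : LagrangianTorusFibration E F Q X) (P : Fin m → Opens Q) where
  triv : ∀ i, L.LocalTrivialisation (P i)
  primitive : ∀ i j : Fin m, i < j → (P i ⊓ P j : Opens Q) → ℝ
  isSmooth_primitive : ∀ i j (h : i < j), IsSmoothFun E (primitive i j h)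
  transition : ∀ i j (h : i < j) (x : (P i ⊓ P j : Opens Q)) (ξ : CotangentSpace E (x : Q)),
    (triv i).toFun ⟨x, ξ⟩ = (triv j).toFun ⟨x, ξ + differential E (primitive i j h) x⟩

namespace TrivialisationData

variable {L : LagrangianTorusFibration E F Q X} {P : Fin m → Opens Q} (D : TrivialisationData L P)

/-- The function `α_{ijk} = f_{ij} + f_{jk} - f_{ik}` on the triple intersection. -/
def alphaFun (i j k : Fin m) (hij : i < j) (hjk : j < k) : (P i ⊓ P j ⊓ P k : Opens Q) → ℝ :=
  restrict le_ij (D.primitive i j hij) + restrict le_jk (D.primitive j k hjk)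
    + -restrict le_ik (D.primitive i k (hij.trans hjk))

theorem alphaFun_mem (i j k : Fin m) (hij : i < j) (hjk : j < k) :
    D.alphaFun i j k hij hjk ∈ Aff L.periodLattice (P i ⊓ P j ⊓ P k) := by
  have s1 := (D.isSmooth_primitive i j hij).restrict (le_ij (k := k))
  have s2 := (D.isSmooth_primitive j k hjk).restrict (le_jk (i := i))
  have s3 := (D.isSmooth_primitive i k (hij.trans hjk)).restrict (le_ik (j := j))
  refine ⟨(s1.add s2).add s3.neg, fun x => ?_⟩
  unfold alphaFun
  rw [differential_add (s1.add s2) s3.neg, differential_add s1 s2, differential_neg,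
    differential_restrict, differential_restrict, differential_restrict, ← sub_eq_add_neg]
  have hx : (x : Q) ∈ P k := x.2.2
  refine ((D.triv k).eq_iff x hx _ _).1 ?_
  have t1 := D.transition i j hij ⟨x, le_ij x.2⟩ 0
  have t2 := D.transition j k hjk ⟨x, le_jk x.2⟩
    (0 + differential E (D.primitive i j hij) ⟨x, le_ij x.2⟩)
  have t3 := D.transition i k (hij.trans hjk) ⟨x, le_ik x.2⟩ 0
  rw [zero_add] at t1 t2 t3
  exact t2.symm.trans (t1.symm.trans t3)

/-- The Čech cochain `α` with values in `Aff`. -/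
def alpha : CechC2 L.periodLattice P := fun s =>
  ⟨D.alphaFun s.1.1 s.1.2.1 s.1.2.2 s.2.1 s.2.2, D.alphaFun_mem _ _ _ s.2.1 s.2.2⟩

theorem alpha_mem_ker : D.alpha ∈ (cechD2 L.periodLattice P).ker := by
  rw [AddMonoidHom.mem_ker]
  funext ⟨(i, j, k, l), hij, hjk, hkl⟩
  apply Subtype.ext
  funext x
  have hx : (x : Q) ∈ P i ⊓ P j ⊓ P k ⊓ P l := x.2
  change (D.primitive j k hjk ⟨x, _⟩ + D.primitive k l hkl ⟨x, _⟩ + -D.primitive j l _ ⟨x, _⟩)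
    - (D.primitive i k _ ⟨x, _⟩ + D.primitive k l hkl ⟨x, _⟩ + -D.primitive i l _ ⟨x, _⟩)
    + (D.primitive i j hij ⟨x, _⟩ + D.primitive j l _ ⟨x, _⟩ + -D.primitive i l _ ⟨x, _⟩)
    - (D.primitive i j hij ⟨x, _⟩ + D.primitive j k hjk ⟨x, _⟩ + -D.primitive i k _ ⟨x, _⟩) = 0
  ring

/-- The cohomology class `[α] ∈ H^2(Q, Aff)`. -/
def obstructionClass : CechH2 L.periodLattice P :=
  QuotientAddGroup.mk ⟨D.alpha, D.alpha_mem_ker⟩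

/-- The pair consisting of the lattice `T^*_ℤ Q` of the fibration and the class `[α]` in the
cohomology of the sheaf of integral affine functions of that lattice. -/
def invariant : Σ Λ : LatticeField E Q, CechH2 Λ P := ⟨L.periodLattice, D.obstructionClass⟩

end TrivialisationData

end ObstructionClass

end LagrangianFibrations

end

noncomputable section

namespace LagrangianFibrations

set_option linter.unusedSectionVars false

/-! ### Smooth parametric integrals and the Poincaré lemma -/

section Instances

variable {G A : Type*} [NormedAddCommGroup G] [NormedSpace ℝ G] [NormedAddCommGroup A]
  [NormedSpace ℝ A]

/-! The local theory rests on a Darboux theorem relative to the projection. In coordinates in which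
`proj` is a product projection, the symplectic form is closed and vanishes on the slices. The
Poincaré lemma, applied to the form and then to its primitive along the slices, writes it as ∑ dp_i
∧ dq_i (`exists_momentum`), and (q, p) are coordinates. So every point of X lies in the image of a
symplectic map over the base defined on an open part of the cotangent bundle
(`LagrangianTorusFibration.exists_isLagAt`). Such germs are rigid: where two of them have a common
value they differ by fibrewise addition of some df (`IsLagAt.transition`). On one fibre this is a
constant translation, so agreement propagates along segments (`IsLagAt.eq_along_segment`).

Translating inside germs therefore makes small covectors act on fibres, by an amount which
compactness makes uniform over a compact part of the base. Local additivity extends this to an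
action of all covectors by pure algebra (`exists_additive_extension`), without integrating
Hamiltonian flows. Orbits are open in the connected fibres, so the action is transitive on each
fibre. Letting it act on a local Lagrangian section gives a local trivialisation, and the
stabilisers are exactly the period lattices (`mem_periodLattice_iff`).

The lattice is discrete and cocompact in each cotangent space, and its elements extend locally to
differentials of integral affine functions. This has two consequences. First, the possible 1-jets of
a primitive of a change of trivialisation form a covering space, so a primitive exists over every
simply connected open set (`exists_isTransition`, through `exists_global_section`). Secondly, Q has
integral affine charts with affine changes of charts. Small chart balls stay convex in neighbouring
charts, and finitely many of them form a good cover (`exists_isGoodCover`). This gives part (1).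

For part (2), a fibrewise symplectomorphism φ carries trivialisations of X to trivialisations of X'.
Over the contractible set P_i the maps φ ∘ τ_i and τ'_i, from the cotangent bundle, differ by some
dh_i. Then f'_ij + h_i - f_ij - h_j is integral affine, and its coboundary is α' - α. Conversely, if
α' - α is the coboundary of b, then f' - f - b is a cocycle of smooth functions, hence p_j - p_i for
smooth p_i by a partition of unity. Translating τ'_i by dp_i makes the changes of trivialisation of
X and X' agree modulo the lattice, so the local identifications glue. -/

instance instSeminormedAddCommGroupBilin : SeminormedAddCommGroup (G →L[ℝ] A →L[ℝ] ℝ) :=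
  ContinuousLinearMap.toSeminormedAddCommGroup

instance instNormedAddCommGroupBilin : NormedAddCommGroup (G →L[ℝ] A →L[ℝ] ℝ) :=
  ContinuousLinearMap.toNormedAddCommGroup

instance instAddCommGroupBilin : AddCommGroup (G →L[ℝ] A →L[ℝ] ℝ) :=
  ContinuousLinearMap.addCommGroup

instance instNormedSpaceBilin : NormedSpace ℝ (G →L[ℝ] A →L[ℝ] ℝ) :=
  ContinuousLinearMap.toNormedSpace

end Instances

section Calculus

universe u

variable {G V : Type u} [NormedAddCommGroup G] [NormedSpace ℝ G]
  [NormedAddCommGroup V] [NormedSpace ℝ V]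

/-- Differentiation under the integral sign by dominated convergence. Only openness of `W` around
the compact segment over `x` is available, so the uniform bound on the partial derivative comes from
the tube lemma. -/
theorem hasFDerivAt_integral_of_contDiffOn {f : G → ℝ → V} {W : Set (G × ℝ)} (hW : IsOpen W)
    (hf : ContDiffOn ℝ 1 (fun p : G × ℝ => f p.1 p.2) W) {x : G}
    (hx : ∀ t ∈ Set.Icc (0 : ℝ) 1, (x, t) ∈ W) :
    HasFDerivAt (fun y => ∫ t in (0 : ℝ)..1, f y t)
      (∫ t in (0 : ℝ)..1, fderiv ℝ (fun y => f y t) x) x := by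
  set g : G × ℝ → G →L[ℝ] V := fun p =>
    (fderiv ℝ (fun p : G × ℝ => f p.1 p.2) p).comp (ContinuousLinearMap.inl ℝ G ℝ) with hg
  have hder : ∀ p ∈ W, HasFDerivAt (fun y => f y p.2) (g p) p.1 := by
    intro p hp
    have h1 : HasFDerivAt (fun p : G × ℝ => f p.1 p.2)
        (fderiv ℝ (fun p : G × ℝ => f p.1 p.2) p) p :=
      ((hf.contDiffAt (hW.mem_nhds hp)).differentiableAt one_ne_zero).hasFDerivAt
    exact HasFDerivAt.comp (g := fun p : G × ℝ => f p.1 p.2) p.1 (f := fun y => (y, p.2)) h1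
      (hasFDerivAt_prodMk_left p.1 p.2)
  have hgc : ContinuousOn g W :=
    ((hf.continuousOn_fderiv_of_isOpen hW le_rfl)).clm_comp continuousOn_const
  have hfc := hf.continuousOn
  obtain ⟨C, hC⟩ : ∃ C, ∀ t ∈ Set.Icc (0 : ℝ) 1, ‖g (x, t)‖ ≤ C :=
    isCompact_Icc.exists_bound_of_continuousOn (f := fun t => g (x, t))
      (hgc.comp (by fun_prop) hx)
  have hopen : IsOpen (W ∩ g ⁻¹' Metric.ball 0 (C + 1)) :=
    hgc.isOpen_inter_preimage hW Metric.isOpen_ball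
  obtain ⟨s, T, hs, -, hxs, hT, hsT⟩ := generalized_tube_lemma (s := {x}) (t := Set.Icc (0 : ℝ) 1)
    isCompact_singleton isCompact_Icc hopen (by
      rintro ⟨y, t⟩ ⟨hy, ht⟩
      obtain rfl : y = x := hy
      exact ⟨hx t ht, by simpa using lt_of_le_of_lt (hC t ht) (lt_add_one C)⟩)
  have hsub : ∀ y ∈ s, ∀ t ∈ Set.Icc (0 : ℝ) 1, (y, t) ∈ W ∧ ‖g (y, t)‖ ≤ C + 1 := by
    intro y hy t ht
    have := hsT (Set.mk_mem_prod hy (hT ht))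
    exact ⟨this.1, by simpa using (le_of_lt (by simpa using this.2))⟩
  have hIoc : ∀ t ∈ Set.uIoc (0 : ℝ) 1, t ∈ Set.Icc (0 : ℝ) 1 := fun t ht => by
    rw [Set.uIoc_of_le zero_le_one] at ht; exact ⟨ht.1.le, ht.2⟩
  have hcont : ∀ y ∈ s, ContinuousOn (fun t => f y t) (Set.Icc 0 1) := fun y hy =>
    hfc.comp (f := fun t => (y, t)) (by fun_prop) (fun t ht => (hsub y hy t ht).1)
  have hxs' : x ∈ s := hxs rfl
  have hcontg : ContinuousOn (fun t => g (x, t)) (Set.Icc 0 1) :=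
    hgc.comp (f := fun t => (x, t)) (by fun_prop) (fun t ht => (hsub x hxs' t ht).1)
  have hu : Set.uIcc (0 : ℝ) 1 = Set.Icc 0 1 := Set.uIcc_of_le zero_le_one
  have key := intervalIntegral.hasFDerivAt_integral_of_dominated_of_fderiv_le
    (μ := MeasureTheory.volume) (𝕜 := ℝ) (a := 0) (b := 1) (F := f) (F' := fun y t => g (y, t))
    (bound := fun _ => C + 1) (hs.mem_nhds hxs')
    (by
      filter_upwards [hs.mem_nhds hxs'] with y hy
      refine ContinuousOn.aestronglyMeasurable ?_ measurableSet_uIoc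
      exact (hcont y hy).mono hIoc)
    ((hu ▸ hcont x hxs').intervalIntegrable)
    (ContinuousOn.aestronglyMeasurable (hcontg.mono hIoc) measurableSet_uIoc)
    (Filter.Eventually.of_forall fun t ht y hy => (hsub y hy t (hIoc t ht)).2)
    (by simp)
    (Filter.Eventually.of_forall fun t ht y hy => hder _ (hsub y hy t (hIoc t ht)).1)
  convert key using 1
  refine intervalIntegral.integral_congr fun t ht => ?_
  rw [hu] at ht
  exact (hder (x, t) (hx t ht)).fderiv

/-- The derivative of the integral is again such an integral, with values in a space of linear maps.
The induction therefore quantifies over the target `V`, which is why `G` and `V` share a universe.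
-/
theorem contDiffOn_integral_nat {U : Set G} {W : Set (G × ℝ)} (hU : IsOpen U) (hW : IsOpen W)
    (hUW : ∀ x ∈ U, ∀ t ∈ Set.Icc (0 : ℝ) 1, (x, t) ∈ W) (n : ℕ) :
    ∀ {V : Type u} [NormedAddCommGroup V] [NormedSpace ℝ V] {f : G → ℝ → V},
    ContDiffOn ℝ ∞ (fun p : G × ℝ => f p.1 p.2) W →
    ContDiffOn ℝ n (fun y => ∫ t in (0 : ℝ)..1, f y t) U := by
  induction n with
  | zero =>
    intro V _ _ f hf
    refine contDiffOn_zero.2 fun x hx => ContinuousAt.continuousWithinAt ?_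
    exact (hasFDerivAt_integral_of_contDiffOn hW (hf.of_le (by simp)) (hUW x hx)).continuousAt
  | succ n ih =>
    intro V _ _ f hf
    have hd : ∀ x ∈ U, HasFDerivAt (fun y => ∫ t in (0 : ℝ)..1, f y t)
      (∫ t in (0 : ℝ)..1, fderiv ℝ (fun y => f y t) x) x := fun x hx =>
      hasFDerivAt_integral_of_contDiffOn hW (hf.of_le (by simp)) (hUW x hx)
    push_cast
    rw [contDiffOn_succ_iff_fderiv_of_isOpen hU]
    refine ⟨fun x hx => (hd x hx).differentiableAt.differentiableWithinAt, by simp, ?_⟩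
    refine ContDiffOn.congr (f := fun x => ∫ t in (0 : ℝ)..1, fderiv ℝ (fun y => f y t) x) ?_
      fun x hx => (hd x hx).fderiv
    refine ih (f := fun x t => fderiv ℝ (fun y => f y t) x) ?_
    have h1 : ContDiffOn ℝ ∞ (fderiv ℝ (fun p : G × ℝ => f p.1 p.2)) W :=
      hf.fderiv_of_isOpen hW (by simp)
    refine (h1.clm_comp (contDiffOn_const (c := ContinuousLinearMap.inl ℝ G ℝ))).congr ?_
    intro p hp
    have h2 : HasFDerivAt (fun p : G × ℝ => f p.1 p.2)
        (fderiv ℝ (fun p : G × ℝ => f p.1 p.2) p) p :=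
      ((hf.contDiffAt (hW.mem_nhds hp)).differentiableAt (by simp)).hasFDerivAt
    exact (HasFDerivAt.comp (g := fun p : G × ℝ => f p.1 p.2) p.1 (f := fun y => (y, p.2)) h2
      (hasFDerivAt_prodMk_left p.1 p.2)).fderiv

theorem contDiffOn_integral {U : Set G} {W : Set (G × ℝ)} (hU : IsOpen U) (hW : IsOpen W)
    (hUW : ∀ x ∈ U, ∀ t ∈ Set.Icc (0 : ℝ) 1, (x, t) ∈ W) {f : G → ℝ → V}
    (hf : ContDiffOn ℝ ∞ (fun p : G × ℝ => f p.1 p.2) W) :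
    ContDiffOn ℝ ∞ (fun y => ∫ t in (0 : ℝ)..1, f y t) U :=
  contDiffOn_infty.2 fun n => contDiffOn_integral_nat hU hW hUW n hf

theorem continuousOn_fderiv_param {f : G → ℝ → V} {W : Set (G × ℝ)} (hW : IsOpen W)
    (hf : ContDiffOn ℝ 1 (fun p : G × ℝ => f p.1 p.2) W) {x : G}
    (hx : ∀ t ∈ Set.Icc (0 : ℝ) 1, (x, t) ∈ W) :
    ContinuousOn (fun t => fderiv ℝ (fun y => f y t) x) (Set.Icc 0 1) := by
  have h2 : ContinuousOn (fun t => (fderiv ℝ (fun p : G × ℝ => f p.1 p.2) (x, t)).comp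
      (ContinuousLinearMap.inl ℝ G ℝ)) (Set.Icc 0 1) :=
    ((hf.continuousOn_fderiv_of_isOpen hW le_rfl).comp (f := fun t : ℝ => (x, t)) (by fun_prop)
      (fun t ht => hx t ht)).clm_comp continuousOn_const
  refine h2.congr fun t ht => ?_
  have h3 : HasFDerivAt (fun p : G × ℝ => f p.1 p.2)
      (fderiv ℝ (fun p : G × ℝ => f p.1 p.2) (x, t)) (x, t) :=
    ((hf.contDiffAt (hW.mem_nhds (hx t ht))).differentiableAt one_ne_zero).hasFDerivAt
  exact (HasFDerivAt.comp (g := fun p : G × ℝ => f p.1 p.2) x (f := fun y => (y, t)) h3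
    (hasFDerivAt_prodMk_left x t)).fderiv

theorem fderiv_integral_apply [CompleteSpace V] {f : G → ℝ → V} {W : Set (G × ℝ)} (hW : IsOpen W)
    (hf : ContDiffOn ℝ 1 (fun p : G × ℝ => f p.1 p.2) W) {x : G}
    (hx : ∀ t ∈ Set.Icc (0 : ℝ) 1, (x, t) ∈ W) (a : G) :
    fderiv ℝ (fun y => ∫ t in (0 : ℝ)..1, f y t) x a =
      ∫ t in (0 : ℝ)..1, fderiv ℝ (fun y => f y t) x a := by
  have hu : Set.uIcc (0 : ℝ) 1 = Set.Icc 0 1 := Set.uIcc_of_le zero_le_one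
  rw [(hasFDerivAt_integral_of_contDiffOn hW hf hx).fderiv]
  have hint : IntervalIntegrable (fun t => fderiv ℝ (fun y => f y t) x) MeasureTheory.volume 0 1 :=
    (hu ▸ continuousOn_fderiv_param hW hf hx).intervalIntegrable
  simpa using (ContinuousLinearMap.intervalIntegral_comp_comm
    (ContinuousLinearMap.apply ℝ V a) hint).symm

theorem intervalIntegral_clm_apply {f : ℝ → G →L[ℝ] ℝ} (hf : ContinuousOn f (Set.Icc 0 1))
    (b : G) : (∫ t in (0 : ℝ)..1, f t) b = ∫ t in (0 : ℝ)..1, f t b := by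
  have hu : Set.uIcc (0 : ℝ) 1 = Set.Icc 0 1 := Set.uIcc_of_le zero_le_one
  have hint : IntervalIntegrable f MeasureTheory.volume 0 1 := (hu ▸ hf).intervalIntegrable
  simpa using (ContinuousLinearMap.intervalIntegral_comp_comm
    (ContinuousLinearMap.apply ℝ ℝ b) hint).symm

theorem hasFDerivAt_comp_homothety {B : G → V} {z₀ z : G} {t : ℝ}
    (hB : DifferentiableAt ℝ B (z₀ + t • (z - z₀))) :
    HasFDerivAt (fun x => B (z₀ + t • (x - z₀)))
      (t • fderiv ℝ B (z₀ + t • (z - z₀))) z := by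
  have h1 : HasFDerivAt (fun x => z₀ + t • (x - z₀)) (t • ContinuousLinearMap.id ℝ G) z :=
    (((hasFDerivAt_id z).sub_const z₀).const_smul t).const_add z₀
  refine (hB.hasFDerivAt.comp z h1).congr_fderiv ?_
  ext v
  simp

theorem hasDerivAt_comp_homothety {B : G → V} {z₀ z : G} {t : ℝ}
    (hB : DifferentiableAt ℝ B (z₀ + t • (z - z₀))) :
    HasDerivAt (fun t : ℝ => B (z₀ + t • (z - z₀)))
      (fderiv ℝ B (z₀ + t • (z - z₀)) (z - z₀)) t := by
  have h1 : HasDerivAt (fun t : ℝ => z₀ + t • (z - z₀)) (z - z₀) t := by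
    simpa using ((hasDerivAt_id t).smul_const (z - z₀)).const_add z₀
  exact hB.hasFDerivAt.comp_hasDerivAt t h1

/-- The Poincaré lemma for `2`-forms on an open convex set. -/
theorem exists_primitive_of_closed_two_form {U : Set G} (hU : IsOpen U) (hc : Convex ℝ U)
    {z₀ : G} (hz₀ : z₀ ∈ U) {B : G → G →L[ℝ] G →L[ℝ] ℝ} (hB : ContDiffOn ℝ ∞ B U)
    (hanti : ∀ z ∈ U, ∀ u v, B z u v = -B z v u)
    (hclosed : ∀ z ∈ U, ∀ u v w,
      fderiv ℝ B z u v w - fderiv ℝ B z v u w + fderiv ℝ B z w u v = 0) :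
    ∃ l : G → G →L[ℝ] ℝ, ContDiffOn ℝ ∞ l U ∧
      ∀ z ∈ U, ∀ u w, fderiv ℝ l z u w - fderiv ℝ l z w u = B z u w := by
  set c : G × ℝ → G := fun p => z₀ + p.2 • (p.1 - z₀) with hcdef
  have hcs : ContDiff ℝ ∞ c := by fun_prop
  set W : Set (G × ℝ) := c ⁻¹' U with hWdef
  have hW : IsOpen W := hU.preimage hcs.continuous
  have hUW : ∀ x ∈ U, ∀ t ∈ Set.Icc (0 : ℝ) 1, (x, t) ∈ W := fun x hx t ht =>
    hc.add_smul_sub_mem hz₀ hx ht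
  -- The radial homotopy operator: the primitive is the integral over t of t · B(z₀ + t(z - z₀))(z -
  -- z₀, ·).
  set f : G → ℝ → G →L[ℝ] ℝ := fun z t => t • B (c (z, t)) (z - z₀) with hfdef
  have hBc : ContDiffOn ℝ ∞ (fun p : G × ℝ => B (c p)) W :=
    hB.comp hcs.contDiffOn (fun p hp => hp)
  have hf : ContDiffOn ℝ ∞ (fun p : G × ℝ => f p.1 p.2) W := by
    exact ContDiffOn.smul contDiff_snd.contDiffOn
      (hBc.clm_apply (contDiff_fst.sub contDiff_const).contDiffOn)
  refine ⟨fun z => ∫ t in (0 : ℝ)..1, f z t, contDiffOn_integral hU hW hUW hf, ?_⟩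
  intro z hz u w
  set y := z - z₀
  have hdB : ∀ t ∈ Set.Icc (0 : ℝ) 1, DifferentiableAt ℝ B (c (z, t)) :=
    fun t ht => ((hB.contDiffAt (hU.mem_nhds (hUW z hz t ht))).differentiableAt
      (by simp))
  have hft : ∀ t ∈ Set.Icc (0 : ℝ) 1, ∀ a b, fderiv ℝ (fun x => f x t) z a b =
      t * (t * fderiv ℝ B (c (z, t)) a y b + B (c (z, t)) a b) := by
    intro t ht a b
    have h2 := hasFDerivAt_comp_homothety (V := G →L[ℝ] G →L[ℝ] ℝ) (hdB t ht)
    have h3 := (h2.clm_apply ((hasFDerivAt_id z).sub_const z₀)).const_smul t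
    have h4 : HasFDerivAt (fun x => f x t) _ z := h3
    rw [h4.fderiv]
    simp [y]
    ring
  have hf1 := hf.of_le (m := 1) (by simp)
  have hcf := continuousOn_fderiv_param hW hf1 (hUW z hz)
  have hu : Set.uIcc (0 : ℝ) 1 = Set.Icc 0 1 := Set.uIcc_of_le zero_le_one
  have hev : ∀ a b, fderiv ℝ (fun y => ∫ t in (0 : ℝ)..1, f y t) z a b =
      ∫ t in (0 : ℝ)..1, fderiv ℝ (fun x => f x t) z a b := fun a b => by
    rw [fderiv_integral_apply hW hf1 (hUW z hz),
      intervalIntegral_clm_apply (hcf.clm_apply continuousOn_const)]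
  have hint' : ∀ a b, IntervalIntegrable (fun t => fderiv ℝ (fun x => f x t) z a b)
      MeasureTheory.volume 0 1 := fun a b =>
    ContinuousOn.intervalIntegrable (hu ▸ ((hcf.clm_apply continuousOn_const).clm_apply
      continuousOn_const))
  rw [hev, hev, ← intervalIntegral.integral_sub (hint' _ _) (hint' _ _)]
  -- By closedness, the antisymmetrised derivative of the integrand is the t-derivative of t² B(c(z,
  -- t))(u, w), whose increment over [0, 1] is B(z)(u, w).
  have hFTC := intervalIntegral.integral_eq_sub_of_hasDerivAt (a := 0) (b := 1)
    (f := fun t => t ^ 2 * B (c (z, t)) u w)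
    (f' := fun t => fderiv ℝ (fun x => f x t) z u w - fderiv ℝ (fun x => f x t) z w u)
    (by
      intro t ht
      rw [hu] at ht
      have h2 := hasDerivAt_comp_homothety (V := G →L[ℝ] G →L[ℝ] ℝ) (hdB t ht)
      have h3 := (h2.clm_apply (hasDerivAt_const t u)).clm_apply (hasDerivAt_const t w)
      have h4 := (hasDerivAt_pow 2 t).mul h3
      refine h4.congr_deriv ?_
      rw [hft t ht, hft t ht]
      have e1 := hclosed _ (hUW z hz t ht) u y w
      have e2 := hanti _ (hUW z hz t ht) w u
      -- Antisymmetry holds on an open set, so it may be differentiated.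
      have e3 : fderiv ℝ B (c (z, t)) w u y = - fderiv ℝ B (c (z, t)) w y u := by
        have k1 : HasFDerivAt (fun x => B x u y) _ (c (z, t)) :=
          ((hdB t ht).hasFDerivAt.clm_apply (hasFDerivAt_const u _)).clm_apply (hasFDerivAt_const y _)
        have k2 : HasFDerivAt (fun x => B x y u) _ (c (z, t)) :=
          ((hdB t ht).hasFDerivAt.clm_apply (hasFDerivAt_const y _)).clm_apply (hasFDerivAt_const u _)
        have k3 := k1.unique ((k2.neg).congr_of_eventuallyEq (by
          filter_upwards [hU.mem_nhds (hUW z hz t ht)] with x hx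
          exact hanti x hx u y))
        have := congrArg (fun l => l w) k3
        simpa using this
      rw [e3] at e1
      change (2 : ℕ) * t ^ (2 - 1) * B (c (z, t)) u w + t ^ 2 * ((fderiv ℝ B (c (z, t)) y u +
        B (c (z, t)) 0) w + B (c (z, t)) u 0) = _
      simp only [map_zero, add_zero]
      rw [e2]
      push_cast
      linear_combination (-t ^ 2) * e1)
    ((hint' _ _).sub (hint' _ _))
  rw [hFTC]
  simp [hcdef]

end Calculus

/-! ### Momentum coordinates for a closed 2-form with isotropic slices -/

section Momentum

universe v w

variable {E : Type v} {K : Type w} [NormedAddCommGroup E] [NormedSpace ℝ E]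
  [NormedAddCommGroup K] [NormedSpace ℝ K] {U : Set E} {C : Set K}

/-- The fibrewise primitive of a family of `1`-forms closed along the fibres. -/
theorem exists_fibre_primitive (hU : IsOpen U) (hC : IsOpen C) (hc : Convex ℝ C) {k₀ : K}
    (hk₀ : k₀ ∈ C) {l : E × K → (E × K) →L[ℝ] ℝ} (hl : ContDiffOn ℝ ∞ l (U ×ˢ C))
    (hsymm : ∀ z ∈ U ×ˢ C, ∀ k k' : K, fderiv ℝ l z (0, k) (0, k') = fderiv ℝ l z (0, k') (0, k)) :
    ∃ g : E × K → ℝ, ContDiffOn ℝ ∞ g (U ×ˢ C) ∧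
      ∀ z ∈ U ×ˢ C, ∀ k : K, fderiv ℝ g z (0, k) = l z (0, k) := by
  have hUC : IsOpen (U ×ˢ C) := hU.prod hC
  set c : (E × K) × ℝ → E × K := fun p => (p.1.1, k₀ + p.2 • (p.1.2 - k₀)) with hcdef
  have hcs : ContDiff ℝ ∞ c := by fun_prop
  set W : Set ((E × K) × ℝ) := c ⁻¹' (U ×ˢ C) with hWdef
  have hW : IsOpen W := hUC.preimage hcs.continuous
  have hUW : ∀ x ∈ U ×ˢ C, ∀ t ∈ Set.Icc (0 : ℝ) 1, (x, t) ∈ W := fun x hx t ht =>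
    ⟨hx.1, hc.add_smul_sub_mem hk₀ hx.2 ht⟩
  set f : E × K → ℝ → (E × K) →L[ℝ] ℝ := fun z t => l (c (z, t)) with hfdef
  have hf : ContDiffOn ℝ ∞ (fun p : (E × K) × ℝ => f p.1 p.2) W :=
    hl.comp hcs.contDiffOn (fun p hp => hp)
  have hf1 := hf.of_le (m := 1) (by simp)
  have hI := contDiffOn_integral hUC hW hUW hf
  -- The radial integral of `l` in the `K` directions alone; the point of `E` is a parameter.
  refine ⟨fun z => (∫ t in (0 : ℝ)..1, f z t) (0, z.2 - k₀), hI.clm_apply (by fun_prop), ?_⟩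
  intro z hz k
  have hu : Set.uIcc (0 : ℝ) 1 = Set.Icc 0 1 := Set.uIcc_of_le zero_le_one
  set y : K := z.2 - k₀ with hy
  have hdl : ∀ t ∈ Set.Icc (0 : ℝ) 1, DifferentiableAt ℝ l (c (z, t)) :=
    fun t ht => (hl.contDiffAt (hUC.mem_nhds (hUW z hz t ht))).differentiableAt (by simp)
  have hcf := continuousOn_fderiv_param hW hf1 (hUW z hz)
  have hc0 : ContinuousOn (fun t => f z t) (Set.Icc 0 1) :=
    hf.continuousOn.comp (f := fun t : ℝ => (z, t)) (by fun_prop) (hUW z hz)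
  have hft : ∀ t ∈ Set.Icc (0 : ℝ) 1, fderiv ℝ (fun x => f x t) z (0, k) (0, y) =
      t * fderiv ℝ l (c (z, t)) (0, k) (0, y) := by
    intro t ht
    have h1 : HasFDerivAt (fun x : E × K => c (x, t))
        ((ContinuousLinearMap.fst ℝ E K).prod (t • ContinuousLinearMap.snd ℝ E K)) z :=
      hasFDerivAt_fst.prodMk (((hasFDerivAt_snd.sub_const k₀).const_smul t).const_add k₀)
    have h2 := ((hdl t ht).hasFDerivAt.comp z h1).fderiv
    change fderiv ℝ (l ∘ fun x : E × K => c (x, t)) z (0, k) (0, y) = _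
    rw [h2]
    have h3 : ((ContinuousLinearMap.fst ℝ E K).prod (t • ContinuousLinearMap.snd ℝ E K)) (0, k)
        = t • ((0, k) : E × K) := by simp
    rw [ContinuousLinearMap.comp_apply, h3, ContinuousLinearMap.map_smul]
    rfl
  have hder : fderiv ℝ (fun z : E × K => (∫ t in (0 : ℝ)..1, f z t) (0, z.2 - k₀)) z (0, k) =
      (∫ t in (0 : ℝ)..1, t * fderiv ℝ l (c (z, t)) (0, k) (0, y)) +
        ∫ t in (0 : ℝ)..1, l (c (z, t)) (0, k) := by
    have h1 := hasFDerivAt_integral_of_contDiffOn hW hf1 (hUW z hz)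
    have h2 : HasFDerivAt (fun z : E × K => ((0, z.2 - k₀) : E × K))
        ((0 : (E × K) →L[ℝ] E).prod (ContinuousLinearMap.snd ℝ E K)) z :=
      (hasFDerivAt_const 0 z).prodMk (hasFDerivAt_snd.sub_const k₀)
    have h3 := h1.clm_apply h2
    have e1 := fderiv_integral_apply hW hf1 (hUW z hz) (0, k)
    rw [h1.fderiv] at e1
    rw [h3.fderiv]
    simp only [add_apply, ContinuousLinearMap.comp_apply,
      ContinuousLinearMap.prod_apply, ContinuousLinearMap.coe_snd',
      ContinuousLinearMap.flip_apply]
    rw [e1, intervalIntegral_clm_apply (hcf.clm_apply continuousOn_const), add_comm]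
    congr 1
    · refine intervalIntegral.integral_congr fun t ht => hft t (hu ▸ ht)
    · exact intervalIntegral_clm_apply hc0 _
  have hF1 : ContinuousOn (fun t => t * fderiv ℝ l (c (z, t)) (0, k) (0, y)) (Set.Icc 0 1) :=
    ((hcf.clm_apply continuousOn_const).clm_apply continuousOn_const).congr
      fun t ht => (hft t ht).symm
  have hF2 : ContinuousOn (fun t => l (c (z, t)) (0, k)) (Set.Icc 0 1) :=
    hc0.clm_apply continuousOn_const
  rw [hder, ← intervalIntegral.integral_add (hu ▸ hF1).intervalIntegrable
    (hu ▸ hF2).intervalIntegrable]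
  -- Symmetry of the derivative of `l` along the slices turns the integrand into the derivative of t
  -- · l(c(z, t))(0, k).
  have hFTC := intervalIntegral.integral_eq_sub_of_hasDerivAt (a := 0) (b := 1)
    (f := fun t => t * l (c (z, t)) (0, k))
    (f' := fun t => t * fderiv ℝ l (c (z, t)) (0, k) (0, y) + l (c (z, t)) (0, k))
    (by
      intro t ht
      rw [hu] at ht
      have h1 : HasDerivAt (fun t : ℝ => c (z, t)) ((0, y) : E × K) t := by
        refine HasDerivAt.prodMk (hasDerivAt_const t z.1) ?_
        simpa using ((hasDerivAt_id t).smul_const (z.2 - k₀)).const_add k₀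
      have h2 : HasDerivAt (fun t => l (c (z, t))) _ t :=
        (hdl t ht).hasFDerivAt.comp_hasDerivAt t h1
      have h3 := h2.clm_apply (hasDerivAt_const t ((0, k) : E × K))
      refine ((hasDerivAt_id t).mul h3).congr_deriv ?_
      rw [hsymm _ (hUW z hz t ht) k y]
      simp
      ring)
    ((hu ▸ hF1).intervalIntegrable.add (hu ▸ hF2).intervalIntegrable)
  rw [hFTC]
  simp [hcdef]

/-- A closed `2`-form on a product for which the slices `{q} × C` are isotropic is
`∑ dp_i ∧ dq_i` for suitable functions `p_i`. -/
theorem exists_momentum (hU : IsOpen U) (hUc : Convex ℝ U) (hC : IsOpen C) (hCc : Convex ℝ C)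
    {q₀ : E} (hq₀ : q₀ ∈ U) {k₀ : K} (hk₀ : k₀ ∈ C)
    {B : E × K → (E × K) →L[ℝ] (E × K) →L[ℝ] ℝ} (hB : ContDiffOn ℝ ∞ B (U ×ˢ C))
    (hanti : ∀ z ∈ U ×ˢ C, ∀ u v, B z u v = -B z v u)
    (hclosed : ∀ z ∈ U ×ˢ C, ∀ u v w,
      fderiv ℝ B z u v w - fderiv ℝ B z v u w + fderiv ℝ B z w u v = 0)
    (hvert : ∀ z ∈ U ×ˢ C, ∀ k k' : K, B z (0, k) (0, k') = 0) :
    ∃ p : E × K → E →L[ℝ] ℝ, ContDiffOn ℝ ∞ p (U ×ˢ C) ∧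
      ∀ z ∈ U ×ˢ C, ∀ u w, B z u w = fderiv ℝ p z u w.1 - fderiv ℝ p z w u.1 := by
  have hUC : IsOpen (U ×ˢ C) := hU.prod hC
  obtain ⟨l, hl, hlB⟩ := exists_primitive_of_closed_two_form hUC (hUc.prod hCc)
    (z₀ := (q₀, k₀)) ⟨hq₀, hk₀⟩ hB hanti hclosed
  -- Since B vanishes on pairs of vertical vectors, its primitive `l` is closed along each slice,
  -- hence equal to some dg there.
  obtain ⟨g, hg, hgl⟩ := exists_fibre_primitive hU hC hCc hk₀ hl (fun z hz k k' => by
    have := hlB z hz (0, k) (0, k')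
    rw [hvert z hz] at this
    linarith)
  have hdg : ContDiffOn ℝ ∞ (fderiv ℝ g) (U ×ˢ C) := hg.fderiv_of_isOpen hUC (by simp)
  have hm : ContDiffOn ℝ ∞ (fun z => l z - fderiv ℝ g z) (U ×ˢ C) := hl.sub hdg
  -- The form l - dg is still a primitive of B and now annihilates vertical vectors. It thus has the
  -- shape ∑ p_i dq_i, and its restriction to `E` is p.
  refine ⟨fun z => (l z - fderiv ℝ g z).comp (ContinuousLinearMap.inl ℝ E K),
    hm.clm_comp contDiffOn_const, ?_⟩
  intro z hz u w
  have hzn := hUC.mem_nhds hz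
  have dl : HasFDerivAt l (fderiv ℝ l z) z :=
    ((hl.contDiffAt hzn).differentiableAt (by simp)).hasFDerivAt
  have ddg : HasFDerivAt (fderiv ℝ g) (fderiv ℝ (fderiv ℝ g) z) z :=
    ((hdg.contDiffAt hzn).differentiableAt (by simp)).hasFDerivAt
  have hsym : fderiv ℝ (fderiv ℝ g) z u w = fderiv ℝ (fderiv ℝ g) z w u :=
    ((hg.contDiffAt hzn).isSymmSndFDerivAt (by
      rw [minSmoothness_of_isRCLikeNormedField]
      exact WithTop.coe_le_coe.2 le_top)) u w
  have hzero : ∀ a : E × K, ∀ k : K, (fderiv ℝ l z a - fderiv ℝ (fderiv ℝ g) z a) (0, k) = 0 := by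
    intro a k
    have h1 := (dl.sub ddg).clm_apply (hasFDerivAt_const ((0, k) : E × K) z)
    have h2 : HasFDerivAt (fun z => (l z - fderiv ℝ g z) ((0, k) : E × K))
        (0 : (E × K) →L[ℝ] ℝ) z := by
      refine (hasFDerivAt_const (0 : ℝ) z).congr_of_eventuallyEq ?_
      filter_upwards [hzn] with z' hz'
      have := hgl z' hz' k
      simp [this]
    have := congrArg (fun L => L a) (h1.unique h2)
    simpa using this
  have hp : ∀ a : E × K, ∀ b : E, fderiv ℝ (fun z => (l z - fderiv ℝ g z).comp
      (ContinuousLinearMap.inl ℝ E K)) z a b =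
      (fderiv ℝ l z a - fderiv ℝ (fderiv ℝ g) z a) (b, 0) := by
    intro a b
    have h0 : HasFDerivAt (fun z => (l z - fderiv ℝ g z).comp (ContinuousLinearMap.inl ℝ E K)) _ z
      := (((hm.clm_comp contDiffOn_const).contDiffAt hzn).differentiableAt (by simp)).hasFDerivAt
    have h1 := h0.clm_apply (hasFDerivAt_const b z)
    have h2 := (dl.sub ddg).clm_apply (hasFDerivAt_const ((b, 0) : E × K) z)
    have := congrArg (fun L => L a) (h1.unique h2)
    simpa using this
  have hsplit : ∀ a b : E × K, (fderiv ℝ l z a - fderiv ℝ (fderiv ℝ g) z a) (b.1, 0) =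
      (fderiv ℝ l z a - fderiv ℝ (fderiv ℝ g) z a) b := by
    intro a b
    have h1 : b = (b.1, 0) + (0, b.2) := by simp
    conv_rhs => rw [h1, map_add, hzero, add_zero]
  rw [hp, hp, hsplit, hsplit, ← hlB z hz]
  simp only [sub_apply]
  linarith

end Momentum

/-! ### Differential forms and maps from vector spaces -/

section AlternatingForms

variable {G : Type*} [NormedAddCommGroup G] [NormedSpace ℝ G]

theorem alternating_add_left (η : G [⋀^Fin 2]→L[ℝ] ℝ) (u u' v : G) :
    η ![u + u', v] = η ![u, v] + η ![u', v] := by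
  have e : ∀ w, Function.update ![u, v] 0 w = ![w, v] := fun w => by
    ext i; fin_cases i <;> simp
  have := η.map_update_add ![u, v] 0 u u'
  simpa only [e] using this

theorem alternating_smul_left (η : G [⋀^Fin 2]→L[ℝ] ℝ) (c : ℝ) (u v : G) :
    η ![c • u, v] = c * η ![u, v] := by
  have e : ∀ w, Function.update ![u, v] 0 w = ![w, v] := fun w => by
    ext i; fin_cases i <;> simp
  have := η.map_update_smul ![u, v] 0 c u
  simpa only [e, smul_eq_mul] using this

theorem alternating_swap (η : G [⋀^Fin 2]→L[ℝ] ℝ) (u v : G) : η ![u, v] = -η ![v, u] := by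
  have := η.map_swap ![v, u] (i := 0) (j := 1) (by decide)
  have e : (![v, u] ∘ Equiv.swap (0 : Fin 2) 1 : Fin 2 → G) = ![u, v] := by
    ext i; fin_cases i <;> simp
  rw [e] at this
  exact this

theorem alternating_add_right (η : G [⋀^Fin 2]→L[ℝ] ℝ) (u v v' : G) :
    η ![u, v + v'] = η ![u, v] + η ![u, v'] := by
  rw [alternating_swap, alternating_add_left, alternating_swap η v, alternating_swap η v']
  ring

theorem alternating_smul_right (η : G [⋀^Fin 2]→L[ℝ] ℝ) (c : ℝ) (u v : G) :
    η ![u, c • v] = c * η ![u, v] := by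
  rw [alternating_swap, alternating_smul_left, alternating_swap η v]
  ring

theorem alternating_two_bound (η : G [⋀^Fin 2]→L[ℝ] ℝ) (u v : G) :
    ‖η ![u, v]‖ ≤ ‖η‖ * ‖u‖ * ‖v‖ := by
  have := η.le_opNorm ![u, v]
  simpa [Fin.prod_univ_two, mul_assoc] using this

/-- An alternating form of degree two as a bilinear form. -/
def toBilin : (G [⋀^Fin 2]→L[ℝ] ℝ) →L[ℝ] G →L[ℝ] G →L[ℝ] ℝ :=
  LinearMap.mkContinuous
    { toFun := fun η => LinearMap.mkContinuous₂
        (LinearMap.mk₂ ℝ (fun u v => η ![u, v]) (alternating_add_left η) (alternating_smul_left η)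
          (alternating_add_right η) (alternating_smul_right η)) ‖η‖ (alternating_two_bound η)
      map_add' := fun _ _ => rfl
      map_smul' := fun _ _ => rfl } 1 (fun η => by
        rw [one_mul]
        exact LinearMap.mkContinuous₂_norm_le _ (norm_nonneg η) (alternating_two_bound η))

@[simp]
theorem toBilin_apply (η : G [⋀^Fin 2]→L[ℝ] ℝ) (u v : G) : toBilin η u v = η ![u, v] := rfl

/-- The canonical symplectic form of `E × E^*`. -/
def stdForm (E : Type*) [NormedAddCommGroup E] [NormedSpace ℝ E] (u w : E × (E →L[ℝ] ℝ)) : ℝ :=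
  u.2 w.1 - w.2 u.1

end AlternatingForms

/-! ### Pullback of forms on a manifold to vector spaces -/

section Pullback

variable {G : Type*} [NormedAddCommGroup G] [NormedSpace ℝ G]
  {E' H' : Type*} [NormedAddCommGroup E'] [NormedSpace ℝ E'] [TopologicalSpace H']
  (I' : ModelWithCorners ℝ E' H')
  {M' : Type*} [TopologicalSpace M'] [ChartedSpace H' M'] [IsManifold I' ∞ M']

/-- The derivatives of the chart and of its inverse cancel. This reduces questions about forms on
manifolds to calculus in the model space, with one fixed chart for all nearby points. -/
theorem pullback_eq_inChart {k : ℕ} (η : DiffForm I' M' k) {ρ : G → M'} {x : M'} {z : G}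
    (hρ : MDifferentiableAt 𝓘(ℝ, G) I' ρ z) (hx : ρ z ∈ (extChartAt I' x).source) :
    DiffForm.pullback 𝓘(ℝ, G) I' η ρ z =
      (DiffForm.inChart I' η x (extChartAt I' x (ρ z))).compContinuousLinearMap
        (fderiv ℝ (fun z => extChartAt I' x (ρ z)) z) := by
  have hx' : ρ z ∈ (chartAt H' x).source := by rwa [extChartAt_source] at hx
  have h1 : fderiv ℝ (fun z => extChartAt I' x (ρ z)) z =
      (mfderiv I' 𝓘(ℝ, E') (extChartAt I' x) (ρ z)).comp (mfderiv 𝓘(ℝ, G) I' ρ z) := by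
    rw [← mfderiv_eq_fderiv]
    exact mfderiv_comp z (mdifferentiableAt_extChartAt hx') hρ
  have h2 : (mfderivWithin 𝓘(ℝ, E') I' (extChartAt I' x).symm (Set.range I')
      (extChartAt I' x (ρ z))).comp (fderiv ℝ (fun z => extChartAt I' x (ρ z)) z) =
      mfderiv 𝓘(ℝ, G) I' ρ z := by
    have := mfderivWithin_extChartAt_symm_comp_mfderiv_extChartAt' (I := I') hx
    refine ContinuousLinearMap.ext fun v => ?_
    have e1 := congrArg (fun L => (mfderivWithin 𝓘(ℝ, E') I' (extChartAt I' x).symm (Set.range I')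
      (extChartAt I' x (ρ z))) (L v)) h1
    exact e1.trans (congrArg (fun L => L (mfderiv 𝓘(ℝ, G) I' ρ z v)) this)
  ext v
  have h3 : (extChartAt I' x).symm (extChartAt I' x (ρ z)) = ρ z := (extChartAt I' x).left_inv hx
  have h4 := fun i => congrArg (fun L => L (v i)) h2
  let η' : M' → E' [⋀^Fin k]→L[ℝ] ℝ := η
  change η' (ρ z) (fun i => mfderiv 𝓘(ℝ, G) I' ρ z (v i)) =
    η' ((extChartAt I' x).symm (extChartAt I' x (ρ z))) (fun i => (mfderivWithin 𝓘(ℝ, E') I'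
      (extChartAt I' x).symm (Set.range I') (extChartAt I' x (ρ z)))
      (fderiv ℝ (fun z => extChartAt I' x (ρ z)) z (v i)))
  rw [h3]
  congr 1
  funext i
  exact (h4 i).symm

omit [IsManifold I' ∞ M'] in
theorem contDiffAt_extChartAt_comp {n : WithTop ℕ∞} (hn : n ≤ ∞) {ρ : G → M'} {z : G}
    (hρ : ContMDiffAt 𝓘(ℝ, G) I' n ρ z) :
    ContDiffAt ℝ n (fun z' => extChartAt I' (ρ z) (ρ z')) z := by
  have h : ContMDiffAt I' 𝓘(ℝ, E') n (extChartAt I' (ρ z)) (ρ z) :=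
    (contMDiffAt_extChartAt (I := I') (n := ∞)).of_le hn
  exact (h.comp z hρ).contDiffAt

theorem pullback_eventuallyEq {k : ℕ} (η : DiffForm I' M' k) {ρ : G → M'} {z : G}
    (hρ : ContMDiffAt 𝓘(ℝ, G) I' 1 ρ z) :
    DiffForm.pullback 𝓘(ℝ, G) I' η ρ =ᶠ[𝓝 z] fun z' =>
      (DiffForm.inChart I' η (ρ z) (extChartAt I' (ρ z) (ρ z'))).compContinuousLinearMap
        (fderiv ℝ (fun z' => extChartAt I' (ρ z) (ρ z')) z') := by
  have : IsManifold I' 1 M' := IsManifold.of_le (n := ∞) (by simp)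
  filter_upwards [(contMDiffAt_iff_contMDiffAt_nhds (by simp)).1 hρ, hρ.continuousAt.preimage_mem_nhds
    (extChartAt_source_mem_nhds (I := I') (ρ z))] with z' h1 h2
  exact pullback_eq_inChart I' η (h1.mdifferentiableAt one_ne_zero) h2

/-- The exterior derivative at ρ(z) is defined in the preferred chart at ρ(z), whose derivative at
that point is the identity. So naturality for maps between vector spaces is enough. -/
theorem extDeriv_pullback_form [I'.Boundaryless] {k : ℕ} {η : DiffForm I' M' k} {ρ : G → M'}
    {z : G} (hη : DifferentiableAt ℝ (DiffForm.inChart I' η (ρ z)) (extChartAt I' (ρ z) (ρ z)))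
    (hρ : ContMDiffAt 𝓘(ℝ, G) I' ∞ ρ z) :
    _root_.extDeriv (DiffForm.pullback 𝓘(ℝ, G) I' η ρ) z =
      DiffForm.pullback 𝓘(ℝ, G) I' (DiffForm.extDeriv I' η) ρ z := by
  have : IsManifold I' 1 M' := IsManifold.of_le (n := ∞) (by simp)
  rw [(pullback_eventuallyEq I' η (hρ.of_le (by simp))).extDeriv_eq]
  have h1 := contDiffAt_extChartAt_comp I' le_rfl hρ
  refine (_root_.extDeriv_pullback (f := fun z' => extChartAt I' (ρ z) (ρ z')) hη h1 (by
      rw [minSmoothness_of_isRCLikeNormedField]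
      exact WithTop.coe_le_coe.2 le_top)).trans ?_
  have hmd : MDifferentiableAt 𝓘(ℝ, G) I' ρ z := hρ.mdifferentiableAt (by simp)
  have h2 : fderiv ℝ (fun z' => extChartAt I' (ρ z) (ρ z')) z = mfderiv 𝓘(ℝ, G) I' ρ z := by
    rw [← mfderiv_eq_fderiv]
    refine (mfderiv_comp z (mdifferentiableAt_extChartAt (mem_chart_source H' (ρ z)))
      hmd).trans ?_
    rw [mfderiv_extChartAt_self]
    rfl
  rw [h2, DiffForm.pullback, DiffForm.extDeriv]
  rw [I'.range_eq_univ, extDerivWithin_univ]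
  rfl

end Pullback

/-! ### Pulled back 2-forms as families of bilinear forms -/

section PullbackTwoForm

variable {G : Type*} [NormedAddCommGroup G] [NormedSpace ℝ G] [FiniteDimensional ℝ G]
  {F : Type*} [NormedAddCommGroup F] [NormedSpace ℝ F]
  {X : Type*} [TopologicalSpace X] [ChartedSpace F X] [IsManifold 𝓘(ℝ, F) ∞ X]
  (η : DiffForm 𝓘(ℝ, F) X 2)

/-- The pullback of a `2`-form under a map from a vector space, as a family of bilinear forms. -/
def pullBilin (ρ : G → X) (z : G) : G →L[ℝ] G →L[ℝ] ℝ :=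
  toBilin (DiffForm.pullback 𝓘(ℝ, G) 𝓘(ℝ, F) η ρ z)

omit [FiniteDimensional ℝ G] [IsManifold 𝓘(ℝ, F) ∞ X] in
theorem pullBilin_apply (ρ : G → X) (z u v : G) : pullBilin η ρ z u v =
    η (ρ z) ![mfderiv 𝓘(ℝ, G) 𝓘(ℝ, F) ρ z u, mfderiv 𝓘(ℝ, G) 𝓘(ℝ, F) ρ z v] := by
  change η (ρ z) (fun i => mfderiv 𝓘(ℝ, G) 𝓘(ℝ, F) ρ z (![u, v] i)) = _
  congr 1
  ext i
  fin_cases i <;> rfl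

variable {η}

omit [FiniteDimensional ℝ G] in
theorem contDiffAt_pullBilin (hη : DiffForm.IsSmooth 𝓘(ℝ, F) η) {ρ : G → X} {z : G}
    (hρ : ContMDiffAt 𝓘(ℝ, G) 𝓘(ℝ, F) ∞ ρ z) : ContDiffAt ℝ ∞ (pullBilin η ρ) z := by
  have h0 : ContDiffAt ℝ ∞ (DiffForm.inChart 𝓘(ℝ, F) η (ρ z)) (extChartAt 𝓘(ℝ, F) (ρ z) (ρ z)) :=
    (hη (ρ z)).contDiffAt (extChartAt_target_mem_nhds (ρ z))
  have h1 := contDiffAt_extChartAt_comp 𝓘(ℝ, F) le_rfl hρ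
  have h2 : ContDiffAt ℝ ∞ (fun z' => DiffForm.inChart 𝓘(ℝ, F) η (ρ z)
      (extChartAt 𝓘(ℝ, F) (ρ z) (ρ z'))) z :=
    ContDiffAt.comp (g := DiffForm.inChart 𝓘(ℝ, F) η (ρ z)) z h0 h1
  have h3 : ContDiffAt ℝ ∞ (fun z' => toBilin (DiffForm.inChart 𝓘(ℝ, F) η (ρ z)
      (extChartAt 𝓘(ℝ, F) (ρ z) (ρ z')))) z :=
    ContDiffAt.comp (g := toBilin (G := F)) z (toBilin (G := F)).contDiff.contDiffAt h2
  have h4 : ContDiffAt ℝ ∞ (fderiv ℝ (fun z' => extChartAt 𝓘(ℝ, F) (ρ z) (ρ z'))) z :=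
    h1.fderiv_right (by simp)
  have h5 : ContDiffAt ℝ ∞ (fun z' => (toBilin (DiffForm.inChart 𝓘(ℝ, F) η (ρ z)
      (extChartAt 𝓘(ℝ, F) (ρ z) (ρ z')))).bilinearComp
      (fderiv ℝ (fun z' => extChartAt 𝓘(ℝ, F) (ρ z) (ρ z')) z')
      (fderiv ℝ (fun z' => extChartAt 𝓘(ℝ, F) (ρ z) (ρ z')) z')) z := by
    -- Precomposition in one slot is visibly smooth. Flipping, precomposing again and flipping back
    -- handles the other slot.
    have k1 := h3.clm_comp h4
    have k2 : ContDiffAt ℝ ∞ (fun z' => ((toBilin (DiffForm.inChart 𝓘(ℝ, F) η (ρ z)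
        (extChartAt 𝓘(ℝ, F) (ρ z) (ρ z')))).comp
        (fderiv ℝ (fun z' => extChartAt 𝓘(ℝ, F) (ρ z) (ρ z')) z')).flip) z :=
      ContDiffAt.comp (g := fun L : G →L[ℝ] F →L[ℝ] ℝ => L.flip) z
        (ContinuousLinearMap.flipₗᵢ ℝ G F ℝ).contDiff.contDiffAt k1
    exact ContDiffAt.comp (g := fun L : G →L[ℝ] G →L[ℝ] ℝ => L.flip) z
      (ContinuousLinearMap.flipₗᵢ ℝ G G ℝ).contDiff.contDiffAt (k2.clm_comp h4)
  refine h5.congr_of_eventuallyEq ?_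
  filter_upwards [pullback_eventuallyEq 𝓘(ℝ, F) η (hρ.of_le (by simp))] with z' hz'
  refine ContinuousLinearMap.ext fun u => ContinuousLinearMap.ext fun v => ?_
  have := congrArg (fun L => L ![u, v]) hz'
  refine this.trans ?_
  change DiffForm.inChart 𝓘(ℝ, F) η (ρ z) (extChartAt 𝓘(ℝ, F) (ρ z) (ρ z'))
    (fun i => fderiv ℝ (fun z' => extChartAt 𝓘(ℝ, F) (ρ z) (ρ z')) z' (![u, v] i)) = _
  simp only [ContinuousLinearMap.bilinearComp_apply, toBilin_apply]
  congr 1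
  ext i
  fin_cases i <;> rfl

omit [FiniteDimensional ℝ G] in
-- The left side is the value on (u, v, w) of the exterior derivative of the pullback, which
-- vanishes by naturality.
theorem pullBilin_closed (hη : DiffForm.IsSmooth 𝓘(ℝ, F) η) (hc : DiffForm.IsClosed 𝓘(ℝ, F) η)
    {ρ : G → X} {z : G} (hρ : ContMDiffAt 𝓘(ℝ, G) 𝓘(ℝ, F) ∞ ρ z) (u v w : G) :
    fderiv ℝ (pullBilin η ρ) z u v w - fderiv ℝ (pullBilin η ρ) z v u w
      + fderiv ℝ (pullBilin η ρ) z w u v = 0 := by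
  have h0 : ContDiffAt ℝ ∞ (DiffForm.inChart 𝓘(ℝ, F) η (ρ z)) (extChartAt 𝓘(ℝ, F) (ρ z) (ρ z)) :=
    (hη (ρ z)).contDiffAt (extChartAt_target_mem_nhds (ρ z))
  have h1 := contDiffAt_extChartAt_comp 𝓘(ℝ, F) le_rfl hρ
  let P : G → G [⋀^Fin 2]→L[ℝ] ℝ := DiffForm.pullback 𝓘(ℝ, G) 𝓘(ℝ, F) η ρ
  have hd : DifferentiableAt ℝ P z := by
    refine DifferentiableAt.congr_of_eventuallyEq ?_
      (pullback_eventuallyEq 𝓘(ℝ, F) η (hρ.of_le (by simp)))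
    refine DifferentiableAt.continuousAlternatingMapCompContinuousLinearMap ?_ ?_
    · exact (h0.comp z h1).differentiableAt (by simp)
    · exact (h1.fderiv_right (m := ∞) (by simp)).differentiableAt (by simp)
  have hzero : _root_.extDeriv P z = 0 := by
    refine (extDeriv_pullback_form 𝓘(ℝ, F) (h0.differentiableAt (by simp)) hρ).trans ?_
    rw [DiffForm.pullback,
      hc (ρ z)]
    rfl
  have hB : HasFDerivAt (pullBilin η ρ)
      (toBilin.comp (fderiv ℝ P z)) z :=
    toBilin.hasFDerivAt.comp z hd.hasFDerivAt
  rw [hB.fderiv]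
  have := congrArg (fun L => L ![u, v, w]) hzero
  simp only [_root_.extDeriv, ContinuousAlternatingMap.alternatizeUncurryFin_apply] at this
  erw [Fin.sum_univ_three] at this
  have e0 : (0 : Fin 3).removeNth ![u, v, w] = ![v, w] := by ext i; fin_cases i <;> rfl
  have e1 : (1 : Fin 3).removeNth ![u, v, w] = ![u, w] := by ext i; fin_cases i <;> rfl
  have e2 : (2 : Fin 3).removeNth ![u, v, w] = ![u, v] := by ext i; fin_cases i <;> rfl
  rw [e0, e1, e2] at this
  simp at this
  simp
  linarith

end PullbackTwoForm

/-! ### Cotangent coordinates -/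

section CotangentCoordinates

variable {E : Type*} [NormedAddCommGroup E] [NormedSpace ℝ E]
  {Q : Type*} [TopologicalSpace Q] [ChartedSpace E Q]

/-- The derivative of the preferred chart at `q₀`. -/
def chartDeriv (q₀ q : Q) : E →L[ℝ] E := mfderiv 𝓘(ℝ, E) 𝓘(ℝ, E) (extChartAt 𝓘(ℝ, E) q₀) q

/-- The derivative of the inverse of the preferred chart at `q₀`. -/
def chartDerivSymm (q₀ : Q) (y : E) : E →L[ℝ] E :=
  mfderiv 𝓘(ℝ, E) 𝓘(ℝ, E) (extChartAt 𝓘(ℝ, E) q₀).symm y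

/-- The cotangent coordinates induced by the preferred chart at `q₀`. -/
def cot (q₀ : Q) (z : E × (E →L[ℝ] ℝ)) : CotangentBundle E Q :=
  ⟨(extChartAt 𝓘(ℝ, E) q₀).symm z.1, z.2.comp (chartDeriv (E := E) q₀ ((extChartAt 𝓘(ℝ, E) q₀).symm z.1))⟩

/-- A covector as a linear form on the model space. -/
def CotangentSpace.toModel {q : Q} (ξ : CotangentSpace E q) : E →L[ℝ] ℝ := ξ

/-- The inverse of the cotangent coordinates induced by the preferred chart at `q₀`. -/
def cotInv (q₀ : Q) (w : CotangentBundle E Q) : E × (E →L[ℝ] ℝ) :=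
  (extChartAt 𝓘(ℝ, E) q₀ w.proj,
    (CotangentSpace.toModel w.snd).comp (chartDerivSymm q₀ (extChartAt 𝓘(ℝ, E) q₀ w.proj)))

@[simp]
theorem cot_proj (q₀ : Q) (z : E × (E →L[ℝ] ℝ)) :
    (cot q₀ z).proj = (extChartAt 𝓘(ℝ, E) q₀).symm z.1 := rfl

variable [IsManifold 𝓘(ℝ, E) ∞ Q]

theorem chartDeriv_comp_symm {q₀ : Q} {y : E} (hy : y ∈ (extChartAt 𝓘(ℝ, E) q₀).target) :
    (chartDeriv q₀ ((extChartAt 𝓘(ℝ, E) q₀).symm y)).comp (chartDerivSymm q₀ y) =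
      ContinuousLinearMap.id ℝ E := by
  have : IsManifold 𝓘(ℝ, E) 1 Q := IsManifold.of_le (n := ∞) (by simp)
  have := mfderiv_extChartAt_comp_mfderivWithin_extChartAt_symm (I := 𝓘(ℝ, E)) hy
  rw [modelWithCornersSelf_coe, Set.range_id, mfderivWithin_univ] at this
  exact this

theorem chartDerivSymm_comp {q₀ q : Q} (hq : q ∈ (extChartAt 𝓘(ℝ, E) q₀).source) :
    (chartDerivSymm q₀ (extChartAt 𝓘(ℝ, E) q₀ q)).comp (chartDeriv q₀ q) =
      ContinuousLinearMap.id ℝ E := by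
  have : IsManifold 𝓘(ℝ, E) 1 Q := IsManifold.of_le (n := ∞) (by simp)
  have := mfderivWithin_extChartAt_symm_comp_mfderiv_extChartAt' (I := 𝓘(ℝ, E)) hq
  rw [modelWithCornersSelf_coe, Set.range_id, mfderivWithin_univ] at this
  exact this

theorem cotInv_cot {q₀ : Q} {z : E × (E →L[ℝ] ℝ)} (hz : z.1 ∈ (extChartAt 𝓘(ℝ, E) q₀).target) :
    cotInv q₀ (cot q₀ z) = z := by
  refine Prod.ext ((extChartAt 𝓘(ℝ, E) q₀).right_inv hz) ?_
  change (z.2.comp (chartDeriv q₀ ((extChartAt 𝓘(ℝ, E) q₀).symm z.1))).comp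
    (chartDerivSymm q₀ (extChartAt 𝓘(ℝ, E) q₀ ((extChartAt 𝓘(ℝ, E) q₀).symm z.1))) = z.2
  rw [(extChartAt 𝓘(ℝ, E) q₀).right_inv hz, ContinuousLinearMap.comp_assoc,
    chartDeriv_comp_symm hz, ContinuousLinearMap.comp_id]

theorem cot_cotInv {q₀ : Q} {w : CotangentBundle E Q}
    (hw : w.proj ∈ (extChartAt 𝓘(ℝ, E) q₀).source) : cot q₀ (cotInv q₀ w) = w := by
  obtain ⟨q, ξ⟩ := w
  -- The base point is generalised because the covector lives in a space depending on it, so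
  -- `left_inv` cannot be rewritten directly.
  have key : ∀ q', q' = q → (⟨q', ((CotangentSpace.toModel ξ).comp
    (chartDerivSymm q₀ (extChartAt 𝓘(ℝ, E) q₀ q))).comp (chartDeriv (E := E) q₀ q')⟩ :
      CotangentBundle E Q) = ⟨q, ξ⟩ := by
    rintro q' rfl
    have e : ((CotangentSpace.toModel ξ).comp
        (chartDerivSymm q₀ (extChartAt 𝓘(ℝ, E) q₀ q'))).comp (chartDeriv (E := E) q₀ q') =
        CotangentSpace.toModel ξ := by
      rw [ContinuousLinearMap.comp_assoc, chartDerivSymm_comp hw]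
      exact ContinuousLinearMap.comp_id _
    exact congrArg (fun ζ : E →L[ℝ] ℝ => (⟨q', ζ⟩ : CotangentBundle E Q)) e
  exact key _ ((extChartAt 𝓘(ℝ, E) q₀).left_inv hw)

/-- The charts of the cotangent bundle come from those of a bundle of homomorphisms. The target
factor is a trivial line bundle, so all that remains is composition with the derivative of the
inverse chart. This identifies abstract bundle charts with explicit cotangent coordinates. -/
theorem extChartAt_cotangentBundle {z₀ w : CotangentBundle E Q}
    (hw : w.proj ∈ (chartAt E z₀.proj).source) :
    extChartAt (cotangentModel E) z₀ w = cotInv z₀.proj w := by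
  have h1 : extChartAt (cotangentModel E) z₀ w = (extChartAt 𝓘(ℝ, E) z₀.proj w.proj,
      ContinuousLinearMap.inCoordinates E (TangentSpace 𝓘(ℝ, E)) ℝ (Bundle.Trivial Q ℝ) z₀.proj
        w.proj z₀.proj w.proj w.snd) := by
    rw [FiberBundle.extChartAt]
    rfl
  rw [h1]
  refine Prod.ext rfl ?_
  have : IsManifold 𝓘(ℝ, E) 1 Q := IsManifold.of_le (n := ∞) (by simp)
  unfold ContinuousLinearMap.inCoordinates
  rw [TangentBundle.symmL_trivializationAt hw, modelWithCornersSelf_coe, Set.range_id,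
    mfderivWithin_univ]
  refine ContinuousLinearMap.ext fun v => ?_
  have e := Bundle.Trivial.continuousLinearMapAt_trivialization ℝ Q ℝ w.proj
  exact congrArg (fun L : ℝ →L[ℝ] ℝ => L (CotangentSpace.toModel w.snd
    (chartDerivSymm z₀.proj (extChartAt 𝓘(ℝ, E) z₀.proj w.proj) v))) e

theorem extChartAt_symm_cotangentBundle {z₀ : CotangentBundle E Q} {z : E × (E →L[ℝ] ℝ)}
    (hz : z.1 ∈ (extChartAt 𝓘(ℝ, E) z₀.proj).target) :
    (extChartAt (cotangentModel E) z₀).symm z = cot z₀.proj z := by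
  have h0 : (extChartAt 𝓘(ℝ, E) z₀.proj).symm z.1 ∈ (chartAt E z₀.proj).source := by
    rw [← extChartAt_source 𝓘(ℝ, E)]
    exact (extChartAt 𝓘(ℝ, E) z₀.proj).map_target hz
  have h1 : cot z₀.proj z ∈ (extChartAt (cotangentModel E) z₀).source := by
    rw [FiberBundle.extChartAt]
    simp only [mfld_simps]
    refine ⟨⟨h0, trivial⟩, h0⟩
  have h2 := (extChartAt (cotangentModel E) z₀).left_inv h1
  rw [extChartAt_cotangentBundle h0, cotInv_cot hz] at h2
  exact h2

theorem extChartAt_cotangentBundle_target_mem_nhds {z₀ : CotangentBundle E Q}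
    {z : E × (E →L[ℝ] ℝ)} (hz : z.1 ∈ (extChartAt 𝓘(ℝ, E) z₀.proj).target) :
    z ∈ (extChartAt (cotangentModel E) z₀).target := by
  rw [FiberBundle.extChartAt_target]
  refine ⟨⟨hz, ?_⟩, trivial⟩
  have := (extChartAt 𝓘(ℝ, E) z₀.proj).map_target hz
  rw [extChartAt_source] at this
  exact ⟨this, trivial⟩

omit [IsManifold 𝓘(ℝ, E) ∞ Q] in
theorem eventually_mem_chart_target {q₀ : Q} {z : E × (E →L[ℝ] ℝ)}
    (hz : z.1 ∈ (extChartAt 𝓘(ℝ, E) q₀).target) :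
    ∀ᶠ z' in 𝓝 z, z'.1 ∈ (extChartAt 𝓘(ℝ, E) q₀).target :=
  continuous_fst.continuousAt.preimage_mem_nhds
    ((isOpen_extChartAt_target (I := 𝓘(ℝ, E)) q₀).mem_nhds hz)

theorem contMDiffAt_cot {q₀ : Q} {z : E × (E →L[ℝ] ℝ)}
    (hz : z.1 ∈ (extChartAt 𝓘(ℝ, E) q₀).target) :
    ContMDiffAt 𝓘(ℝ, E × (E →L[ℝ] ℝ)) (cotangentModel E) ∞ (cot q₀) z := by
  let z₀ : CotangentBundle E Q := ⟨q₀, (0 : E →L[ℝ] ℝ)⟩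
  have h := (contMDiffOn_extChartAt_symm (I := cotangentModel E) (n := ∞) z₀).contMDiffAt
    ((isOpen_extChartAt_target (I := cotangentModel E) z₀).mem_nhds
      (extChartAt_cotangentBundle_target_mem_nhds (z₀ := z₀) hz))
  refine h.congr_of_eventuallyEq ?_
  filter_upwards [eventually_mem_chart_target hz] with z' hz'
  exact (extChartAt_symm_cotangentBundle (z₀ := z₀) hz').symm

theorem contMDiffAt_cotInv {q₀ : Q} {w : CotangentBundle E Q}
    (hw : w.proj ∈ (extChartAt 𝓘(ℝ, E) q₀).source) :
    ContMDiffAt (cotangentModel E) 𝓘(ℝ, E × (E →L[ℝ] ℝ)) ∞ (cotInv q₀) w := by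
  let z₀ : CotangentBundle E Q := ⟨q₀, (0 : E →L[ℝ] ℝ)⟩
  rw [extChartAt_source] at hw
  have h := contMDiffAt_extChartAt' (I := cotangentModel E) (n := ∞) (x := z₀) (x' := w) (by
    simp only [FiberBundle.chartedSpace_chartAt, mfld_simps]
    exact ⟨⟨hw, trivial⟩, hw⟩)
  refine h.congr_of_eventuallyEq ?_
  have hc : Continuous (fun w : CotangentBundle E Q => w.proj) :=
    FiberBundle.continuous_proj (E →L[ℝ] ℝ) _
  filter_upwards [hc.continuousAt.preimage_mem_nhds ((chartAt E q₀).open_source.mem_nhds hw)]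
    with w' hw'
  exact (extChartAt_cotangentBundle (z₀ := z₀) hw').symm

/-- The Liouville form in cotangent coordinates. -/
def liouvilleCoord (E : Type*) [NormedAddCommGroup E] [NormedSpace ℝ E] :
    E × (E →L[ℝ] ℝ) →L[ℝ] (E × (E →L[ℝ] ℝ)) [⋀^Fin 1]→L[ℝ] ℝ :=
  (ContinuousAlternatingMap.ofSubsingletonLIE (𝕜 := ℝ) (E := E × (E →L[ℝ] ℝ)) (F := ℝ) (0 : Fin 1)
    ).toContinuousLinearEquiv.toContinuousLinearMap.comp
    (((ContinuousLinearMap.compL ℝ (E × (E →L[ℝ] ℝ)) E ℝ).flip (ContinuousLinearMap.fst ℝ E _)).comp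
      (ContinuousLinearMap.snd ℝ E _))

omit [TopologicalSpace Q] [ChartedSpace E Q] [IsManifold 𝓘(ℝ, E) ∞ Q] in
theorem liouvilleCoord_apply (z : E × (E →L[ℝ] ℝ)) (v : Fin 1 → E × (E →L[ℝ] ℝ)) :
    liouvilleCoord E z v = z.2 (v 0).1 := rfl

theorem contMDiff_cotangentBundle_proj : ContMDiff (cotangentModel E) 𝓘(ℝ, E) ∞
    (fun y : CotangentBundle E Q => y.proj) :=
  contMDiff_proj _

/-- In cotangent coordinates the tautological form is p dq: differentiate the identity saying that
`cot` covers the inverse chart. -/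
theorem pullback_liouvilleForm_cot {q₀ : Q} {z : E × (E →L[ℝ] ℝ)}
    (hz : z.1 ∈ (extChartAt 𝓘(ℝ, E) q₀).target) :
    DiffForm.pullback 𝓘(ℝ, E × (E →L[ℝ] ℝ)) (cotangentModel E) (liouvilleForm E Q) (cot q₀) z =
      liouvilleCoord E z := by
  have h1 : mfderiv 𝓘(ℝ, E × (E →L[ℝ] ℝ)) 𝓘(ℝ, E)
      (fun z => (extChartAt 𝓘(ℝ, E) q₀).symm (z.1 : E)) z =
      (mfderiv (cotangentModel E) 𝓘(ℝ, E) (fun y : CotangentBundle E Q => y.proj)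
        (cot q₀ z)).comp (mfderiv 𝓘(ℝ, E × (E →L[ℝ] ℝ)) (cotangentModel E) (cot q₀) z) :=
    mfderiv_comp z (contMDiff_cotangentBundle_proj.mdifferentiable (by simp) _)
      ((contMDiffAt_cot hz).mdifferentiableAt (by simp))
  have h2 : mfderiv 𝓘(ℝ, E × (E →L[ℝ] ℝ)) 𝓘(ℝ, E)
      (fun z => (extChartAt 𝓘(ℝ, E) q₀).symm (z.1 : E)) z =
      (mfderiv 𝓘(ℝ, E) 𝓘(ℝ, E) (extChartAt 𝓘(ℝ, E) q₀).symm z.1).comp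
        (mfderiv 𝓘(ℝ, E × (E →L[ℝ] ℝ)) 𝓘(ℝ, E) Prod.fst z) := by
    have hs := (contMDiffOn_extChartAt_symm (I := 𝓘(ℝ, E)) (n := ∞) q₀).contMDiffAt
      ((isOpen_extChartAt_target (I := 𝓘(ℝ, E)) q₀).mem_nhds hz)
    exact mfderiv_comp z (hs.mdifferentiableAt (by simp))
      (differentiableAt_fst.mdifferentiableAt)
  ext v
  have h3 := congrArg (fun L : (E × (E →L[ℝ] ℝ)) →L[ℝ] E => (CotangentSpace.toModel (cot q₀ z).snd)
    (L (v 0))) (h1.symm.trans h2)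
  refine h3.trans ?_
  rw [mfderiv_eq_fderiv, fderiv_fst]
  exact congrArg (fun L : E →L[ℝ] E => z.2 (L (v 0).1)) (chartDeriv_comp_symm hz)

theorem inChart_liouvilleForm (w : CotangentBundle E Q) {z : E × (E →L[ℝ] ℝ)}
    (hz : z.1 ∈ (extChartAt 𝓘(ℝ, E) w.proj).target) :
    DiffForm.inChart (cotangentModel E) (liouvilleForm E Q) w z = liouvilleCoord E z := by
  rw [← pullback_liouvilleForm_cot hz]
  have hev : ∀ᶠ z' in 𝓝 z, (extChartAt (cotangentModel E) w).symm z' = cot w.proj z' := by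
    filter_upwards [eventually_mem_chart_target hz] with z' hz'
    exact extChartAt_symm_cotangentBundle hz'
  unfold DiffForm.inChart DiffForm.pullback
  rw [(cotangentModel E).range_eq_univ, mfderivWithin_univ]
  have e : mfderiv 𝓘(ℝ, E × (E →L[ℝ] ℝ)) (cotangentModel E) (extChartAt (cotangentModel E) w).symm z
      = mfderiv 𝓘(ℝ, E × (E →L[ℝ] ℝ)) (cotangentModel E) (cot w.proj) z :=
    Filter.EventuallyEq.mfderiv_eq hev
  have e' := hev.self_of_nhds
  ext v
  let η : CotangentBundle E Q → (E × (E →L[ℝ] ℝ)) [⋀^Fin 1]→L[ℝ] ℝ := liouvilleForm E Q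
  have key : ∀ (a b : CotangentBundle E Q)
    (A B : E × (E →L[ℝ] ℝ) →L[ℝ] E × (E →L[ℝ] ℝ)), a = b → A = B →
      η a (fun i => A (v i)) = η b (fun i => B (v i)) := by
    rintro a _ A _ rfl rfl
    rfl
  exact key _ _ _ _ e' e

/-- Pullback commutes with d, and p dq depends linearly on the point, so its derivative can be read
off. -/
theorem pullback_canonicalForm_cot {q₀ : Q} {z : E × (E →L[ℝ] ℝ)}
    (hz : z.1 ∈ (extChartAt 𝓘(ℝ, E) q₀).target) (u w : E × (E →L[ℝ] ℝ)) :
    DiffForm.pullback 𝓘(ℝ, E × (E →L[ℝ] ℝ)) (cotangentModel E) (canonicalForm E Q) (cot q₀) z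
      ![u, w] = stdForm E u w := by
  have hd : DifferentiableAt ℝ (DiffForm.inChart (cotangentModel E) (liouvilleForm E Q) (cot q₀ z))
      (extChartAt (cotangentModel E) (cot q₀ z) (cot q₀ z)) := by
    refine (liouvilleCoord E).differentiableAt.congr_of_eventuallyEq ?_
    have h : (extChartAt (cotangentModel E) (cot q₀ z) (cot q₀ z)).1 ∈
        (extChartAt 𝓘(ℝ, E) (cot q₀ z).proj).target := by
      rw [extChartAt_cotangentBundle (mem_chart_source _ _)]
      exact mem_extChartAt_target _
    filter_upwards [eventually_mem_chart_target h] with z' hz'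
    exact inChart_liouvilleForm _ hz'
  have h := extDeriv_pullback_form (cotangentModel E) hd (contMDiffAt_cot hz)
  have h2 : DiffForm.pullback 𝓘(ℝ, E × (E →L[ℝ] ℝ)) (cotangentModel E) (liouvilleForm E Q) (cot q₀)
      =ᶠ[𝓝 z] liouvilleCoord E := by
    filter_upwards [eventually_mem_chart_target hz] with z' hz'
    exact pullback_liouvilleForm_cot hz'
  rw [h2.extDeriv_eq] at h
  have h3 := congrArg (fun L => L ![u, w]) h
  refine h3.symm.trans ?_
  change _root_.extDeriv (liouvilleCoord E) z ![u, w] = _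
  rw [_root_.extDeriv, ContinuousLinearMap.fderiv,
    ContinuousAlternatingMap.alternatizeUncurryFin_apply]
  erw [Fin.sum_univ_two]
  simp [stdForm, liouvilleCoord_apply, Fin.removeNth]
  ring

end CotangentCoordinates

/-! ### The inverse function theorem for maps from a vector space to a manifold -/

section Inverse

variable {G : Type*} [NormedAddCommGroup G] [NormedSpace ℝ G] [FiniteDimensional ℝ G]
  {F : Type*} [NormedAddCommGroup F] [NormedSpace ℝ F] [FiniteDimensional ℝ F]
  {X : Type*} [TopologicalSpace X] [ChartedSpace F X] [IsManifold 𝓘(ℝ, F) ∞ X]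

/-- An injective derivative between spaces with this dimension bound is an isomorphism. Injectivity
is asked at all nearby points, not just at `z`, so that the inverse is smooth on its whole domain.
-/
theorem exists_openPartialHomeomorph {s : G → X} {z : G}
    (hs : ∀ᶠ z' in 𝓝 z, ContMDiffAt 𝓘(ℝ, G) 𝓘(ℝ, F) ∞ s z' ∧
      Function.Injective (mfderiv 𝓘(ℝ, G) 𝓘(ℝ, F) s z'))
    (hdim : Module.finrank ℝ F ≤ Module.finrank ℝ G) {N : Set G} (hN : N ∈ 𝓝 z) :
    ∃ e : OpenPartialHomeomorph G X, z ∈ e.source ∧ e.source ⊆ N ∧ (∀ z' ∈ e.source, e z' = s z') ∧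
      ∀ x ∈ e.target, ContMDiffAt 𝓘(ℝ, F) 𝓘(ℝ, G) ∞ e.symm x := by
  have : IsManifold 𝓘(ℝ, F) 1 X := IsManifold.of_le (n := ∞) (by simp)
  let χ := chartAt F (s z)
  have hcont : ContinuousAt s z := hs.self_of_nhds.1.continuousAt
  have hχ : ∀ᶠ z' in 𝓝 z, s z' ∈ χ.source := hcont.preimage_mem_nhds
    (χ.open_source.mem_nhds (mem_chart_source F (s z)))
  have hgood : ∀ᶠ z' in 𝓝 z, s z' ∈ χ.source ∧ ContDiffAt ℝ ∞ (fun z' => χ (s z')) z' ∧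
      ∃ A : G ≃L[ℝ] F, HasFDerivAt (fun z' => χ (s z')) (A : G →L[ℝ] F) z' := by
    filter_upwards [hs, hχ] with z' h1 h2
    have h2' : s z' ∈ (extChartAt 𝓘(ℝ, F) (s z)).source := by rwa [extChartAt_source]
    have hχ1 : ContMDiffAt 𝓘(ℝ, F) 𝓘(ℝ, F) ∞ (extChartAt 𝓘(ℝ, F) (s z)) (s z') :=
      contMDiffAt_extChartAt' h2
    have hcd : ContDiffAt ℝ ∞ (fun z' => χ (s z')) z' :=
      ContMDiffAt.contDiffAt (f := fun z' => χ (s z')) (hχ1.comp z' h1.1)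
    refine ⟨h2, hcd, ?_⟩
    have hd : HasFDerivAt (fun z' => χ (s z')) (fderiv ℝ (fun z' => χ (s z')) z') z' :=
      (hcd.differentiableAt (by simp)).hasFDerivAt
    have hinj : Function.Injective (fderiv ℝ (fun z' => χ (s z')) z') := by
      have e : fderiv ℝ (fun z' => χ (s z')) z' =
          (mfderiv 𝓘(ℝ, F) 𝓘(ℝ, F) (extChartAt 𝓘(ℝ, F) (s z)) (s z')).comp
            (mfderiv 𝓘(ℝ, G) 𝓘(ℝ, F) s z') := by
        rw [← mfderiv_eq_fderiv]
        exact mfderiv_comp z' (hχ1.mdifferentiableAt (by simp))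
          (h1.1.mdifferentiableAt (by simp))
      rw [e]
      have hl := mfderivWithin_extChartAt_symm_comp_mfderiv_extChartAt' (I := 𝓘(ℝ, F)) h2'
      have hi : Function.Injective (mfderiv 𝓘(ℝ, F) 𝓘(ℝ, F) (extChartAt 𝓘(ℝ, F) (s z)) (s z')) :=
        Function.LeftInverse.injective (g := mfderivWithin 𝓘(ℝ, F) 𝓘(ℝ, F)
          (extChartAt 𝓘(ℝ, F) (s z)).symm (Set.range 𝓘(ℝ, F)) (extChartAt 𝓘(ℝ, F) (s z) (s z')))
          (fun v => congrArg (fun L => L v) hl)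
      exact hi.comp h1.2
    have hker : LinearMap.ker (fderiv ℝ (fun z' => χ (s z')) z').toLinearMap = ⊥ :=
      LinearMap.ker_eq_bot.2 hinj
    have hfr : Module.finrank ℝ G = Module.finrank ℝ F :=
      le_antisymm (LinearMap.finrank_le_finrank_of_injective (f := (fderiv ℝ (fun z' => χ (s z')) z').toLinearMap) hinj) hdim
    have hsurj : Function.Surjective (fderiv ℝ (fun z' => χ (s z')) z').toLinearMap :=
      (LinearMap.injective_iff_surjective_of_finrank_eq_finrank hfr).1 hinj
    exact ⟨ContinuousLinearEquiv.ofBijective _ hker (LinearMap.range_eq_top.2 hsurj), hd⟩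
  obtain ⟨h1, h2, A, hA⟩ := hgood.self_of_nhds
  let Θ := h2.toOpenPartialHomeomorph _ hA (by simp)
  -- The local inverse is restricted to an open set where the derivative stays invertible and which
  -- lies in `N`.
  obtain ⟨O, hO, hOo, hzO⟩ := eventually_nhds_iff.1 (hgood.and hN)
  let e := (Θ.restrOpen O hOo).trans χ.symm
  refine ⟨e, ?_, ?_, ?_, ?_⟩
  · simp only [e, mfld_simps]
    refine ⟨⟨h2.mem_toOpenPartialHomeomorph_source hA (by simp), hzO⟩, ?_⟩
    exact χ.map_source h1
  · intro z' hz'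
    simp only [e, mfld_simps] at hz'
    exact (hO z' hz'.1.2).2
  · intro z' hz'
    simp only [e, mfld_simps] at hz'
    exact χ.left_inv (hO z' hz'.1.2).1.1
  · intro x hx
    have hx' := e.map_target hx
    simp only [e, mfld_simps] at hx hx'
    obtain ⟨-, h3, A', hA'⟩ := (hO _ hx'.1.2).1
    have h4 : ContDiffAt ℝ ∞ Θ.symm (χ x) := Θ.contDiffAt_symm hx.2.1 hA' h3
    have h5 : ContMDiffAt 𝓘(ℝ, F) 𝓘(ℝ, F) ∞ (extChartAt 𝓘(ℝ, F) (s z)) x :=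
      contMDiffAt_extChartAt' hx.1
    exact ContMDiffAt.comp (g := Θ.symm) x h4.contMDiffAt h5

end Inverse

/-! ### Lagrangian germs: local symplectic maps from the cotangent bundle over the base -/

section Germs

variable {E : Type*} [NormedAddCommGroup E] [NormedSpace ℝ E]
  {F : Type*} [NormedAddCommGroup F] [NormedSpace ℝ F]
  {F' : Type*} [NormedAddCommGroup F'] [NormedSpace ℝ F']
  {Q : Type*} [TopologicalSpace Q] [ChartedSpace E Q]
  {X : Type*} [TopologicalSpace X] [ChartedSpace F X]
  {X' : Type*} [TopologicalSpace X'] [ChartedSpace F' X']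

/-- Near `z`, the map `s` is, in the cotangent coordinates at `q₀`, a smooth symplectic map
over the base. -/
def IsLagAt (L : LagrangianTorusFibration E F Q X) (q₀ : Q) (s : E × (E →L[ℝ] ℝ) → X)
    (z : E × (E →L[ℝ] ℝ)) : Prop :=
  ∀ᶠ z' in 𝓝 z, z'.1 ∈ (extChartAt 𝓘(ℝ, E) q₀).target ∧
    ContMDiffAt 𝓘(ℝ, E × (E →L[ℝ] ℝ)) 𝓘(ℝ, F) ∞ s z' ∧
    L.proj (s z') = (extChartAt 𝓘(ℝ, E) q₀).symm z'.1 ∧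
    ∀ u w, pullBilin L.form s z' u w = stdForm E u w

variable {L : LagrangianTorusFibration E F Q X} {L' : LagrangianTorusFibration E F' Q X'} {q₀ : Q}
  {s s₁ s₂ : E × (E →L[ℝ] ℝ) → X} {z z₁ z₂ : E × (E →L[ℝ] ℝ)}

theorem IsLagAt.eventually (h : IsLagAt L q₀ s z) : ∀ᶠ z' in 𝓝 z, IsLagAt L q₀ s z' :=
  eventually_eventually_nhds.2 h

theorem IsLagAt.mem_target (h : IsLagAt L q₀ s z) : z.1 ∈ (extChartAt 𝓘(ℝ, E) q₀).target :=
  h.self_of_nhds.1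

theorem IsLagAt.contMDiffAt (h : IsLagAt L q₀ s z) :
    ContMDiffAt 𝓘(ℝ, E × (E →L[ℝ] ℝ)) 𝓘(ℝ, F) ∞ s z := h.self_of_nhds.2.1

theorem IsLagAt.proj_eq (h : IsLagAt L q₀ s z) :
    L.proj (s z) = (extChartAt 𝓘(ℝ, E) q₀).symm z.1 := h.self_of_nhds.2.2.1

theorem IsLagAt.pullBilin_eq (h : IsLagAt L q₀ s z) (u w : E × (E →L[ℝ] ℝ)) :
    pullBilin L.form s z u w = stdForm E u w := h.self_of_nhds.2.2.2 u w

theorem IsLagAt.fst_eq (h : IsLagAt L q₀ s z) : z.1 = extChartAt 𝓘(ℝ, E) q₀ (L.proj (s z)) := by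
  rw [h.proj_eq, (extChartAt 𝓘(ℝ, E) q₀).right_inv h.mem_target]

theorem IsLagAt.congr (h : IsLagAt L q₀ s₁ z) (he : s₂ =ᶠ[𝓝 z] s₁) : IsLagAt L q₀ s₂ z := by
  unfold IsLagAt at *
  filter_upwards [h, he.eventuallyEq_nhds] with z' h1 h2
  have e : mfderiv 𝓘(ℝ, E × (E →L[ℝ] ℝ)) 𝓘(ℝ, F) s₂ z' =
    mfderiv 𝓘(ℝ, E × (E →L[ℝ] ℝ)) 𝓘(ℝ, F) s₁ z' := h2.mfderiv_eq
  refine ⟨h1.1, h1.2.1.congr_of_eventuallyEq h2, by rw [h2.self_of_nhds, h1.2.2.1], fun u w => ?_⟩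
  rw [← h1.2.2.2 u w, pullBilin_apply, pullBilin_apply]
  have key : ∀ (a b : X) (A B : E × (E →L[ℝ] ℝ) →L[ℝ] F), a = b → A = B →
      (L.form a : F [⋀^Fin 2]→L[ℝ] ℝ) ![A u, A w] = (L.form b : F [⋀^Fin 2]→L[ℝ] ℝ) ![B u, B w] := by
    rintro a _ A _ rfl rfl
    rfl
  exact key _ _ _ _ h2.self_of_nhds e

theorem stdForm_nondegenerate {u : E × (E →L[ℝ] ℝ)} (h : ∀ w, stdForm E u w = 0) : u = 0 := by
  have h2 : u.2 = 0 := by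
    ext v
    simpa [stdForm] using h (v, 0)
  have h1 : u.1 = 0 := by
    refine SeparatingDual.eq_zero_of_forall_dual_eq_zero (R := ℝ) fun f => ?_
    simpa [stdForm] using h (0, f)
  exact Prod.ext h1 h2

/-- A vector killed by the derivative would be in the kernel of the standard form. -/
theorem IsLagAt.injective_mfderiv (h : IsLagAt L q₀ s z) :
    Function.Injective (mfderiv 𝓘(ℝ, E × (E →L[ℝ] ℝ)) 𝓘(ℝ, F) s z) := by
  have key : ∀ A : E × (E →L[ℝ] ℝ) →L[ℝ] F, (∀ u w, (L.form (s z) : F [⋀^Fin 2]→L[ℝ] ℝ) ![A u, A w]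
      = stdForm E u w) → Function.Injective A := by
    intro A hA
    refine (injective_iff_map_eq_zero A).2 fun u hu => stdForm_nondegenerate fun w => ?_
    rw [← hA, hu]
    have := toBilin (G := F) (L.form (s z))
    have h0 := congrArg (fun l => l (A w)) (map_zero (toBilin (G := F) (L.form (s z))))
    exact h0
  exact key _ fun u w => (pullBilin_apply L.form s z u w).symm.trans (h.pullBilin_eq u w)

/-- Let r be a linear right inverse of p. The map u ↦ (p u, B(u, r ·)) is injective: if both entries
vanish then u is vertical, so B(u, ·) vanishes on vertical vectors and on the image of r, hence
everywhere. -/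
theorem finrank_le_of_isotropic [FiniteDimensional ℝ E] [FiniteDimensional ℝ F]
    (B : F →L[ℝ] F →L[ℝ] ℝ) (hB : ∀ u, (∀ w, B u w = 0) → u = 0) (p : F →L[ℝ] E)
    (hp : Function.Surjective p) (hi : ∀ u w, p u = 0 → p w = 0 → B u w = 0) :
    Module.finrank ℝ F ≤ Module.finrank ℝ (E × (E →L[ℝ] ℝ)) := by
  obtain ⟨r, hr⟩ := p.toLinearMap.exists_rightInverse_of_surjective (LinearMap.range_eq_top.2 hp)
  have hr' : ∀ v, p (r v) = v := fun v => congrArg (fun l => l v) hr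
  let Φ : F →ₗ[ℝ] E × (E →L[ℝ] ℝ) :=
    { toFun := fun u => (p u, (B u).comp (LinearMap.toContinuousLinearMap r))
      map_add' := fun u v => by simp
      map_smul' := fun c u => by simp }
  refine LinearMap.finrank_le_finrank_of_injective (f := Φ) ?_
  refine (injective_iff_map_eq_zero Φ).2 fun u hu => hB u fun w => ?_
  have h1 : p u = 0 := congrArg Prod.fst hu
  have h2 : B u (r (p w)) = 0 := congrArg (fun l : E × (E →L[ℝ] ℝ) => l.2 (p w)) hu
  have h3 := hi u (w - r (p w)) h1 (by rw [map_sub, hr', sub_self])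
  rw [map_sub, h2, sub_zero] at h3
  exact h3

theorem LagrangianTorusFibration.form_vertical (L : LagrangianTorusFibration E F Q X) {x : X}
    {u w : TangentSpace 𝓘(ℝ, F) x} (hu : mfderiv 𝓘(ℝ, F) 𝓘(ℝ, E) L.proj x u = 0)
    (hw : mfderiv 𝓘(ℝ, F) 𝓘(ℝ, E) L.proj x w = 0) : L.form x ![u, w] = 0 :=
  (L.lagrangian_fibre x u).1 hu w hw

theorem LagrangianTorusFibration.finrank_le [FiniteDimensional ℝ E] [FiniteDimensional ℝ F]
    (L : LagrangianTorusFibration E F Q X) (x : X) :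
    Module.finrank ℝ F ≤ Module.finrank ℝ (E × (E →L[ℝ] ℝ)) :=
  finrank_le_of_isotropic (toBilin (G := F) (L.form x)) (fun u hu => L.nondegenerate x u hu)
    (mfderiv 𝓘(ℝ, F) 𝓘(ℝ, E) L.proj x) (L.submersion x)
    (fun _ _ hu hw => L.form_vertical hu hw)

theorem IsLagAt.exists_openPartialHomeomorph [FiniteDimensional ℝ E] [FiniteDimensional ℝ F]
    [IsManifold 𝓘(ℝ, F) ∞ X] (h : IsLagAt L q₀ s z) {N : Set (E × (E →L[ℝ] ℝ))} (hN : N ∈ 𝓝 z) :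
    ∃ e : OpenPartialHomeomorph (E × (E →L[ℝ] ℝ)) X, z ∈ e.source ∧ e.source ⊆ N ∧
      (∀ z' ∈ e.source, e z' = s z') ∧
      ∀ x ∈ e.target, ContMDiffAt 𝓘(ℝ, F) 𝓘(ℝ, E × (E →L[ℝ] ℝ)) ∞ e.symm x := by
  refine LagrangianFibrations.exists_openPartialHomeomorph ?_ (L.finrank_le (s z)) hN
  filter_upwards [h.eventually] with z' hz'
  exact ⟨hz'.contMDiffAt, hz'.injective_mfderiv⟩

/-- The composite s₂⁻¹ ∘ s₁ is a symplectic map over `E`, so it has the form (y, η) ↦ (y, η + b(y,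
η)). Preservation of the standard form says that b does not depend on η and is a closed 1-form in y;
on a ball it is exact. All later rigidity comes from this. -/
theorem IsLagAt.transition [FiniteDimensional ℝ E] [FiniteDimensional ℝ F]
    [IsManifold 𝓘(ℝ, F) ∞ X] (h₁ : IsLagAt L q₀ s₁ z₁) (h₂ : IsLagAt L q₀ s₂ z₂)
    (he : s₁ z₁ = s₂ z₂) :
    ∃ r > 0, ∃ f : E → ℝ, ContDiffOn ℝ ∞ f (Metric.ball z₁.1 r) ∧
      fderiv ℝ f z₁.1 = z₂.2 - z₁.2 ∧
      ∀ z ∈ Metric.ball z₁ r, s₁ z = s₂ (z.1, z.2 + fderiv ℝ f z.1) := by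
  obtain ⟨e, hze, heN, hes, hsm⟩ := h₂.exists_openPartialHomeomorph h₂.eventually
  have hgz : e.symm (s₁ z₁) = z₂ := by rw [he, ← hes _ hze, e.left_inv hze]
  have htgt : s₁ z₁ ∈ e.target := by rw [he, ← hes _ hze]; exact e.map_source hze
  let g : E × (E →L[ℝ] ℝ) → E × (E →L[ℝ] ℝ) := fun z => e.symm (s₁ z)
  have hev : ∀ᶠ z in 𝓝 z₁, IsLagAt L q₀ s₁ z ∧ s₁ z ∈ e.target :=
    h₁.eventually.and (h₁.contMDiffAt.continuousAt.preimage_mem_nhds (e.open_target.mem_nhds htgt))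
  obtain ⟨r, hr, hball⟩ := Metric.eventually_nhds_iff_ball.1 hev
  have hgs : ∀ z ∈ Metric.ball z₁ r, g z ∈ e.source := fun z hz => e.map_target (hball z hz).2
  have hs2g : ∀ z ∈ Metric.ball z₁ r, s₂ (g z) = s₁ z := fun z hz => by
    rw [← hes _ (hgs z hz)]
    exact e.right_inv (hball z hz).2
  have hfst : ∀ z ∈ Metric.ball z₁ r, (g z).1 = z.1 := fun z hz => by
    have k : IsLagAt L q₀ s₂ (g z) := heN (hgs z hz)
    rw [k.fst_eq, hs2g z hz, ← (hball z hz).1.fst_eq]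
  have hgd : ∀ z ∈ Metric.ball z₁ r, ContDiffAt ℝ ∞ g z := fun z hz =>
    ContMDiffAt.contDiffAt ((hsm _ (hball z hz).2).comp z (hball z hz).1.contMDiffAt)
  have hstd : ∀ z ∈ Metric.ball z₁ r, ∀ u w,
      stdForm E (fderiv ℝ g z u) (fderiv ℝ g z w) = stdForm E u w := by
    intro z hz u w
    have k : IsLagAt L q₀ s₂ (g z) := heN (hgs z hz)
    have hev' : s₁ =ᶠ[𝓝 z] s₂ ∘ g := by
      filter_upwards [Metric.isOpen_ball.mem_nhds hz] with z' hz'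
      exact (hs2g z' hz').symm
    have hD : (mfderiv 𝓘(ℝ, E × (E →L[ℝ] ℝ)) 𝓘(ℝ, F) s₁ z : E × (E →L[ℝ] ℝ) →L[ℝ] F) =
        (mfderiv 𝓘(ℝ, E × (E →L[ℝ] ℝ)) 𝓘(ℝ, F) s₂ (g z) : E × (E →L[ℝ] ℝ) →L[ℝ] F).comp
          (fderiv ℝ g z) := by
      have h := mfderiv_comp z (k.contMDiffAt.mdifferentiableAt (by simp))
        ((hgd z hz).differentiableAt (by simp)).mdifferentiableAt
      refine (hev'.mfderiv_eq.trans h).trans ?_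
      exact congrArg (fun B : E × (E →L[ℝ] ℝ) →L[ℝ] E × (E →L[ℝ] ℝ) =>
        (mfderiv 𝓘(ℝ, E × (E →L[ℝ] ℝ)) 𝓘(ℝ, F) s₂ (g z) : E × (E →L[ℝ] ℝ) →L[ℝ] F).comp B)
        mfderiv_eq_fderiv
    rw [← k.pullBilin_eq, ← (hball z hz).1.pullBilin_eq u w, pullBilin_apply, pullBilin_apply]
    have key : ∀ (a b : X) (A B : E × (E →L[ℝ] ℝ) →L[ℝ] F), a = b → A = B →
        (L.form a : F [⋀^Fin 2]→L[ℝ] ℝ) ![A u, A w] =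
          (L.form b : F [⋀^Fin 2]→L[ℝ] ℝ) ![B u, B w] := by
      rintro a _ A _ rfl rfl
      rfl
    exact (key _ _ _ _ (hs2g z hz).symm hD).symm
  have hAfst : ∀ z ∈ Metric.ball z₁ r, ∀ u, (fderiv ℝ g z u).1 = u.1 := by
    intro z hz u
    have h1 : HasFDerivAt (fun z => (g z).1)
        ((ContinuousLinearMap.fst ℝ E (E →L[ℝ] ℝ)).comp (fderiv ℝ g z)) z :=
      (ContinuousLinearMap.fst ℝ E (E →L[ℝ] ℝ)).hasFDerivAt.comp z
        ((hgd z hz).differentiableAt (by simp)).hasFDerivAt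
    have h2 : HasFDerivAt (fun z => (g z).1) (ContinuousLinearMap.fst ℝ E (E →L[ℝ] ℝ)) z := by
      refine hasFDerivAt_fst.congr_of_eventuallyEq ?_
      filter_upwards [Metric.isOpen_ball.mem_nhds hz] with z' hz'
      exact hfst z' hz'
    exact congrArg (fun l => l u) (h1.unique h2)
  let b : E × (E →L[ℝ] ℝ) → E →L[ℝ] ℝ := fun z => (g z).2 - z.2
  have hbd : ∀ z ∈ Metric.ball z₁ r, HasFDerivAt b
      ((ContinuousLinearMap.snd ℝ E (E →L[ℝ] ℝ)).comp (fderiv ℝ g z) -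
        ContinuousLinearMap.snd ℝ E (E →L[ℝ] ℝ)) z := fun z hz =>
    ((ContinuousLinearMap.snd ℝ E (E →L[ℝ] ℝ)).hasFDerivAt.comp z
        ((hgd z hz).differentiableAt (by simp)).hasFDerivAt).sub hasFDerivAt_snd
  -- Preservation of the standard form, once the identical parts of g are cancelled.
  have hsymm : ∀ z ∈ Metric.ball z₁ r, ∀ u w, fderiv ℝ b z u w.1 = fderiv ℝ b z w u.1 := by
    intro z hz u w
    rw [(hbd z hz).fderiv]
    have k := hstd z hz u w
    simp only [stdForm, hAfst z hz] at k
    simp only [sub_apply, ContinuousLinearMap.comp_apply, ContinuousLinearMap.coe_snd']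
    linarith
  have hmem : ∀ y ∈ Metric.ball z₁.1 r, ∀ η ∈ Metric.ball z₁.2 r, ((y, η) : E × (E →L[ℝ] ℝ)) ∈
      Metric.ball z₁ r := fun y hy η hη => by
    rw [← Prod.mk.eta (p := z₁), ← ball_prod_same]
    exact ⟨hy, hη⟩
  have hz1 : z₁.2 ∈ Metric.ball z₁.2 r := Metric.mem_ball_self hr
  -- The symmetry applied to (0, ζ) and (v, 0) says that the derivative of b in the fibre direction
  -- vanishes.
  have hconst : ∀ y ∈ Metric.ball z₁.1 r, ∀ η ∈ Metric.ball z₁.2 r, b (y, η) = b (y, z₁.2) := by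
    intro y hy η hη
    have hd : ∀ η ∈ Metric.ball z₁.2 r, HasFDerivAt (fun η => b (y, η))
        ((fderiv ℝ b (y, η)).comp (ContinuousLinearMap.inr ℝ E (E →L[ℝ] ℝ))) η := fun η hη =>
      (hbd _ (hmem y hy η hη)).differentiableAt.hasFDerivAt.comp η (hasFDerivAt_prodMk_right y η)
    refine Metric.isOpen_ball.is_const_of_fderiv_eq_zero (𝕜 := ℝ)
      (convex_ball z₁.2 r).isPreconnected (fun η hη => (hd η hη).differentiableAt.differentiableWithinAt)
      (fun η hη => ?_) hη hz1
    rw [(hd η hη).fderiv]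
    ext ζ v
    simpa using hsymm _ (hmem y hy η hη) (0, ζ) (v, 0)
  let β : E → E →L[ℝ] ℝ := fun y => b (y, z₁.2)
  have hβd : ∀ y ∈ Metric.ball z₁.1 r, HasFDerivAt β
      ((fderiv ℝ b (y, z₁.2)).comp (ContinuousLinearMap.inl ℝ E (E →L[ℝ] ℝ))) y := fun y hy =>
    HasFDerivAt.comp (g := b) y (hbd _ (hmem y hy _ hz1)).differentiableAt.hasFDerivAt
      (hasFDerivAt_prodMk_left y z₁.2)
  have hβc : ContDiffOn ℝ ∞ β (Metric.ball z₁.1 r) := by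
    intro y hy
    have k1 : ContDiffAt ℝ ∞ b (y, z₁.2) :=
      (hgd _ (hmem y hy _ hz1)).snd.sub contDiffAt_snd
    exact (k1.comp y (contDiffAt_id.prodMk contDiffAt_const)).contDiffWithinAt
  obtain ⟨f, hf⟩ := (convex_ball z₁.1 r).exists_forall_hasFDerivAt_of_fderiv_symmetric
    Metric.isOpen_ball (fun y hy => (hβd y hy).differentiableAt.differentiableWithinAt)
    (fun y hy v w => by
      rw [(hβd y hy).fderiv]
      simpa using hsymm _ (hmem y hy _ hz1) (v, 0) (w, 0))
  refine ⟨r, hr, f, ?_, ?_, ?_⟩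
  · rw [contDiffOn_infty_iff_fderiv_of_isOpen Metric.isOpen_ball]
    exact ⟨fun y hy => (hf y hy).differentiableAt.differentiableWithinAt,
      hβc.congr fun y hy => (hf y hy).fderiv⟩
  · rw [(hf _ (Metric.mem_ball_self hr)).fderiv]
    change (e.symm (s₁ (z₁.1, z₁.2))).2 - z₁.2 = _
    rw [Prod.mk.eta, hgz]
  · intro z hz
    have hz' := hz
    rw [← Prod.mk.eta (p := z₁), ← ball_prod_same] at hz'
    rw [(hf _ hz'.1).fderiv, ← hs2g z hz]
    congr 1
    refine Prod.ext (hfst z hz) ?_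
    have := hconst z.1 hz'.1 z.2 hz'.2
    change (g z).2 = z.2 + b (z.1, z₁.2)
    rw [← this]
    change (g z).2 = z.2 + ((g z).2 - z.2)
    abel

end Germs

/-! ### Stability of Lagrangian germs under composition -/

section Composition

variable {E : Type*} [NormedAddCommGroup E] [NormedSpace ℝ E]
  {F : Type*} [NormedAddCommGroup F] [NormedSpace ℝ F]
  {F' : Type*} [NormedAddCommGroup F'] [NormedSpace ℝ F']
  {Q : Type*} [TopologicalSpace Q] [ChartedSpace E Q]
  {X : Type*} [TopologicalSpace X] [ChartedSpace F X]
  {X' : Type*} [TopologicalSpace X'] [ChartedSpace F' X']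
  {G G' : Type*} [NormedAddCommGroup G] [NormedSpace ℝ G] [NormedAddCommGroup G'] [NormedSpace ℝ G']

theorem pullBilin_comp (η : DiffForm 𝓘(ℝ, F) X 2) {ρ : G → X} {g : G' → G} {z : G'}
    (hρ : MDifferentiableAt 𝓘(ℝ, G) 𝓘(ℝ, F) ρ (g z)) (hg : DifferentiableAt ℝ g z) (u w : G') :
    pullBilin η (ρ ∘ g) z u w = pullBilin η ρ (g z) (fderiv ℝ g z u) (fderiv ℝ g z w) := by
  rw [pullBilin_apply, pullBilin_apply]
  have h := mfderiv_comp z hρ hg.mdifferentiableAt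
  have h2 : ∀ v, (mfderiv 𝓘(ℝ, G') 𝓘(ℝ, F) (ρ ∘ g) z v : F) =
      mfderiv 𝓘(ℝ, G) 𝓘(ℝ, F) ρ (g z) (fderiv ℝ g z v) := fun v => by
    rw [h]
    exact congrArg (fun B : G' →L[ℝ] G => (mfderiv 𝓘(ℝ, G) 𝓘(ℝ, F) ρ (g z) : G →L[ℝ] F) (B v))
        mfderiv_eq_fderiv
  exact congrArg₂ (fun a b : F => (η (ρ (g z)) : F [⋀^Fin 2]→L[ℝ] ℝ) ![a, b]) (h2 u) (h2 w)

theorem pullBilin_map {η : DiffForm 𝓘(ℝ, F) X 2} {η' : DiffForm 𝓘(ℝ, F') X' 2} {ρ : G → X}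
    {φ : X → X'} {z : G} (hφ : MDifferentiableAt 𝓘(ℝ, F) 𝓘(ℝ, F') φ (ρ z))
    (hρ : MDifferentiableAt 𝓘(ℝ, G) 𝓘(ℝ, F) ρ z)
    (h : DiffForm.pullback 𝓘(ℝ, F) 𝓘(ℝ, F') η' φ (ρ z) = η (ρ z)) (u w : G) :
    pullBilin η' (φ ∘ ρ) z u w = pullBilin η ρ z u w := by
  rw [pullBilin_apply, pullBilin_apply, ← h]
  have h := mfderiv_comp z hφ hρ
  rw [h]
  change _ = (η' (φ (ρ z)) : F' [⋀^Fin 2]→L[ℝ] ℝ) (fun i => mfderiv 𝓘(ℝ, F) 𝓘(ℝ, F') φ (ρ z) (_))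
  change (η' (φ (ρ z)) : F' [⋀^Fin 2]→L[ℝ] ℝ) _ = (η' (φ (ρ z)) : F' [⋀^Fin 2]→L[ℝ] ℝ) _
  congr 1
  ext i
  fin_cases i <;> rfl

variable {L : LagrangianTorusFibration E F Q X} {L' : LagrangianTorusFibration E F' Q X'} {q₀ : Q}
  {s : E × (E →L[ℝ] ℝ) → X} {z : E × (E →L[ℝ] ℝ)}

theorem IsLagAt.comp {g : E × (E →L[ℝ] ℝ) → E × (E →L[ℝ] ℝ)} (h : IsLagAt L q₀ s (g z))
    (hg : ∀ᶠ z' in 𝓝 z, ContDiffAt ℝ ∞ g z' ∧ (g z').1 = z'.1 ∧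
      ∀ u w, stdForm E (fderiv ℝ g z' u) (fderiv ℝ g z' w) = stdForm E u w) :
    IsLagAt L q₀ (s ∘ g) z := by
  have hc := hg.self_of_nhds.1.continuousAt.eventually h
  filter_upwards [hg, hc] with z' h1 h2
  refine ⟨h1.2.1 ▸ h2.1, h2.2.1.comp z' h1.1.contMDiffAt, ?_, fun u w => ?_⟩
  · rw [← h1.2.1]
    exact h2.2.2.1
  · rw [pullBilin_comp _ (h2.2.1.mdifferentiableAt (by simp)) (h1.1.differentiableAt (by simp)),
      h2.2.2.2, h1.2.2]

/-- Translation by df is symplectic because the second derivative of f is symmetric. The constant c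
is kept separate so that translation by a fixed covector needs no linear function. -/
theorem IsLagAt.comp_translation {f : E → ℝ} {c : E →L[ℝ] ℝ}
    (hf : ∀ᶠ y in 𝓝 z.1, ContDiffAt ℝ ∞ f y)
    (h : IsLagAt L q₀ s (z.1, z.2 + (fderiv ℝ f z.1 + c))) :
    IsLagAt L q₀ (fun z => s (z.1, z.2 + (fderiv ℝ f z.1 + c))) z := by
  refine IsLagAt.comp (g := fun z => (z.1, z.2 + (fderiv ℝ f z.1 + c))) h ?_
  filter_upwards [continuous_fst.continuousAt.eventually hf] with z' h1
  have h2 : ContDiffAt ℝ ∞ (fderiv ℝ f) z'.1 := h1.fderiv_right (by simp)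
  have h3 : HasFDerivAt (fun z : E × (E →L[ℝ] ℝ) => fderiv ℝ f z.1)
      ((fderiv ℝ (fderiv ℝ f) z'.1).comp (ContinuousLinearMap.fst ℝ E (E →L[ℝ] ℝ))) z' :=
    HasFDerivAt.comp (g := fderiv ℝ f) z' (h2.differentiableAt (by simp)).hasFDerivAt hasFDerivAt_fst
  have h4 := HasFDerivAt.prodMk (hasFDerivAt_fst (𝕜 := ℝ) (p := z'))
    ((hasFDerivAt_snd (𝕜 := ℝ) (p := z')).add (h3.add_const c))
  refine ⟨contDiffAt_fst.prodMk (contDiffAt_snd.add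
    ((ContDiffAt.comp (g := fderiv ℝ f) z' h2 contDiffAt_fst).add contDiffAt_const)), rfl,
    fun u w => ?_⟩
  erw [h4.fderiv]
  have hsym := h1.isSymmSndFDerivAt (by
    rw [minSmoothness_of_isRCLikeNormedField]
    exact WithTop.coe_le_coe.2 le_top) u.1 w.1
  simp [stdForm, hsym]

theorem IsLagAt.map {φ : X → X'} (h : IsLagAt L q₀ s z)
    (hφ : ∀ᶠ z' in 𝓝 z, ContMDiffAt 𝓘(ℝ, F) 𝓘(ℝ, F') ∞ φ (s z') ∧
      L'.proj (φ (s z')) = L.proj (s z') ∧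
      DiffForm.pullback 𝓘(ℝ, F) 𝓘(ℝ, F') L'.form φ (s z') = L.form (s z')) :
    IsLagAt L' q₀ (φ ∘ s) z := by
  unfold IsLagAt at *
  filter_upwards [h, hφ] with z' h1 h2
  refine ⟨h1.1, h2.1.comp z' h1.2.1, h2.2.1.trans h1.2.2.1, fun u w => ?_⟩
  rw [pullBilin_map (h2.1.mdifferentiableAt (by simp)) (h1.2.1.mdifferentiableAt (by simp)) h2.2.2]
  exact h1.2.2.2 u w

theorem LagrangianTorusFibration.FibrewiseSymplectomorphism.isLagAt
    (φ : L.FibrewiseSymplectomorphism L') (h : IsLagAt L q₀ s z) :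
    IsLagAt L' q₀ (φ.toDiffeomorph ∘ s) z :=
  h.map (.of_forall fun _ => ⟨φ.toDiffeomorph.contMDiff.contMDiffAt, φ.proj_comp _,
    congrFun φ.pullback_form _⟩)

/-- Trivialisations become Lagrangian germs in cotangent coordinates, so everything proved about
germs applies to them. -/
theorem LagrangianTorusFibration.LocalTrivialisation.isLagAt [IsManifold 𝓘(ℝ, E) ∞ Q]
    {P : Opens Q} (τ : L.LocalTrivialisation P) (hz : z.1 ∈ (extChartAt 𝓘(ℝ, E) q₀).target)
    (hP : (extChartAt 𝓘(ℝ, E) q₀).symm z.1 ∈ P) : IsLagAt L q₀ (τ.toFun ∘ cot q₀) z := by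
  have hc : ContinuousAt (fun z : E × (E →L[ℝ] ℝ) => (extChartAt 𝓘(ℝ, E) q₀).symm z.1) z :=
    (continuousAt_extChartAt_symm'' hz).comp continuous_fst.continuousAt
  have hopen : IsOpen {w : CotangentBundle E Q | w.proj ∈ P} :=
    P.isOpen.preimage (FiberBundle.continuous_proj (E →L[ℝ] ℝ) _)
  filter_upwards [eventually_mem_chart_target hz, hc.preimage_mem_nhds (P.isOpen.mem_nhds hP)]
    with z' h1 h2
  have k1 : ContMDiffAt (cotangentModel E) 𝓘(ℝ, F) ∞ τ.toFun (cot q₀ z') :=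
    τ.contMDiffOn.contMDiffAt (hopen.mem_nhds h2)
  refine ⟨h1, k1.comp z' (contMDiffAt_cot h1), τ.proj_comp _ h2, fun u w => ?_⟩
  rw [← pullback_canonicalForm_cot h1 u w]
  have hD := mfderiv_comp z' (k1.mdifferentiableAt (by simp))
    ((contMDiffAt_cot h1).mdifferentiableAt (by simp))
  rw [pullBilin_apply]
  have h3 : DiffForm.pullback (cotangentModel E) 𝓘(ℝ, F) L.form τ.toFun (cot q₀ z') =
    canonicalForm E Q (cot q₀ z') := τ.symplectic _ h2
  unfold DiffForm.pullback
  rw [← h3, hD]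
  change (L.form (τ.toFun (cot q₀ z')) : F [⋀^Fin 2]→L[ℝ] ℝ) _ =
    (L.form (τ.toFun (cot q₀ z')) : F [⋀^Fin 2]→L[ℝ] ℝ) _
  congr 1
  ext i
  fin_cases i <;> rfl

end Composition

/-! ### Existence of Lagrangian germs -/

section Existence

variable {E : Type*} [NormedAddCommGroup E] [NormedSpace ℝ E] [FiniteDimensional ℝ E]
  {F : Type*} [NormedAddCommGroup F] [NormedSpace ℝ F] [FiniteDimensional ℝ F]
  {Q : Type*} [TopologicalSpace Q] [ChartedSpace E Q]
  {X : Type*} [TopologicalSpace X] [ChartedSpace F X]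

omit [FiniteDimensional ℝ E] in
-- Restricting B(u, ·) to K gives a map into the dual of K. Its kernel lies in K by hypothesis, so
-- rank and nullity are both at most dim K.
theorem finrank_le_of_lagrangian (B : F →L[ℝ] F →L[ℝ] ℝ) (K : Submodule ℝ F)
    (hK : ∀ u, (∀ w ∈ K, B u w = 0) → u ∈ K) :
    Module.finrank ℝ F ≤ Module.finrank ℝ K + Module.finrank ℝ K := by
  let Φ : F →ₗ[ℝ] (K →ₗ[ℝ] ℝ) :=
    { toFun := fun u => (B u).toLinearMap.comp K.subtype
      map_add' := fun u v => by ext; simp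
      map_smul' := fun c u => by ext; simp }
  have h1 := LinearMap.finrank_range_add_finrank_ker Φ
  have h2 : LinearMap.ker Φ ≤ K := fun u hu => hK u fun w hw =>
    congrArg (fun l : K →ₗ[ℝ] ℝ => l ⟨w, hw⟩) (LinearMap.mem_ker.1 hu)
  have h3 := Submodule.finrank_mono h2
  have h4 := Submodule.finrank_le (LinearMap.range Φ)
  have h5 : Module.finrank ℝ (K →ₗ[ℝ] ℝ) = Module.finrank ℝ K := Subspace.dual_finrank_eq
  omega

/-- Coordinates on the total space of a submersion in which it becomes a product projection. -/
theorem LagrangianTorusFibration.exists_straightening [IsManifold 𝓘(ℝ, E) ∞ Q]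
    [IsManifold 𝓘(ℝ, F) ∞ X] (L : LagrangianTorusFibration E F Q X) {q₀ : Q} {x₀ : X}
    (hx₀ : L.proj x₀ ∈ (extChartAt 𝓘(ℝ, E) q₀).source) :
    ∃ (K : Submodule ℝ F) (ρ : E × K → X) (z₀ : E × K),
      Module.finrank ℝ (E × (E →L[ℝ] ℝ)) ≤ Module.finrank ℝ (E × K) ∧ ρ z₀ = x₀ ∧
      ∀ᶠ z in 𝓝 z₀, z.1 ∈ (extChartAt 𝓘(ℝ, E) q₀).target ∧
        ContMDiffAt 𝓘(ℝ, E × K) 𝓘(ℝ, F) ∞ ρ z ∧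
        Function.Bijective (mfderiv 𝓘(ℝ, E × K) 𝓘(ℝ, F) ρ z) ∧
        L.proj (ρ z) = (extChartAt 𝓘(ℝ, E) q₀).symm z.1 := by
  let κ := extChartAt 𝓘(ℝ, E) q₀
  let χ := extChartAt 𝓘(ℝ, F) x₀
  let P : F → E := fun v => κ (L.proj (χ.symm v))
  have hχx : χ.symm (χ x₀) = x₀ := extChartAt_to_inv x₀
  have hχs : ∀ v ∈ χ.target, ContMDiffAt 𝓘(ℝ, F) 𝓘(ℝ, F) ∞ χ.symm v := fun v hv =>
    (contMDiffOn_extChartAt_symm (I := 𝓘(ℝ, F)) (n := ∞) x₀).contMDiffAt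
      ((isOpen_extChartAt_target (I := 𝓘(ℝ, F)) x₀).mem_nhds hv)
  have hκ : ∀ q ∈ κ.source, ContMDiffAt 𝓘(ℝ, E) 𝓘(ℝ, E) ∞ κ q := fun q hq =>
    contMDiffAt_extChartAt' (by rwa [← extChartAt_source 𝓘(ℝ, E)])
  have hP : ∀ v ∈ χ.target, L.proj (χ.symm v) ∈ κ.source → ContDiffAt ℝ ∞ P v := fun v hv hv' =>
    ContMDiffAt.contDiffAt ((hκ _ hv').comp v (L.contMDiff_proj.contMDiffAt.comp v (hχs v hv)))
  have hv₀ : χ x₀ ∈ χ.target := mem_extChartAt_target x₀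
  have hv₀' : L.proj (χ.symm (χ x₀)) ∈ κ.source := by rwa [hχx]
  have hsurj : Function.Surjective (fderiv ℝ P (χ x₀)) := by
    have h1 := mfderiv_comp (χ x₀) ((hκ _ hv₀').mdifferentiableAt (by simp))
      ((L.contMDiff_proj.contMDiffAt.comp (χ x₀) (hχs _ hv₀)).mdifferentiableAt (by simp))
    have h2 := mfderiv_comp (χ x₀) (L.contMDiff_proj.mdifferentiable (by simp) _)
      ((hχs _ hv₀).mdifferentiableAt (by simp))
    have h3 : ∀ v, fderiv ℝ P (χ x₀) v = (chartDeriv q₀ (L.proj (χ.symm (χ x₀))) : E →L[ℝ] E)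
        (mfderiv 𝓘(ℝ, F) 𝓘(ℝ, E) L.proj (χ.symm (χ x₀)) (chartDerivSymm x₀ (χ x₀) v)) := by
      intro v
      rw [← mfderiv_eq_fderiv]
      exact (congrArg (fun l : F →L[ℝ] E => l v) h1).trans
        (congrArg (fun l : F →L[ℝ] E => (chartDeriv (E := E) q₀ (L.proj (χ.symm (χ x₀))) : E →L[ℝ] E) (l v)) h2)
    intro y
    have h4 := chartDeriv_comp_symm (κ.map_source hv₀')
    obtain ⟨u, hu⟩ := L.submersion (χ.symm (χ x₀)) (chartDerivSymm (E := E) q₀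
      (κ (L.proj (χ.symm (χ x₀)))) y)
    have h5 := chartDerivSymm_comp (E := F) (q₀ := x₀) (q := x₀) (mem_extChartAt_source x₀)
    refine ⟨chartDeriv (E := F) x₀ x₀ u, ?_⟩
    rw [h3]
    have h6 : chartDerivSymm (E := F) x₀ (χ x₀) (chartDeriv (E := F) x₀ x₀ u) = u :=
      congrArg (fun l : F →L[ℝ] F => l u) h5
    rw [h6]
    refine (congrArg (chartDeriv (E := E) q₀ (L.proj (χ.symm (χ x₀)))) hu).trans ?_
    have h7 := congrArg (fun l : E →L[ℝ] E => l y) h4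
    rw [κ.left_inv hv₀'] at h7
    exact h7
  let K : Submodule ℝ F := LinearMap.ker (fderiv ℝ P (χ x₀)).toLinearMap
  obtain ⟨pr, hpr⟩ := K.subtype.exists_leftInverse_of_injective (by simp)
  have hpr' : ∀ k : K, pr k = k := fun k => congrArg (fun l => l k) hpr
  let prc : F →L[ℝ] K := LinearMap.toContinuousLinearMap pr
  -- Normal form of a submersion: its expression in charts is completed by a linear projection onto
  -- the kernel of its derivative.
  let Φ : F → E × K := fun v => (P v, prc v)
  have hΦ : ∀ v ∈ χ.target, L.proj (χ.symm v) ∈ κ.source → ContDiffAt ℝ ∞ Φ v := fun v hv hv' =>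
    (hP v hv hv').prodMk prc.contDiff.contDiffAt
  have hfr : Module.finrank ℝ (E × K) = Module.finrank ℝ F := by
    have h1 := LinearMap.finrank_range_add_finrank_ker (fderiv ℝ P (χ x₀)).toLinearMap
    rw [LinearMap.range_eq_top.2 hsurj, finrank_top] at h1
    rw [Module.finrank_prod]
    exact h1
  -- Here the fibres being equal to their orthogonals, and not just isotropic, matters: it bounds
  -- dim F by twice the dimension of the fibre.
  have hdim : Module.finrank ℝ (E × (E →L[ℝ] ℝ)) ≤ Module.finrank ℝ (E × K) := by
    let T : F →L[ℝ] E := mfderiv 𝓘(ℝ, F) 𝓘(ℝ, E) L.proj x₀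
    have h1 := LinearMap.finrank_range_add_finrank_ker T.toLinearMap
    rw [LinearMap.range_eq_top.2 (show Function.Surjective T.toLinearMap from L.submersion x₀), finrank_top] at h1
    have h2 := finrank_le_of_lagrangian (toBilin (G := F) (L.form x₀)) (LinearMap.ker T.toLinearMap)
      (fun u hu => (L.lagrangian_fibre x₀ u).2 fun w hw => hu w hw)
    have h3 : Module.finrank ℝ (E →L[ℝ] ℝ) = Module.finrank ℝ E := by
      rw [← (LinearMap.toContinuousLinearMap (𝕜 := ℝ) (E := E) (F' := ℝ)).finrank_eq]
      exact Subspace.dual_finrank_eq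
    rw [hfr, Module.finrank_prod, h3]
    omega
  have hN : ∀ᶠ v in 𝓝 (χ x₀), v ∈ χ.target ∧ L.proj (χ.symm v) ∈ κ.source := by
    refine Filter.Eventually.and (extChartAt_target_mem_nhds x₀) ?_
    have hc : ContinuousAt (fun v => L.proj (χ.symm v)) (χ x₀) :=
      L.contMDiff_proj.continuous.continuousAt.comp (hχs _ hv₀).continuousAt
    exact hc.preimage_mem_nhds ((isOpen_extChartAt_source (I := 𝓘(ℝ, E)) q₀).mem_nhds hv₀')
  have hinj₀ : Function.Injective (fderiv ℝ Φ (χ x₀)) := by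
    have h1 : HasFDerivAt Φ ((fderiv ℝ P (χ x₀)).prod prc) (χ x₀) :=
      ((hP _ hv₀ hv₀').differentiableAt (by simp)).hasFDerivAt.prodMk prc.hasFDerivAt
    rw [h1.fderiv]
    refine (injective_iff_map_eq_zero _).2 fun u hu => ?_
    have hk : u ∈ K := congrArg Prod.fst hu
    have h2 : prc u = 0 := congrArg Prod.snd hu
    have h3 : prc u = ⟨u, hk⟩ := hpr' ⟨u, hk⟩
    rw [h2] at h3
    exact congrArg Subtype.val h3.symm
  have hinj : ∀ᶠ v in 𝓝 (χ x₀), Function.Injective (fderiv ℝ Φ v) := by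
    have hs : Function.Surjective (fderiv ℝ Φ (χ x₀)).toLinearMap :=
      (LinearMap.injective_iff_surjective_of_finrank_eq_finrank hfr.symm).1 hinj₀
    let A := ContinuousLinearEquiv.ofBijective (fderiv ℝ Φ (χ x₀)) (LinearMap.ker_eq_bot.2 hinj₀)
      (LinearMap.range_eq_top.2 hs)
    have hA : (A : F →L[ℝ] E × K) = fderiv ℝ Φ (χ x₀) := by ext1 v; rfl
    have hc : ContinuousAt (fderiv ℝ Φ) (χ x₀) :=
      ((hΦ _ hv₀ hv₀').fderiv_right (m := ∞) (by simp)).continuousAt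
    have hn := ContinuousLinearEquiv.nhds A
    rw [hA] at hn
    filter_upwards [hc.preimage_mem_nhds hn] with v ⟨A', hA'⟩
    rw [← hA']
    exact A'.injective
  obtain ⟨e, hze, heN, hes, hsm⟩ := exists_openPartialHomeomorph (s := Φ) (z := χ x₀) (by
    filter_upwards [hN, hinj] with v h1 h2
    refine ⟨(hΦ v h1.1 h1.2).contMDiffAt, ?_⟩
    rw [mfderiv_eq_fderiv]
    exact h2) hfr.le hN
  refine ⟨K, χ.symm ∘ e.symm, e (χ x₀), hdim, ?_, ?_⟩
  · rw [Function.comp_apply, e.left_inv hze, hχx]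
  · filter_upwards [e.open_target.mem_nhds (e.map_source hze)] with z hz
    obtain ⟨hm1, hm2⟩ := heN (e.map_target hz)
    have hz1 : z.1 = κ (L.proj (χ.symm (e.symm z))) := by
      have := e.right_inv hz
      rw [hes _ (e.map_target hz)] at this
      exact (congrArg Prod.fst this).symm
    have hρ : ContMDiffAt 𝓘(ℝ, E × K) 𝓘(ℝ, F) ∞ (χ.symm ∘ e.symm) z := (hχs _ hm1).comp z (hsm z hz)
    have hi : Function.Injective (mfderiv 𝓘(ℝ, E × K) 𝓘(ℝ, F) (χ.symm ∘ e.symm) z) := by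
      have h1 : ContMDiffAt 𝓘(ℝ, F) 𝓘(ℝ, F) ∞ χ ((χ.symm ∘ e.symm) z) :=
        contMDiffAt_extChartAt' (by
          rw [← extChartAt_source 𝓘(ℝ, F)]
          exact χ.map_target hm1)
      have h2 : MDifferentiableAt 𝓘(ℝ, F) 𝓘(ℝ, E × K) Φ (χ ((χ.symm ∘ e.symm) z)) := by
        rw [Function.comp_apply, χ.right_inv hm1]
        exact ((hΦ _ hm1 hm2).differentiableAt (by simp)).mdifferentiableAt
      have h3 := h2.comp _ (h1.mdifferentiableAt (by simp))
      have h4 := mfderiv_comp z h3 (hρ.mdifferentiableAt (by simp))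
      have h5 : (Φ ∘ χ) ∘ (χ.symm ∘ e.symm) =ᶠ[𝓝 z] id := by
        filter_upwards [e.open_target.mem_nhds hz] with z' hz'
        change Φ (χ (χ.symm (e.symm z'))) = z'
        rw [χ.right_inv (heN (e.map_target hz')).1, ← hes _ (e.map_target hz')]
        exact e.right_inv hz'
      have h6 := h4.symm.trans (h5.mfderiv_eq.trans mfderiv_id)
      exact Function.LeftInverse.injective (g := mfderiv 𝓘(ℝ, F) 𝓘(ℝ, E × K) (Φ ∘ χ)
        ((χ.symm ∘ e.symm) z)) (fun v => congrArg (fun l : E × K →L[ℝ] E × K => l v) h6)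
    refine ⟨hz1 ▸ κ.map_source hm2, hρ, ⟨hi, ?_⟩, ?_⟩
    · let T : E × K →L[ℝ] F := mfderiv 𝓘(ℝ, E × K) 𝓘(ℝ, F) (χ.symm ∘ e.symm) z
      exact (LinearMap.injective_iff_surjective_of_finrank_eq_finrank (f := T.toLinearMap) hfr).1 hi
    · rw [hz1]
      exact (κ.left_inv hm2).symm

/-- Relative Darboux theorem. In straightened coordinates the form is ∑ dp_i ∧ dq_i by
`exists_momentum`. The map (q, p) has injective derivative since it pulls the standard form back to
a nondegenerate one, and its local inverse provides the germ. -/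
theorem LagrangianTorusFibration.exists_isLagAt [IsManifold 𝓘(ℝ, E) ∞ Q]
    [IsManifold 𝓘(ℝ, F) ∞ X] (L : LagrangianTorusFibration E F Q X) {q₀ : Q} {x₀ : X}
    (hx₀ : L.proj x₀ ∈ (extChartAt 𝓘(ℝ, E) q₀).source) :
    ∃ s : E × (E →L[ℝ] ℝ) → X, IsLagAt L q₀ s (extChartAt 𝓘(ℝ, E) q₀ (L.proj x₀), 0) ∧
      s (extChartAt 𝓘(ℝ, E) q₀ (L.proj x₀), 0) = x₀ := by
  obtain ⟨K, ρ, z₀, hdim, hz₀, hev⟩ := L.exists_straightening hx₀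
  obtain ⟨r, hr, hball⟩ := Metric.eventually_nhds_iff_ball.1 hev
  have hbp : Metric.ball z₀ r = Metric.ball z₀.1 r ×ˢ Metric.ball z₀.2 r := by
    rw [ball_prod_same]
  have hopen : IsOpen (Metric.ball z₀.1 r ×ˢ Metric.ball z₀.2 r) :=
    Metric.isOpen_ball.prod Metric.isOpen_ball
  rw [hbp] at hball
  have hz₀m : z₀ ∈ Metric.ball z₀.1 r ×ˢ Metric.ball z₀.2 r := by
    rw [← hbp]
    exact Metric.mem_ball_self hr
  have hvert : ∀ z ∈ Metric.ball z₀.1 r ×ˢ Metric.ball z₀.2 r, ∀ k : K,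
      mfderiv 𝓘(ℝ, F) 𝓘(ℝ, E) L.proj (ρ z) (mfderiv 𝓘(ℝ, E × K) 𝓘(ℝ, F) ρ z (0, k)) = 0 := by
    intro z hz k
    have hs := (contMDiffOn_extChartAt_symm (I := 𝓘(ℝ, E)) (n := ∞) q₀).contMDiffAt
      ((isOpen_extChartAt_target (I := 𝓘(ℝ, E)) q₀).mem_nhds (hball z hz).1)
    have h1 := mfderiv_comp z (L.contMDiff_proj.mdifferentiable (by simp) (ρ z))
      ((hball z hz).2.1.mdifferentiableAt (by simp))
    have h2 := mfderiv_comp (I := 𝓘(ℝ, E × K)) z (hs.mdifferentiableAt (by simp))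
      ((differentiableAt_fst (𝕜 := ℝ) (p := z)).mdifferentiableAt)
    have h3 : L.proj ∘ ρ =ᶠ[𝓝 z] (extChartAt 𝓘(ℝ, E) q₀).symm ∘ Prod.fst := by
      filter_upwards [hopen.mem_nhds hz] with z' hz'
      exact (hball z' hz').2.2.2
    have h4 := (h1.symm.trans h3.mfderiv_eq).trans h2
    have h5 := congrArg (fun l : E × K →L[ℝ] E => l (0, k)) h4
    refine h5.trans ?_
    rw [mfderiv_eq_fderiv, fderiv_fst]
    exact map_zero (mfderiv 𝓘(ℝ, E) 𝓘(ℝ, E) (extChartAt 𝓘(ℝ, E) q₀).symm z.1)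
  obtain ⟨p, hp, hpB⟩ := exists_momentum (B := pullBilin L.form ρ) Metric.isOpen_ball
    (convex_ball z₀.1 r) Metric.isOpen_ball (convex_ball z₀.2 r) (Metric.mem_ball_self hr)
    (Metric.mem_ball_self hr)
    (fun z hz => (contDiffAt_pullBilin L.isSmooth_form (hball z hz).2.1).contDiffWithinAt)
    (fun z _ u v => by
      rw [pullBilin_apply, pullBilin_apply]
      exact alternating_swap (G := F) _ _ _)
    (fun z hz u v w => pullBilin_closed L.isSmooth_form L.isClosed_form (hball z hz).2.1 u v w)
    (fun z hz k k' => by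
      rw [pullBilin_apply]
      exact L.form_vertical (hvert z hz k) (hvert z hz k'))
  -- Subtracting the constant p(z₀) puts x₀ on the zero covector without changing dp.
  let Ψ : E × K → E × (E →L[ℝ] ℝ) := fun z => (z.1, p z - p z₀)
  have hΨc : ∀ z ∈ Metric.ball z₀.1 r ×ˢ Metric.ball z₀.2 r, ContDiffAt ℝ ∞ Ψ z := fun z hz =>
    contDiffAt_fst.prodMk ((hp.contDiffAt (hopen.mem_nhds hz)).sub contDiffAt_const)
  have hΨd : ∀ z ∈ Metric.ball z₀.1 r ×ˢ Metric.ball z₀.2 r, ∀ u,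
      fderiv ℝ Ψ z u = (u.1, fderiv ℝ p z u) := fun z hz u => by
    have h1 : HasFDerivAt Ψ ((ContinuousLinearMap.fst ℝ E K).prod (fderiv ℝ p z)) z :=
      hasFDerivAt_fst.prodMk
        (((hp.contDiffAt (hopen.mem_nhds hz)).differentiableAt (by simp)).hasFDerivAt.sub_const _)
    rw [h1.fderiv]
    rfl
  have hΨs : ∀ z ∈ Metric.ball z₀.1 r ×ˢ Metric.ball z₀.2 r, ∀ u w,
      stdForm E (fderiv ℝ Ψ z u) (fderiv ℝ Ψ z w) = pullBilin L.form ρ z u w := fun z hz u w => by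
    rw [hpB z hz, hΨd z hz, hΨd z hz]
    rfl
  have hΨi : ∀ z ∈ Metric.ball z₀.1 r ×ˢ Metric.ball z₀.2 r, Function.Injective (fderiv ℝ Ψ z) := by
    intro z hz
    refine (injective_iff_map_eq_zero _).2 fun u hu => ?_
    have h1 : ∀ w, pullBilin L.form ρ z u w = 0 := fun w => by
      rw [← hΨs z hz, hu]
      simp [stdForm]
    have h2 : mfderiv 𝓘(ℝ, E × K) 𝓘(ℝ, F) ρ z u = 0 := by
      refine L.nondegenerate _ _ fun w => ?_
      obtain ⟨w', rfl⟩ := (hball z hz).2.2.1.2 w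
      exact (pullBilin_apply L.form ρ z u w').symm.trans (h1 w')
    exact (hball z hz).2.2.1.1 (h2.trans (map_zero _).symm)
  obtain ⟨e, hze, heN, hes, hsm⟩ := exists_openPartialHomeomorph (s := Ψ) (z := z₀) (by
    filter_upwards [hopen.mem_nhds hz₀m] with z hz
    refine ⟨(hΨc z hz).contMDiffAt, ?_⟩
    rw [mfderiv_eq_fderiv]
    exact hΨi z hz) hdim (hopen.mem_nhds hz₀m)
  have hz₀1 : z₀.1 = extChartAt 𝓘(ℝ, E) q₀ (L.proj x₀) := by
    rw [← hz₀, (hball z₀ hz₀m).2.2.2, (extChartAt 𝓘(ℝ, E) q₀).right_inv (hball z₀ hz₀m).1]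
  have hΨ₀ : e z₀ = (extChartAt 𝓘(ℝ, E) q₀ (L.proj x₀), 0) := by
    rw [hes _ hze, ← hz₀1]
    exact Prod.ext rfl (sub_self _)
  rw [← hΨ₀]
  refine ⟨ρ ∘ e.symm, ?_, ?_⟩
  · filter_upwards [e.open_target.mem_nhds (e.map_source hze)] with z hz
    have hm := heN (e.map_target hz)
    have hfst : (e.symm z).1 = z.1 := by
      have := e.right_inv hz
      rw [hes _ (e.map_target hz)] at this
      exact congrArg Prod.fst this
    have hθ : ContDiffAt ℝ ∞ e.symm z := (hsm z hz).contDiffAt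
    refine ⟨hfst ▸ (hball _ hm).1, (hball _ hm).2.1.comp z (hsm z hz), ?_, fun u w => ?_⟩
    · rw [← hfst]
      exact (hball _ hm).2.2.2
    · rw [pullBilin_comp _ ((hball _ hm).2.1.mdifferentiableAt (by simp))
        (hθ.differentiableAt (by simp)), ← hΨs _ hm]
      have h1 : HasFDerivAt (Ψ ∘ e.symm) ((fderiv ℝ Ψ (e.symm z)).comp (fderiv ℝ e.symm z)) z :=
        ((hΨc _ hm).differentiableAt (by simp)).hasFDerivAt.comp z
          (hθ.differentiableAt (by simp)).hasFDerivAt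
      have h2 : HasFDerivAt (Ψ ∘ e.symm) (ContinuousLinearMap.id ℝ _) z := by
        refine (hasFDerivAt_id z).congr_of_eventuallyEq ?_
        filter_upwards [e.open_target.mem_nhds hz] with z' hz'
        change Ψ (e.symm z') = z'
        rw [← hes _ (e.map_target hz')]
        exact e.right_inv hz'
      have h3 : ∀ v, fderiv ℝ Ψ (e.symm z) (fderiv ℝ e.symm z v) = v := fun v =>
        congrArg (fun l => l v) (h1.unique h2)
      rw [h3, h3]
  · change ρ (e.symm (e z₀)) = x₀
    rw [e.left_inv hze, hz₀]

end Existence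

/-! ### The fibrewise action of covectors -/

/-- Put a(ξ) = e(ξ/n)ⁿ for n large. Passing to a common multiple shows that n is irrelevant. Values
of e on small vectors commute because addition of vectors does, so the powers multiply. This
replaces completeness of Hamiltonian flows. -/
theorem exists_additive_extension {V M : Type*} [NormedAddCommGroup V] [NormedSpace ℝ V] [Monoid M]
    {e : V → M} {ε : ℝ} (hε : 0 < ε) (h0 : e 0 = 1)
    (he : ∀ ξ η, ‖ξ‖ < ε → ‖η‖ < ε → e (ξ + η) = e ξ * e η) :
    ∃ a : V → M, (∀ ξ η, a (ξ + η) = a ξ * a η) ∧ ∀ ξ, ‖ξ‖ < ε → a ξ = e ξ := by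
  have hpow : ∀ (ξ : V) (n : ℕ), 0 < n → ‖ξ‖ < ε → e ξ = e ((n : ℝ)⁻¹ • ξ) ^ n := by
    intro ξ n hn hξ
    have hn' : (0 : ℝ) < n := Nat.cast_pos.2 hn
    have key : ∀ k : ℕ, k ≤ n → e (((k : ℝ) * (n : ℝ)⁻¹) • ξ) = e ((n : ℝ)⁻¹ • ξ) ^ k := by
      intro k
      induction k with
      | zero => intro _; simp [h0]
      | succ k ih =>
        intro hk
        have hb : ∀ c : ℝ, 0 ≤ c → c ≤ 1 → ‖c • ξ‖ < ε := fun c hc hc1 => by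
          rw [norm_smul, Real.norm_of_nonneg hc]
          exact (mul_le_of_le_one_left (norm_nonneg _) hc1).trans_lt hξ
        rw [pow_succ, ← ih (by omega), ← he]
        · congr 1
          rw [← add_smul]
          push_cast
          ring_nf
        · refine hb _ (by positivity) ?_
          rw [← div_eq_mul_inv, div_le_one hn']
          exact_mod_cast (by omega : k ≤ n)
        · refine hb _ (by positivity) ?_
          exact inv_le_one_of_one_le₀ (by exact_mod_cast hn)
    have := key n le_rfl
    rwa [mul_inv_cancel₀ hn'.ne', one_smul] at this
  -- An explicit n for which ξ/n is in the domain of additivity; the 1 makes it positive and the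
  -- inequality strict.
  let N : V → ℕ := fun ξ => ⌊‖ξ‖ / ε⌋₊ + 1
  have hN : ∀ ξ, ‖ξ‖ < ε * N ξ := fun ξ => by
    have := Nat.lt_floor_add_one (‖ξ‖ / ε)
    rw [div_lt_iff₀ hε] at this
    simpa [N, mul_comm] using this
  have hsm : ∀ (ξ : V) (n : ℕ), 0 < n → ‖ξ‖ < ε * n → ‖(n : ℝ)⁻¹ • ξ‖ < ε := fun ξ n hn h => by
    rw [norm_smul, norm_inv, Real.norm_natCast, inv_mul_lt_iff₀ (by exact_mod_cast hn), mul_comm]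
    exact h
  have hNpos : ∀ ξ, 0 < N ξ := fun ξ => Nat.succ_pos _
  have hind : ∀ (ξ : V) (n m : ℕ), 0 < n → 0 < m → ‖ξ‖ < ε * n →
      e ((n : ℝ)⁻¹ • ξ) ^ n = e (((n * m : ℕ) : ℝ)⁻¹ • ξ) ^ (n * m) := by
    intro ξ n m hn hm h
    rw [hpow _ m hm (hsm ξ n hn h), smul_smul, ← pow_mul, mul_comm m n]
    congr 3
    push_cast
    rw [mul_inv, mul_comm]
  have hind' : ∀ (ξ : V) (n : ℕ), 0 < n → ‖ξ‖ < ε * n →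
      e ((n : ℝ)⁻¹ • ξ) ^ n = e ((N ξ : ℝ)⁻¹ • ξ) ^ N ξ := by
    intro ξ n hn h
    rw [hind ξ n (N ξ) hn (hNpos ξ) h, hind ξ (N ξ) n (hNpos ξ) hn (hN ξ), mul_comm]
  refine ⟨fun ξ => e ((N ξ : ℝ)⁻¹ • ξ) ^ N ξ, fun ξ η => ?_, fun ξ hξ => ?_⟩
  · let n := N ξ + N η
    have hn : 0 < n := Nat.add_pos_left (hNpos ξ) _
    have h1 : ‖ξ‖ < ε * n := (hN ξ).trans_le (by
      gcongr
      exact_mod_cast Nat.le_add_right _ _)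
    have h2 : ‖η‖ < ε * n := (hN η).trans_le (by
      gcongr
      exact_mod_cast Nat.le_add_left _ _)
    have h3 : ‖ξ + η‖ < ε * n := (norm_add_le _ _).trans_lt (by
      have := add_lt_add (hN ξ) (hN η)
      simpa [n, mul_add] using this)
    have hc : Commute (e ((n : ℝ)⁻¹ • ξ)) (e ((n : ℝ)⁻¹ • η)) := by
      unfold Commute SemiconjBy
      rw [← he _ _ (hsm ξ n hn h1) (hsm η n hn h2), ← he _ _ (hsm η n hn h2) (hsm ξ n hn h1),
        add_comm]
    simp only
    rw [← hind' (ξ + η) n hn h3, ← hind' ξ n hn h1, ← hind' η n hn h2, smul_add,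
      he _ _ (hsm ξ n hn h1) (hsm η n hn h2), hc.mul_pow]
  · have := hind' ξ 1 one_pos (by simpa using hξ)
    simp only
    rw [← this]
    simp

section Action

variable {E : Type*} [NormedAddCommGroup E] [NormedSpace ℝ E] [FiniteDimensional ℝ E]
  {F : Type*} [NormedAddCommGroup F] [NormedSpace ℝ F] [FiniteDimensional ℝ F]
  {Q : Type*} [TopologicalSpace Q] [ChartedSpace E Q]
  {X : Type*} [TopologicalSpace X] [ChartedSpace F X] [IsManifold 𝓘(ℝ, F) ∞ X]
  {L : LagrangianTorusFibration E F Q X} {q₀ : Q}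

/-- The parameters where the two translates agree form a closed set, since X is Hausdorff. It is
open by `IsLagAt.transition`: within a fibre the two germs differ by a constant translation, here by
z₂.2 - z₁.2. -/
theorem IsLagAt.eq_along_segment [T2Space X] {s₁ s₂ : E × (E →L[ℝ] ℝ) → X} {z₁ z₂ : E × (E →L[ℝ] ℝ)}
    {ξ : E →L[ℝ] ℝ} (h₁ : ∀ t ∈ Set.Icc (0 : ℝ) 1, IsLagAt L q₀ s₁ (z₁.1, z₁.2 + t • ξ))
    (h₂ : ∀ t ∈ Set.Icc (0 : ℝ) 1, IsLagAt L q₀ s₂ (z₂.1, z₂.2 + t • ξ)) (he : s₁ z₁ = s₂ z₂) :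
    s₁ (z₁.1, z₁.2 + ξ) = s₂ (z₂.1, z₂.2 + ξ) := by
  have hc : ∀ z : E × (E →L[ℝ] ℝ), Continuous fun t : ℝ => (z.1, z.2 + t • ξ) := fun z => by fun_prop
  have hcl : IsClosed ({t : ℝ | s₁ (z₁.1, z₁.2 + t • ξ) = s₂ (z₂.1, z₂.2 + t • ξ)} ∩ Set.Icc 0 1) := by
    have hc₁ : ContinuousOn (fun t : ℝ => s₁ (z₁.1, z₁.2 + t • ξ)) (Set.Icc 0 1) := fun t ht =>
      (ContinuousAt.comp (g := s₁) (f := fun t : ℝ => (z₁.1, z₁.2 + t • ξ))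
        (h₁ t ht).contMDiffAt.continuousAt (hc z₁).continuousAt).continuousWithinAt
    have hc₂ : ContinuousOn (fun t : ℝ => s₂ (z₂.1, z₂.2 + t • ξ)) (Set.Icc 0 1) := fun t ht =>
      (ContinuousAt.comp (g := s₂) (f := fun t : ℝ => (z₂.1, z₂.2 + t • ξ))
        (h₂ t ht).contMDiffAt.continuousAt (hc z₂).continuousAt).continuousWithinAt
    have := (hc₁.prodMk hc₂).preimage_isClosed_of_isClosed isClosed_Icc isClosed_diagonal
    rw [Set.inter_comm]
    exact this
  have hsub := hcl.Icc_subset_of_forall_mem_nhdsWithin (by simpa using he) (fun t ht => by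
    have ht' : t ∈ Set.Icc (0 : ℝ) 1 := ⟨ht.2.1, ht.2.2.le⟩
    obtain ⟨r, hr, f, hf, hf0, hfe⟩ := (h₁ t ht').transition (h₂ t ht') ht.1
    refine mem_nhdsWithin_of_mem_nhds ?_
    filter_upwards [(hc z₁).continuousAt.preimage_mem_nhds (Metric.ball_mem_nhds _ hr)] with t' ht''
    rw [hfe _ ht'']
    simp only [hf0]
    have k := (h₁ t ht').fst_eq
    have k' := (h₂ t ht').fst_eq
    have e1 : z₁.1 = z₂.1 := by
      have := ht.1
      rw [this] at k
      exact k.trans k'.symm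
    rw [e1]
    congr 2
    module)
  simpa using hsub (Set.right_mem_Icc.2 zero_le_one)

/-- Every point is the value of a germ at the centre of a ball. Compactness of the part of X over
the compact set makes the radius uniform. Halving the radius leaves room to recentre at a nearby
point. -/
theorem LagrangianTorusFibration.exists_uniform_isLagAt [IsManifold 𝓘(ℝ, E) ∞ Q] [T2Space Q]
    [CompactSpace X] (L : LagrangianTorusFibration E F Q X) {K : Set E} (hK : IsCompact K)
    (hKt : K ⊆ (extChartAt 𝓘(ℝ, E) q₀).target) :
    ∃ ε > 0, ∀ x, L.proj x ∈ (extChartAt 𝓘(ℝ, E) q₀).symm '' K →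
      ∃ (s : E × (E →L[ℝ] ℝ) → X) (z : E × (E →L[ℝ] ℝ)), s z = x ∧
        ∀ z' ∈ Metric.ball z ε, IsLagAt L q₀ s z' := by
  have hN : IsCompact (L.proj ⁻¹' ((extChartAt 𝓘(ℝ, E) q₀).symm '' K)) := by
    refine IsClosed.isCompact (IsClosed.preimage L.contMDiff_proj.continuous (IsCompact.isClosed ?_))
    exact hK.image_of_continuousOn ((continuousOn_extChartAt_symm q₀).mono hKt)
  refine hN.induction_on (p := fun S => ∃ ε > 0, ∀ x ∈ S,
      ∃ (s : E × (E →L[ℝ] ℝ) → X) (z : E × (E →L[ℝ] ℝ)), s z = x ∧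
        ∀ z' ∈ Metric.ball z ε, IsLagAt L q₀ s z') ⟨1, one_pos, by simp⟩ ?_ ?_ ?_
  · rintro S T hST ⟨ε, hε, h⟩
    exact ⟨ε, hε, fun x hx => h x (hST hx)⟩
  · rintro S T ⟨ε, hε, h⟩ ⟨ε', hε', h'⟩
    refine ⟨min ε ε', lt_min hε hε', fun x hx => ?_⟩
    rcases hx with hx | hx
    · obtain ⟨s, z, h1, h2⟩ := h x hx
      exact ⟨s, z, h1, fun z' hz' => h2 z' (Metric.ball_subset_ball (min_le_left _ _) hz')⟩
    · obtain ⟨s, z, h1, h2⟩ := h' x hx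
      exact ⟨s, z, h1, fun z' hz' => h2 z' (Metric.ball_subset_ball (min_le_right _ _) hz')⟩
  · rintro x₀ ⟨y, hy, hxy⟩
    obtain ⟨s, hs, hsx⟩ := L.exists_isLagAt (x₀ := x₀) (q₀ := q₀)
      (hxy ▸ (extChartAt 𝓘(ℝ, E) q₀).map_target (hKt hy))
    set z₀ : E × (E →L[ℝ] ℝ) := (extChartAt 𝓘(ℝ, E) q₀ (L.proj x₀), 0)
    obtain ⟨e, hze, heN, hes, -⟩ := hs.exists_openPartialHomeomorph hs.eventually
    obtain ⟨r, hr, hball⟩ := Metric.isOpen_iff.1 e.open_source z₀ hze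
    have hx₀ : e z₀ = x₀ := (hes _ hze).trans hsx
    have hO : e.target ∩ e.symm ⁻¹' Metric.ball z₀ (r / 2) ∈ 𝓝 x₀ := by
      have h1 := e.map_source hze
      rw [hx₀] at h1
      refine Filter.inter_mem (e.open_target.mem_nhds h1)
        ((e.continuousAt_symm h1).preimage_mem_nhds ?_)
      rw [← hx₀, e.left_inv hze]
      exact Metric.ball_mem_nhds _ (half_pos hr)
    refine ⟨_, mem_nhdsWithin_of_mem_nhds hO, r / 2, half_pos hr, fun x hx => ⟨s, e.symm x, ?_, ?_⟩⟩
    · rw [← hes _ (e.map_target hx.1)]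
      exact e.right_inv hx.1
    · intro z' hz'
      refine heN (hball ?_)
      have h1 := Metric.mem_ball.1 hx.2
      have h2 := Metric.mem_ball.1 hz'
      rw [Metric.mem_ball]
      linarith [dist_triangle z' (e.symm x) z₀]

omit [FiniteDimensional ℝ E] in
theorem segment_mem_ball {z₀ z : E × (E →L[ℝ] ℝ)} {ξ : E →L[ℝ] ℝ} {r : ℝ}
    (h₀ : z ∈ Metric.ball z₀ r) (h₁ : (z.1, z.2 + ξ) ∈ Metric.ball z₀ r) {t : ℝ}
    (ht : t ∈ Set.Icc (0 : ℝ) 1) : (z.1, z.2 + t • ξ) ∈ Metric.ball z₀ r := by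
  have := (convex_ball z₀ r).add_smul_sub_mem h₀ h₁ ht
  convert this using 1
  refine Prod.ext ?_ ?_ <;> simp

/-- A small covector moves a point by translation in any germ through it; `IsLagAt.eq_along_segment`
makes this independent of the germ, hence additive. The extension to all covectors is taken in the
monoid of self-maps of X. That the action again yields germs is proved for small covectors and then
iterated. -/
theorem LagrangianTorusFibration.exists_fibre_action [IsManifold 𝓘(ℝ, E) ∞ Q] [T2Space Q]
    [T2Space X] [CompactSpace X] (L : LagrangianTorusFibration E F Q X) {K : Set E}
    (hK : IsCompact K) (hKt : K ⊆ (extChartAt 𝓘(ℝ, E) q₀).target) :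
    ∃ (a : (E →L[ℝ] ℝ) → X → X) (ε : ℝ), 0 < ε ∧ (∀ ξ η x, a (ξ + η) x = a ξ (a η x)) ∧
      (∀ x, a 0 x = x) ∧
      (∀ (s : E × (E →L[ℝ] ℝ) → X) (z : E × (E →L[ℝ] ℝ)) (ξ : E →L[ℝ] ℝ), z.1 ∈ K → ‖ξ‖ < ε →
        (∀ t ∈ Set.Icc (0 : ℝ) 1, IsLagAt L q₀ s (z.1, z.2 + t • ξ)) →
        a ξ (s z) = s (z.1, z.2 + ξ)) ∧
      (∀ (s : E × (E →L[ℝ] ℝ) → X) (z : E × (E →L[ℝ] ℝ)) (ξ : E →L[ℝ] ℝ), z.1 ∈ interior K →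
        IsLagAt L q₀ s z → IsLagAt L q₀ (a ξ ∘ s) z) := by
  classical
  obtain ⟨ε, hε, hs⟩ := L.exists_uniform_isLagAt hK hKt
  have hs' : ∀ x, ∃ (s : E × (E →L[ℝ] ℝ) → X) (z : E × (E →L[ℝ] ℝ)),
      L.proj x ∈ (extChartAt 𝓘(ℝ, E) q₀).symm '' K → s z = x ∧
        ∀ z' ∈ Metric.ball z ε, IsLagAt L q₀ s z' := fun x => by
    by_cases hx : L.proj x ∈ (extChartAt 𝓘(ℝ, E) q₀).symm '' K
    · obtain ⟨s, z, h⟩ := hs x hx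
      exact ⟨s, z, fun _ => h⟩
    · exact ⟨fun _ => x, 0, fun h => absurd h hx⟩
  choose σ ζ hσζ using hs'
  have hσ := fun x hx => (hσζ x hx).1
  have hLag := fun x hx => (hσζ x hx).2
  let N : Set X := L.proj ⁻¹' ((extChartAt 𝓘(ℝ, E) q₀).symm '' K)
  -- Points not over the compact set are fixed, which makes the maps total and keeps additivity.
  let e : (E →L[ℝ] ℝ) → Function.End X := fun ξ x => if x ∈ N then σ x ((ζ x).1, (ζ x).2 + ξ) else x
  have hNm : ∀ (s : E × (E →L[ℝ] ℝ) → X) (z : E × (E →L[ℝ] ℝ)), z.1 ∈ K → IsLagAt L q₀ s z →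
      s z ∈ N := fun s z hz h => ⟨z.1, hz, h.proj_eq.symm⟩
  have hball : ∀ x (ξ : E →L[ℝ] ℝ), ‖ξ‖ < ε → ((ζ x).1, (ζ x).2 + ξ) ∈ Metric.ball (ζ x) ε :=
    fun x ξ hξ => by
      rw [Metric.mem_ball, dist_eq_norm]
      simpa [Prod.norm_def, hε] using hξ
  have hW : ∀ (s : E × (E →L[ℝ] ℝ) → X) (z : E × (E →L[ℝ] ℝ)) (ξ : E →L[ℝ] ℝ), z.1 ∈ K → ‖ξ‖ < ε →
        (∀ t ∈ Set.Icc (0 : ℝ) 1, IsLagAt L q₀ s (z.1, z.2 + t • ξ)) →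
        e ξ (s z) = s (z.1, z.2 + ξ) := by
    intro s z ξ hz hξ h
    have hm : s z ∈ N := hNm s z hz (by simpa using h 0 (by simp))
    simp only [e, if_pos hm]
    exact IsLagAt.eq_along_segment (fun t ht => hLag _ hm _
      (segment_mem_ball (Metric.mem_ball_self hε) (hball _ ξ hξ) ht)) h (hσ _ hm)
  have hζ : ∀ x ∈ N, (ζ x).1 ∈ K := by
    rintro x hx
    have h1 := (hLag x hx _ (Metric.mem_ball_self hε)).fst_eq
    rw [hσ x hx] at h1
    obtain ⟨y, hy, hxy⟩ := hx
    rw [h1, ← hxy, (extChartAt 𝓘(ℝ, E) q₀).right_inv (hKt hy)]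
    exact hy
  obtain ⟨a, ha, hae⟩ := exists_additive_extension (e := e) (half_pos hε) (by
      funext x
      by_cases hx : x ∈ N
      · simp only [e, if_pos hx, add_zero]
        exact hσ x hx
      · simp only [e, if_neg hx]
        rfl) (by
      intro ξ η hξ hη
      funext x
      change e (ξ + η) x = e ξ (e η x)
      by_cases hx : x ∈ N
      · have h1 : e η x = σ x ((ζ x).1, (ζ x).2 + η) := by simp only [e, if_pos hx]
        have h2 : e (ξ + η) x = σ x ((ζ x).1, (ζ x).2 + (ξ + η)) := by simp only [e, if_pos hx]
        have hη' : ‖η‖ < ε := by linarith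
        rw [h1, h2, hW (σ x) ((ζ x).1, (ζ x).2 + η) ξ (hζ x hx) (by linarith)]
        · simp only
          rw [add_assoc, add_comm η ξ]
        · intro t ht
          refine hLag x hx _ (segment_mem_ball (hball x η hη') ?_ ht)
          simp only
          rw [add_assoc]
          exact hball x _ ((norm_add_le _ _).trans_lt (by linarith))
      · have h1 : ∀ ζ, e ζ x = x := fun ζ => by simp only [e, if_neg hx]
        rw [h1 (ξ + η), h1 η, h1 ξ])
  have hadd : ∀ ξ η x, a (ξ + η) x = a ξ (a η x) := fun ξ η x => congrFun (ha ξ η) x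
  have hzero : ∀ x, a 0 x = x := fun x => by
    rw [hae 0 (by simpa using hε)]
    by_cases hx : x ∈ N
    · simp only [e, if_pos hx]
      simpa using hσ x hx
    · simp only [e, if_neg hx]
  -- Near z the germ s is a translate by some df of the chosen germ σ, so applying a(ξ) yields σ
  -- translated by df + ξ.
  have hsmall : ∀ (s : E × (E →L[ℝ] ℝ) → X) (z : E × (E →L[ℝ] ℝ)) (ξ : E →L[ℝ] ℝ),
      z.1 ∈ interior K → ‖ξ‖ < ε / 2 → IsLagAt L q₀ s z → IsLagAt L q₀ (a ξ ∘ s) z := by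
    intro s z ξ hz hξ h
    have hm : s z ∈ N := hNm s z (interior_subset hz) h
    have hξ' : ‖ξ‖ < ε := by linarith
    have hL0 := hLag _ hm _ (Metric.mem_ball_self hε)
    have hfst : (ζ (s z)).1 = z.1 := by
      rw [hL0.fst_eq, hσ _ hm, ← h.fst_eq]
    obtain ⟨r, hr, f, hf, hf0, hfe⟩ := h.transition hL0 (hσ _ hm).symm
    have hfd : ContinuousAt (fun z' : E × (E →L[ℝ] ℝ) => (z'.1, z'.2 + fderiv ℝ f z'.1)) z := by
      have h1 : ContinuousAt (fderiv ℝ f) z.1 :=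
        ((hf.contDiffAt (Metric.ball_mem_nhds _ hr)).fderiv_right (m := ∞) (by simp)).continuousAt
      exact continuousAt_fst.prodMk
        (continuousAt_snd.add (ContinuousAt.comp (g := fderiv ℝ f) h1 continuousAt_fst))
    have hval : (z.1, z.2 + fderiv ℝ f z.1) = ζ (s z) := by
      rw [hf0]
      exact Prod.ext hfst.symm (by simp)
    have hpt : ((z.1, z.2 + (fderiv ℝ f z.1 + ξ)) : E × (E →L[ℝ] ℝ)) =
        ((ζ (s z)).1, (ζ (s z)).2 + ξ) := by
      rw [← hval]
      simp only
      rw [add_assoc]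
    have hLag2 : IsLagAt L q₀ (fun z' => σ (s z) (z'.1, z'.2 + (fderiv ℝ f z'.1 + ξ))) z := by
      refine IsLagAt.comp_translation ?_ ?_
      · filter_upwards [Metric.ball_mem_nhds z.1 hr] with y hy
        exact hf.contDiffAt (Metric.isOpen_ball.mem_nhds hy)
      · rw [hpt]
        exact hLag _ hm _ (hball _ ξ hξ')
    refine hLag2.congr ?_
    have hnear := hfd.preimage_mem_nhds (t := Metric.ball (ζ (s z)) (ε / 2)) (by
      rw [hval]
      exact Metric.ball_mem_nhds (ζ (s z)) (half_pos hε))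
    filter_upwards [hnear, Metric.ball_mem_nhds z hr, continuous_fst.continuousAt.preimage_mem_nhds
      (isOpen_interior.mem_nhds hz)] with z' h1 h2 h3
    have h1' : dist ((z'.1, z'.2 + fderiv ℝ f z'.1) : E × (E →L[ℝ] ℝ)) (ζ (s z)) < ε / 2 := h1
    change a ξ (s z') = _
    rw [hae ξ hξ, hfe z' h2, hW (σ (s z)) (z'.1, z'.2 + fderiv ℝ f z'.1) ξ (interior_subset h3) hξ']
    · simp only
      rw [add_assoc]
    · intro t ht
      refine hLag _ hm _ (segment_mem_ball ?_ ?_ ht)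
      · rw [Metric.mem_ball]
        linarith
      · rw [Metric.mem_ball]
        refine (dist_triangle _ ((z'.1, z'.2 + fderiv ℝ f z'.1) : E × (E →L[ℝ] ℝ)) _).trans_lt ?_
        have h4 : dist ((z'.1, z'.2 + fderiv ℝ f z'.1 + ξ) : E × (E →L[ℝ] ℝ))
            (z'.1, z'.2 + fderiv ℝ f z'.1) = ‖ξ‖ := by
          rw [dist_eq_norm]
          simp [Prod.norm_def]
        simp only
        rw [h4]
        linarith
  refine ⟨a, ε / 2, half_pos hε, hadd, hzero, ?_, ?_⟩
  · intro s z ξ hz hξ h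
    rw [hae ξ hξ]
    exact hW s z ξ hz (by linarith) h
  · intro s z ξ hz h
    obtain ⟨n, hn⟩ := exists_nat_gt (‖ξ‖ / (ε / 2))
    have hn0 : (0 : ℝ) < n := lt_of_le_of_lt (by positivity) hn
    have hη : ‖(n : ℝ)⁻¹ • ξ‖ < ε / 2 := by
      rw [norm_smul, norm_inv, Real.norm_natCast, inv_mul_lt_iff₀ hn0]
      rwa [div_lt_iff₀ (half_pos hε)] at hn
    -- A large covector acts as n successive small steps of size ξ/n.
    have key : ∀ k : ℕ, IsLagAt L q₀ (a ((k : ℝ) • (n : ℝ)⁻¹ • ξ) ∘ s) z := by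
      intro k
      induction k with
      | zero =>
        refine h.congr (.of_forall fun z' => ?_)
        change a (((0 : ℕ) : ℝ) • (n : ℝ)⁻¹ • ξ) (s z') = s z'
        rw [Nat.cast_zero, zero_smul, hzero]
      | succ k ih =>
        refine (hsmall _ z _ hz hη ih).congr (.of_forall fun z' => ?_)
        have e1 : ((k + 1 : ℕ) : ℝ) • (n : ℝ)⁻¹ • ξ = (n : ℝ)⁻¹ • ξ + (k : ℝ) • (n : ℝ)⁻¹ • ξ := by
          push_cast
          module
        change a (((k + 1 : ℕ) : ℝ) • (n : ℝ)⁻¹ • ξ) (s z') =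
          a ((n : ℝ)⁻¹ • ξ) (a ((k : ℝ) • (n : ℝ)⁻¹ • ξ) (s z'))
        rw [e1, hadd]
    have := key n
    rwa [smul_smul, mul_inv_cancel₀ hn0.ne', one_smul] at this

end Action

/-! ### Sections of the fibrewise action and their stabilisers -/

section Sections

variable {E : Type*} [NormedAddCommGroup E] [NormedSpace ℝ E] [FiniteDimensional ℝ E]
  {F : Type*} [NormedAddCommGroup F] [NormedSpace ℝ F] [FiniteDimensional ℝ F]
  {Q : Type*} [TopologicalSpace Q] [ChartedSpace E Q]
  {X : Type*} [TopologicalSpace X] [ChartedSpace F X] [IsManifold 𝓘(ℝ, F) ∞ X]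
  {L : LagrangianTorusFibration E F Q X} {q₀ : Q}

/-- The action is applied to the zero section of one germ: S(y, η) = a(η) s(y, 0). It reaches the
whole fibre because orbits are open in the fibre, which is connected. -/
theorem LagrangianTorusFibration.exists_section [IsManifold 𝓘(ℝ, E) ∞ Q] [T2Space Q]
    [T2Space X] [CompactSpace X] (L : LagrangianTorusFibration E F Q X) {y₀ : E}
    (hy₀ : y₀ ∈ (extChartAt 𝓘(ℝ, E) q₀).target) :
    ∃ r > 0, ∃ S : E × (E →L[ℝ] ℝ) → X, Metric.ball y₀ r ⊆ (extChartAt 𝓘(ℝ, E) q₀).target ∧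
      (∀ y ∈ Metric.ball y₀ r, ∀ η, IsLagAt L q₀ S (y, η)) ∧
      ∀ y ∈ Metric.ball y₀ r, ∀ x, L.proj x = (extChartAt 𝓘(ℝ, E) q₀).symm y → ∃ η, S (y, η) = x := by
  obtain ⟨R, hR, hRt⟩ := Metric.nhds_basis_closedBall.mem_iff.1
    ((isOpen_extChartAt_target (I := 𝓘(ℝ, E)) q₀).mem_nhds hy₀)
  obtain ⟨a, ε, hε, hadd, hzero, haS, haL⟩ := L.exists_fibre_action
    (isCompact_closedBall y₀ R) hRt
  obtain ⟨x₀, hx₀⟩ := (L.connected_fibre ((extChartAt 𝓘(ℝ, E) q₀).symm y₀)).nonempty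
  have hx₀' : L.proj x₀ = (extChartAt 𝓘(ℝ, E) q₀).symm y₀ := hx₀
  obtain ⟨s, hs, -⟩ := L.exists_isLagAt (x₀ := x₀) (q₀ := q₀)
    (hx₀' ▸ (extChartAt 𝓘(ℝ, E) q₀).map_target hy₀)
  rw [hx₀', (extChartAt 𝓘(ℝ, E) q₀).right_inv hy₀] at hs
  obtain ⟨r', hr', hball'⟩ := Metric.eventually_nhds_iff_ball.1 hs.eventually
  let r := min r' R
  have hr : 0 < r := lt_min hr' hR
  have hball : ∀ z ∈ Metric.ball ((y₀, 0) : E × (E →L[ℝ] ℝ)) r, IsLagAt L q₀ s z := fun z hz =>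
    hball' z (Metric.ball_subset_ball (min_le_left _ _) hz)
  have hmem : ∀ y ∈ Metric.ball y₀ r, ∀ η : E →L[ℝ] ℝ, ‖η‖ < r →
      ((y, η) : E × (E →L[ℝ] ℝ)) ∈ Metric.ball ((y₀, 0) : E × (E →L[ℝ] ℝ)) r := fun y hy η hη => by
    rw [← ball_prod_same]
    exact ⟨hy, by simpa using hη⟩
  have hint : ∀ y ∈ Metric.ball y₀ r, y ∈ interior (Metric.closedBall y₀ R) := fun y hy =>
    interior_mono Metric.ball_subset_closedBall
      (by rw [Metric.isOpen_ball.interior_eq]; exact Metric.ball_subset_ball (min_le_right _ _) hy)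
  have hS : ∀ y ∈ Metric.ball y₀ r, ∀ η, IsLagAt L q₀ (fun z => a z.2 (s (z.1, 0))) (y, η) := by
    intro y hy η
    have h1 : IsLagAt L q₀ (a η ∘ s) (y, 0) :=
      haL s (y, 0) η (hint y hy) (hball _ (hmem y hy 0 (by simpa using hr)))
    -- Near (y, η), S is a(η) ∘ s with the fibre coordinate shifted by -η, so that only s close to
    -- the zero covector is involved.
    have h2 : IsLagAt L q₀ (fun z => (a η ∘ s) (z.1, z.2 + (fderiv ℝ (fun _ : E => (0 : ℝ)) z.1 + -η)))
        (y, η) := by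
      refine IsLagAt.comp_translation (.of_forall fun _ => contDiffAt_const) ?_
      simpa using h1
    refine h2.congr ?_
    have hn : ∀ᶠ z in 𝓝 ((y, η) : E × (E →L[ℝ] ℝ)), z.1 ∈ Metric.ball y₀ r ∧
        ‖z.2 - η‖ < min ε r := by
      refine Filter.Eventually.and (continuousAt_fst.preimage_mem_nhds
        (Metric.isOpen_ball.mem_nhds hy)) ?_
      have hc : Continuous fun z : E × (E →L[ℝ] ℝ) => ‖z.2 - η‖ := by fun_prop
      refine hc.continuousAt.eventually_lt continuousAt_const ?_
      simpa using ⟨hε, hr⟩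
    filter_upwards [hn] with z hz
    have h3 := haS s (z.1, 0) (z.2 - η) (Metric.ball_subset_closedBall
      (Metric.ball_subset_ball (min_le_right _ _) hz.1)) (hz.2.trans_le (min_le_left _ _))
      (fun t ht => hball _ (hmem _ hz.1 _ (by
        rw [zero_add, norm_smul, Real.norm_of_nonneg ht.1]
        exact (mul_le_of_le_one_left (norm_nonneg _) ht.2).trans_lt
          (hz.2.trans_le (min_le_right _ _)))))
    have e1 : a z.2 (s (z.1, 0)) = a η (a (z.2 - η) (s (z.1, 0))) := by
      rw [← hadd, add_sub_cancel]
    change a z.2 (s (z.1, 0)) = _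
    rw [e1, h3]
    simp [sub_eq_add_neg]
  refine ⟨r, hr, fun z => a z.2 (s (z.1, 0)), ?_, hS, ?_⟩
  · exact (Metric.ball_subset_ball (min_le_right _ _)).trans
      (Metric.ball_subset_closedBall.trans hRt)
  · intro y hy
    have hyt : y ∈ (extChartAt 𝓘(ℝ, E) q₀).target := (hS y hy 0).mem_target
    -- orbits of the action are open in the fibre
    have horb : ∀ x, L.proj x = (extChartAt 𝓘(ℝ, E) q₀).symm y → ∃ O : Set X, IsOpen O ∧ x ∈ O ∧
        ∀ x' ∈ O, L.proj x' = (extChartAt 𝓘(ℝ, E) q₀).symm y → ∃ η, a η x = x' := by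
      intro x hx
      obtain ⟨σ, hσ, hσx⟩ := L.exists_isLagAt (x₀ := x) (q₀ := q₀)
        (hx ▸ (extChartAt 𝓘(ℝ, E) q₀).map_target hyt)
      rw [hx, (extChartAt 𝓘(ℝ, E) q₀).right_inv hyt] at hσ hσx
      obtain ⟨ρ, hρ, hρb⟩ := Metric.eventually_nhds_iff_ball.1 hσ.eventually
      obtain ⟨e, hze, heN, hes, -⟩ := hσ.exists_openPartialHomeomorph
        (Metric.ball_mem_nhds _ (lt_min hε hρ))
      refine ⟨e.target, e.open_target, ?_, fun x' hx' hp => ?_⟩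
      · rw [← hσx, ← hes _ hze]
        exact e.map_source hze
      · have h1 := heN (e.map_target hx')
        have h2 : σ (e.symm x') = x' := by
          rw [← hes _ (e.map_target hx')]
          exact e.right_inv hx'
        have h3 : (e.symm x').1 = y := by
          rw [(hρb _ (Metric.ball_subset_ball (min_le_right _ _) h1)).fst_eq, h2, hp,
            (extChartAt 𝓘(ℝ, E) q₀).right_inv hyt]
        have h4 : ‖(e.symm x').2‖ < min ε ρ := by
          rw [← ball_prod_same] at h1
          simpa using h1.2
        refine ⟨(e.symm x').2, ?_⟩
        have h5 := haS σ (y, 0) (e.symm x').2 (interior_subset (hint y hy))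
          (h4.trans_le (min_le_left _ _)) (fun t ht => hρb _ (by
            rw [← ball_prod_same]
            refine ⟨Metric.mem_ball_self hρ, ?_⟩
            rw [zero_add, mem_ball_zero_iff, norm_smul, Real.norm_of_nonneg ht.1]
            exact (mul_le_of_le_one_left (norm_nonneg _) ht.2).trans_lt
              (h4.trans_le (min_le_right _ _))))
        rw [hσx] at h5
        rw [h5]
        simp only [zero_add]
        rw [← h3, Prod.mk.eta, h2]
    choose! O hOo hxO hO using horb
    have hneg : ∀ η x x', a η x = x' → a (-η) x' = x := by
      rintro η x _ rfl
      rw [← hadd, neg_add_cancel, hzero]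
    have hpc := (L.connected_fibre ((extChartAt 𝓘(ℝ, E) q₀).symm y)).isPreconnected
    have hx1 : L.proj (s (y, 0)) = (extChartAt 𝓘(ℝ, E) q₀).symm y :=
      (hball _ (hmem y hy 0 (by simpa using hr))).proj_eq
    intro x hx
    by_contra hcon
    -- The fibre is split into the orbit of s(y, 0) and its complement. The open sets O around their
    -- points cannot be separated, by connectedness, and a common point joins the two orbits.
    let A : Set X := {x' | L.proj x' = (extChartAt 𝓘(ℝ, E) q₀).symm y ∧ ∃ η, a η (s (y, 0)) = x'}
    let B : Set X := {x' | L.proj x' = (extChartAt 𝓘(ℝ, E) q₀).symm y ∧ ¬ ∃ η, a η (s (y, 0)) = x'}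
    obtain ⟨p, hp, hpA, hpB⟩ := hpc (⋃ x' ∈ A, O x') (⋃ x' ∈ B, O x')
      (isOpen_biUnion fun x' hx' => hOo _ hx'.1) (isOpen_biUnion fun x' hx' => hOo _ hx'.1)
      (fun x' hx' => by
        by_cases h : ∃ η, a η (s (y, 0)) = x'
        · exact Or.inl (Set.mem_biUnion (show x' ∈ A from ⟨hx', h⟩) (hxO _ hx'))
        · exact Or.inr (Set.mem_biUnion (show x' ∈ B from ⟨hx', h⟩) (hxO _ hx')))
      ⟨s (y, 0), hx1, Set.mem_biUnion (show s (y, 0) ∈ A from ⟨hx1, 0, hzero _⟩) (hxO _ hx1)⟩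
      ⟨x, hx, Set.mem_biUnion (show x ∈ B from ⟨hx, hcon⟩) (hxO _ hx)⟩
    simp only [Set.mem_iUnion] at hpA hpB
    obtain ⟨x₁, ⟨h1, η₁, hη₁⟩, h1'⟩ := hpA
    obtain ⟨x₂, ⟨h2, h2n⟩, h2'⟩ := hpB
    obtain ⟨η, hη⟩ := hO _ h1 _ h1' hp
    obtain ⟨η', hη'⟩ := hO _ h2 _ h2' hp
    refine h2n ⟨-η' + (η + η₁), ?_⟩
    rw [hadd, hadd, hη₁, hη, hneg _ _ _ hη']

/-! ### Periods -/

theorem IsLagAt.mfderiv_proj [IsManifold 𝓘(ℝ, E) ∞ Q] {s : E × (E →L[ℝ] ℝ) → X}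
    {z : E × (E →L[ℝ] ℝ)} (h : IsLagAt L q₀ s z) (u : E × (E →L[ℝ] ℝ)) :
    (mfderiv 𝓘(ℝ, F) 𝓘(ℝ, E) L.proj (s z) (mfderiv 𝓘(ℝ, E × (E →L[ℝ] ℝ)) 𝓘(ℝ, F) s z u) : E) =
      chartDerivSymm q₀ z.1 u.1 := by
  have hs := (contMDiffOn_extChartAt_symm (I := 𝓘(ℝ, E)) (n := ∞) q₀).contMDiffAt
    ((isOpen_extChartAt_target (I := 𝓘(ℝ, E)) q₀).mem_nhds h.mem_target)
  have h1 := mfderiv_comp z (L.contMDiff_proj.mdifferentiable (by simp) (s z))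
    (h.contMDiffAt.mdifferentiableAt (by simp))
  have h2 := mfderiv_comp (I := 𝓘(ℝ, E × (E →L[ℝ] ℝ))) z (hs.mdifferentiableAt (by simp))
    ((differentiableAt_fst (𝕜 := ℝ) (p := z)).mdifferentiableAt)
  have h3 : L.proj ∘ s =ᶠ[𝓝 z] (extChartAt 𝓘(ℝ, E) q₀).symm ∘ Prod.fst := by
    filter_upwards [h.eventually] with z' hz'
    exact hz'.proj_eq
  have h4 := (h1.symm.trans h3.mfderiv_eq).trans h2
  have h5 := congrArg (fun l : E × (E →L[ℝ] ℝ) →L[ℝ] E => l u) h4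
  refine h5.trans ?_
  rw [mfderiv_eq_fderiv, fderiv_fst]
  rfl

/-- Changing the lift W adds a vertical vector, which pairs to zero with a vertical vector. The
value can thus be computed with a coordinate lift. The sign is that of the standard form on ((v, 0),
(0, ζ)). -/
theorem IsLagAt.form_vertical_apply [IsManifold 𝓘(ℝ, E) ∞ Q] {s : E × (E →L[ℝ] ℝ) → X}
    {z : E × (E →L[ℝ] ℝ)} (h : IsLagAt L q₀ s z) (v : E) (ζ : E →L[ℝ] ℝ)
    (W : TangentSpace 𝓘(ℝ, F) (s z))
    (hW : (mfderiv 𝓘(ℝ, F) 𝓘(ℝ, E) L.proj (s z) W : E) = chartDerivSymm q₀ z.1 v) :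
    L.form (s z) ![W, mfderiv 𝓘(ℝ, E × (E →L[ℝ] ℝ)) 𝓘(ℝ, F) s z (0, ζ)] = -ζ v := by
  let D : E × (E →L[ℝ] ℝ) →L[ℝ] F := mfderiv 𝓘(ℝ, E × (E →L[ℝ] ℝ)) 𝓘(ℝ, F) s z
  let T : F →L[ℝ] E := mfderiv 𝓘(ℝ, F) 𝓘(ℝ, E) L.proj (s z)
  let W' : F := W
  have h1 : T (W' - D (v, 0)) = 0 := by
    rw [map_sub]
    exact sub_eq_zero.2 (hW.trans (h.mfderiv_proj (v, 0)).symm)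
  have h2 : T (D (0, ζ)) = 0 := (h.mfderiv_proj (0, ζ)).trans (map_zero _)
  have h3 := L.form_vertical h1 h2
  have h4 := alternating_add_left (G := F) (L.form (s z)) (W' - D (v, 0)) (D (v, 0)) (D (0, ζ))
  have h5 : (L.form (s z) : F [⋀^Fin 2]→L[ℝ] ℝ) ![D (v, 0), D (0, ζ)] =
      stdForm E (v, 0) (0, ζ) :=
    (pullBilin_apply L.form s z _ _).symm.trans (h.pullBilin_eq _ _)
  rw [sub_add_cancel] at h4
  refine h4.trans ((congrArg₂ (· + ·) h3 h5).trans ?_)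
  simp [stdForm]

/-- The covector at the point with coordinate `y` which has coordinates `η`. -/
def covector (q₀ : Q) (y : E) :
    (E →L[ℝ] ℝ) →+ CotangentSpace E ((extChartAt 𝓘(ℝ, E) q₀).symm y) where
  toFun η := (cot q₀ (y, η)).snd
  map_zero' := rfl
  map_add' _ _ := rfl

omit [FiniteDimensional ℝ E] in
theorem covector_injective [IsManifold 𝓘(ℝ, E) ∞ Q] {y : E}
    (hy : y ∈ (extChartAt 𝓘(ℝ, E) q₀).target) : Function.Injective (covector q₀ y) := by
  intro η η' h
  have := cotInv_cot (q₀ := q₀) (z := (y, η)) hy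
  have h2 := cotInv_cot (q₀ := q₀) (z := (y, η')) hy
  have h3 : cot q₀ (y, η) = cot q₀ (y, η') :=
    congrArg (fun ζ => (⟨(extChartAt 𝓘(ℝ, E) q₀).symm y, ζ⟩ : CotangentBundle E Q)) h
  rw [h3, h2] at this
  exact (congrArg Prod.snd this).symm

/-- The loop t ↦ S(y, -tη) closes up because η stabilises, and along it the integrand is constant.
The minus sign cancels the one in `IsLagAt.form_vertical_apply`. -/
theorem isPeriod_of_stabilises [IsManifold 𝓘(ℝ, E) ∞ Q] {S : E × (E →L[ℝ] ℝ) → X} {y : E}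
    (hS : ∀ η, IsLagAt L q₀ S (y, η)) {η : E →L[ℝ] ℝ} (hη : ∀ ζ, S (y, ζ + η) = S (y, ζ)) :
    L.IsPeriod ((extChartAt 𝓘(ℝ, E) q₀).symm y) (covector q₀ y η) := by
  have hyt := (hS 0).mem_target
  have hc : ContDiff ℝ ∞ fun t : ℝ => ((y, -(t • η)) : E × (E →L[ℝ] ℝ)) := by fun_prop
  refine ⟨fun t => S (y, -(t • η)), fun t => ?_, fun t => ?_, fun t => (hS _).proj_eq, ?_⟩
  · exact ContMDiffAt.comp (g := S) (f := fun t : ℝ => ((y, -(t • η)) : E × (E →L[ℝ] ℝ))) t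
      (hS _).contMDiffAt hc.contDiffAt.contMDiffAt
  · simp only
    rw [← hη]
    congr 2
    module
  · intro v W hW
    have hder : ∀ t, HasDerivAt (fun t : ℝ => ((y, -(t • η)) : E × (E →L[ℝ] ℝ))) (0, -η) t :=
      fun t => by
        have h1 := ((hasDerivAt_id t).smul_const η).neg
        rw [one_smul] at h1
        exact (hasDerivAt_const t y).prodMk h1
    have hint : ∀ t, L.form (S (y, -(t • η))) ![W t, mfderiv 𝓘(ℝ, ℝ) 𝓘(ℝ, F)
        (fun t => S (y, -(t • η))) t (1 : ℝ)] =
        η (chartDeriv q₀ ((extChartAt 𝓘(ℝ, E) q₀).symm y) v) := by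
      intro t
      have h1 := mfderiv_comp (g := S) (f := fun t : ℝ => ((y, -(t • η)) : E × (E →L[ℝ] ℝ))) t
        ((hS _).contMDiffAt.mdifferentiableAt (by simp))
        (hder t).differentiableAt.mdifferentiableAt
      have h2 : (mfderiv 𝓘(ℝ, ℝ) 𝓘(ℝ, F) (fun t => S (y, -(t • η))) t (1 : ℝ) : F) =
          mfderiv 𝓘(ℝ, E × (E →L[ℝ] ℝ)) 𝓘(ℝ, F) S (y, -(t • η)) (0, -η) := by
        refine (congrArg (fun l : ℝ →L[ℝ] F => l 1) h1).trans ?_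
        have h3 : fderiv ℝ (fun t : ℝ => ((y, -(t • η)) : E × (E →L[ℝ] ℝ))) t 1 = (0, -η) := by
          rw [(hder t).hasFDerivAt.fderiv]
          simp
        exact congrArg (fun w : E × (E →L[ℝ] ℝ) => (mfderiv 𝓘(ℝ, E × (E →L[ℝ] ℝ)) 𝓘(ℝ, F) S
          (y, -(t • η)) : E × (E →L[ℝ] ℝ) →L[ℝ] F) w) ((congrArg (fun l : ℝ →L[ℝ]
            E × (E →L[ℝ] ℝ) => l 1) mfderiv_eq_fderiv).trans h3)
      have h4 := (hS (-(t • η))).form_vertical_apply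
        (chartDeriv q₀ ((extChartAt 𝓘(ℝ, E) q₀).symm y) v) (-η) (W t) (by
          refine (hW t).trans ?_
          have h5 := chartDerivSymm_comp ((extChartAt 𝓘(ℝ, E) q₀).map_target hyt)
          rw [(extChartAt 𝓘(ℝ, E) q₀).right_inv hyt] at h5
          exact (congrArg (fun l : E →L[ℝ] E => l v) h5).symm)
      rw [neg_apply, neg_neg] at h4
      rw [← h4]
      exact congrArg (fun a : F => (L.form (S (y, -(t • η))) : F [⋀^Fin 2]→L[ℝ] ℝ) ![W t, a]) h2
    simp only [hint]
    rw [intervalIntegral.integral_const]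
    simp
    rfl

/-- A loop in the fibre is lifted to a path of covectors. The velocity of the lift is dictated by
the form, so the endpoints of the lift over one turn have the same image and differ by the period.
-/
theorem exists_stabiliser_of_isPeriod [IsManifold 𝓘(ℝ, E) ∞ Q] [T2Space X]
    {S : E × (E →L[ℝ] ℝ) → X} {y : E} (hS : ∀ η, IsLagAt L q₀ S (y, η))
    (hsurj : ∀ x, L.proj x = (extChartAt 𝓘(ℝ, E) q₀).symm y → ∃ η, S (y, η) = x)
    {c : CotangentSpace E ((extChartAt 𝓘(ℝ, E) q₀).symm y)}
    (hc : L.IsPeriod ((extChartAt 𝓘(ℝ, E) q₀).symm y) c) :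
    ∃ η η' : E →L[ℝ] ℝ, S (y, η) = S (y, η') ∧ c = covector q₀ y (η - η') := by
  obtain ⟨γ, hγ, hper, hproj, hint⟩ := hc
  have hyt := (hS 0).mem_target
  have hlift : ∀ t, ∃ r : E →ₗ[ℝ] F, ∀ v,
      (mfderiv 𝓘(ℝ, F) 𝓘(ℝ, E) L.proj (γ t) (r v) : E) = v := fun t => by
    let T : F →L[ℝ] E := mfderiv 𝓘(ℝ, F) 𝓘(ℝ, E) L.proj (γ t)
    obtain ⟨r, hr⟩ := T.toLinearMap.exists_rightInverse_of_surjective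
      (LinearMap.range_eq_top.2 (L.submersion (γ t)))
    exact ⟨r, fun v => congrArg (fun l => l v) hr⟩
  choose r hr using hlift
  let vel : ℝ → F := fun t => mfderiv 𝓘(ℝ, ℝ) 𝓘(ℝ, F) γ t (1 : ℝ)
  -- The velocity of any local lift, expressed through the form alone; it is therefore defined for
  -- all t before a global lift is known.
  let p' : ℝ → E →L[ℝ] ℝ := fun t => -(((toBilin (G := F) (L.form (γ t))).flip (vel t)).comp
    ((LinearMap.toContinuousLinearMap (r t)).comp (chartDerivSymm q₀ y)))
  have hp'_apply : ∀ t v, p' t v = -(L.form (γ t) : F [⋀^Fin 2]→L[ℝ] ℝ)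
    ![r t (chartDerivSymm q₀ y v), vel t] := fun t v => rfl
  have hloc : ∀ (t₀ : ℝ) (η : E →L[ℝ] ℝ), γ t₀ = S (y, η) → ∃ p : ℝ → E →L[ℝ] ℝ, p t₀ = η ∧
      ∀ᶠ t in 𝓝 t₀, γ t = S (y, p t) ∧ HasDerivAt p (p' t) t ∧ ContinuousAt (deriv p) t := by
    intro t₀ η hη
    obtain ⟨e, hze, heN, hes, hsm⟩ := (hS η).exists_openPartialHomeomorph (hS η).eventually
    have ht₀ : γ t₀ ∈ e.target := by
      rw [hη, ← hes _ hze]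
      exact e.map_source hze
    refine ⟨fun t => (e.symm (γ t)).2, ?_, ?_⟩
    · simp only
      rw [hη, ← hes _ hze, e.left_inv hze]
    have hev : ∀ᶠ t in 𝓝 t₀, γ t ∈ e.target :=
      hγ.continuous.continuousAt.preimage_mem_nhds (e.open_target.mem_nhds ht₀)
    filter_upwards [hev.eventually_nhds] with t ht'
    have ht := ht'.self_of_nhds
    have hSe : ∀ t, γ t ∈ e.target → S (e.symm (γ t)) = γ t := fun t ht => by
      rw [← hes _ (e.map_target ht)]
      exact e.right_inv ht
    have hfst : ∀ t, γ t ∈ e.target → (e.symm (γ t)).1 = y := fun t ht => by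
      have k : IsLagAt L q₀ S (e.symm (γ t)) := heN (e.map_target ht)
      rw [k.fst_eq, hSe t ht, hproj, (extChartAt 𝓘(ℝ, E) q₀).right_inv hyt]
    have hpair : ∀ t, γ t ∈ e.target → e.symm (γ t) = (y, (e.symm (γ t)).2) := fun t ht =>
      Prod.ext (hfst t ht) rfl
    have hg : ContDiffAt ℝ ∞ (fun t => e.symm (γ t)) t :=
      ContMDiffAt.contDiffAt ((hsm _ ht).comp t (hγ t))
    have hpc : ContDiffAt ℝ ∞ (fun t => (e.symm (γ t)).2) t := hg.snd
    have hpd : HasDerivAt (fun t => (e.symm (γ t)).2) (deriv (fun t => (e.symm (γ t)).2) t) t :=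
      (hpc.differentiableAt (by simp)).hasDerivAt
    have hγS : γ t = S (y, (e.symm (γ t)).2) := by
      rw [← hpair t ht]
      exact (hSe t ht).symm
    refine ⟨hγS, ?_, ?_⟩
    · convert hpd using 1
      have hpd2 : HasDerivAt (fun t => ((y, (e.symm (γ t)).2) : E × (E →L[ℝ] ℝ)))
          (0, deriv (fun t => (e.symm (γ t)).2) t) t := (hasDerivAt_const t y).prodMk hpd
      have hev2 : γ =ᶠ[𝓝 t] S ∘ fun t => ((y, (e.symm (γ t)).2) : E × (E →L[ℝ] ℝ)) := by
        filter_upwards [ht'] with t' ht''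
        rw [Function.comp_apply, ← hpair t' ht'']
        exact (hSe t' ht'').symm
      have h1 := mfderiv_comp (g := S) (f := fun t => ((y, (e.symm (γ t)).2) : E × (E →L[ℝ] ℝ))) t
        ((hS _).contMDiffAt.mdifferentiableAt (by simp)) hpd2.differentiableAt.mdifferentiableAt
      have h3 : fderiv ℝ (fun t => ((y, (e.symm (γ t)).2) : E × (E →L[ℝ] ℝ))) t 1 =
          (0, deriv (fun t => (e.symm (γ t)).2) t) := by
        rw [hpd2.hasFDerivAt.fderiv]
        simp
      have h2 : vel t = mfderiv 𝓘(ℝ, E × (E →L[ℝ] ℝ)) 𝓘(ℝ, F) S (y, (e.symm (γ t)).2)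
          (0, deriv (fun t => (e.symm (γ t)).2) t) := by
        refine (congrArg (fun l : ℝ →L[ℝ] F => l 1) (hev2.mfderiv_eq.trans h1)).trans ?_
        exact congrArg (fun w : E × (E →L[ℝ] ℝ) => (mfderiv 𝓘(ℝ, E × (E →L[ℝ] ℝ)) 𝓘(ℝ, F) S
          (y, (e.symm (γ t)).2) : E × (E →L[ℝ] ℝ) →L[ℝ] F) w) ((congrArg (fun l : ℝ →L[ℝ]
            E × (E →L[ℝ] ℝ) => l 1) mfderiv_eq_fderiv).trans h3)
      ext v
      rw [hp'_apply, h2]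
      have key : ∀ x, x = S (y, (e.symm (γ t)).2) → ∀ W : F,
          (mfderiv 𝓘(ℝ, F) 𝓘(ℝ, E) L.proj x W : E) = chartDerivSymm q₀ y v →
          -(L.form x : F [⋀^Fin 2]→L[ℝ] ℝ) ![W, mfderiv 𝓘(ℝ, E × (E →L[ℝ] ℝ)) 𝓘(ℝ, F) S
            (y, (e.symm (γ t)).2) (0, deriv (fun t => (e.symm (γ t)).2) t)] =
            deriv (fun t => (e.symm (γ t)).2) t v := by
        rintro _ rfl W hW
        have h6 := (hS (e.symm (γ t)).2).form_vertical_apply v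
          (deriv (fun t => (e.symm (γ t)).2) t) W hW
        exact neg_eq_iff_eq_neg.2 h6
      exact key _ hγS _ (hr t _)
    · have := (hpc.fderiv_right (m := ∞) (by simp)).continuousAt
      exact (this.clm_apply continuousAt_const)
  obtain ⟨η₀, hη₀⟩ := hsurj (γ 0) (hproj 0)
  have hsurj' : ∀ t, ∃ η, γ t = S (y, η) := fun t =>
    (hsurj (γ t) (hproj t)).imp fun _ h => h.symm
  have hp'c : Continuous p' := continuous_iff_continuousAt.2 fun t₀ => by
    obtain ⟨η, hη⟩ := hsurj' t₀
    obtain ⟨p, -, hp⟩ := hloc t₀ η hη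
    refine hp.self_of_nhds.2.2.congr ?_
    filter_upwards [hp] with t ht
    exact ht.2.1.deriv
  let A : ℝ → E →L[ℝ] ℝ := fun t => ∫ u in (0 : ℝ)..t, p' u
  have hA : ∀ t, HasDerivAt A (p' t) t := fun t => hp'c.integral_hasStrictDerivAt 0 t |>.hasDerivAt
  have hAc : Continuous A := continuous_iff_continuousAt.2 fun t => (hA t).continuousAt
  -- The integral A of this velocity is a global lift: near a point of agreement a local lift has
  -- the same derivative as A.
  have hall : {t : ℝ | γ t = S (y, η₀ + A t)} = Set.univ := by
    refine IsClopen.eq_univ ⟨?_, ?_⟩ ⟨0, ?_⟩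
    · refine isClosed_eq hγ.continuous ?_
      exact continuous_iff_continuousAt.2 fun t => ContinuousAt.comp (g := S)
        (f := fun t => ((y, η₀ + A t) : E × (E →L[ℝ] ℝ))) (hS _).contMDiffAt.continuousAt
        (by fun_prop)
    · refine isOpen_iff_mem_nhds.2 fun t₀ ht₀ => ?_
      obtain ⟨p, hp0, hp⟩ := hloc t₀ _ ht₀
      obtain ⟨δ, hδ, hball⟩ := Metric.eventually_nhds_iff_ball.1 hp
      filter_upwards [Metric.ball_mem_nhds t₀ hδ] with t ht
      have h1 : p t - A t = p t₀ - A t₀ :=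
        Metric.isOpen_ball.is_const_of_deriv_eq_zero (𝕜 := ℝ) (f := fun t => p t - A t)
          (convex_ball t₀ δ).isPreconnected
          (fun u hu => ((hball u hu).2.1.sub (hA u)).differentiableAt.differentiableWithinAt)
          (fun u hu => by
            refine ((hball u hu).2.1.sub (hA u)).deriv.trans ?_
            simp) ht (Metric.mem_ball_self hδ)
      have h2 : p t = η₀ + A t := by
        rw [hp0] at h1
        have := sub_eq_iff_eq_add.1 h1
        rw [this]
        abel
      change γ t = _
      rw [← h2]
      exact (hball t ht).1
    · change γ 0 = S (y, η₀ + ∫ u in (0 : ℝ)..0, p' u)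
      rw [intervalIntegral.integral_same, add_zero, hη₀]
  have h1 : γ 1 = S (y, η₀ + A 1) := by
    have : (1 : ℝ) ∈ {t : ℝ | γ t = S (y, η₀ + A t)} := hall ▸ Set.mem_univ _
    exact this
  have hγ1 : γ 1 = γ 0 := by simpa using hper 0
  refine ⟨η₀, η₀ + A 1, ?_, ?_⟩
  · rw [hη₀, ← h1, hγ1]
  · refine ContinuousLinearMap.ext fun v => ?_
    refine (hint v (fun t => r t v) (fun t => hr t v)).trans ?_
    have e1 : (η₀ - (η₀ + A 1)) = -A 1 := by abel
    rw [e1]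
    change _ = -(A 1) (chartDeriv q₀ ((extChartAt 𝓘(ℝ, E) q₀).symm y) v)
    have e2 : ∀ t, L.form (γ t) ![r t v, mfderiv 𝓘(ℝ, ℝ) 𝓘(ℝ, F) γ t (1 : ℝ)] =
        -p' t (chartDeriv q₀ ((extChartAt 𝓘(ℝ, E) q₀).symm y) v) := fun t => by
      rw [hp'_apply, neg_neg]
      have h5 := chartDerivSymm_comp ((extChartAt 𝓘(ℝ, E) q₀).map_target hyt)
      rw [(extChartAt 𝓘(ℝ, E) q₀).right_inv hyt] at h5
      have h6 := congrArg (fun l : E →L[ℝ] E => l v) h5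
      exact congrArg (fun v : E => (L.form (γ t) : F [⋀^Fin 2]→L[ℝ] ℝ) ![r t v, vel t]) h6.symm
    refine (intervalIntegral.integral_congr fun t _ => e2 t).trans ?_
    rw [intervalIntegral.integral_neg]
    congr 1
    exact (intervalIntegral_clm_apply hp'c.continuousOn _).symm

/-- Agreement of S at two covectors is invariant under translation, so it is governed by a
stabiliser subgroup. The two preceding lemmas show that this subgroup and the periods generate the
same group. From here on no loops are needed. -/
theorem mem_periodLattice_iff [IsManifold 𝓘(ℝ, E) ∞ Q] [T2Space X]
    {S : E × (E →L[ℝ] ℝ) → X} {y : E} (hS : ∀ η, IsLagAt L q₀ S (y, η))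
    (hsurj : ∀ x, L.proj x = (extChartAt 𝓘(ℝ, E) q₀).symm y → ∃ η, S (y, η) = x)
    (η η' : E →L[ℝ] ℝ) :
    S (y, η) = S (y, η') ↔
      covector q₀ y (η - η') ∈ L.periodLattice ((extChartAt 𝓘(ℝ, E) q₀).symm y) := by
  have htr : ∀ η η' ζ, S (y, η) = S (y, η') → S (y, η + ζ) = S (y, η' + ζ) := fun η η' ζ h =>
    IsLagAt.eq_along_segment (z₁ := (y, η)) (z₂ := (y, η')) (fun _ _ => hS _) (fun _ _ => hS _) h
  let T : AddSubgroup (E →L[ℝ] ℝ) :=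
    { carrier := {η | S (y, η) = S (y, 0)}
      zero_mem' := rfl
      add_mem' := fun {a b} ha hb => by
        have := htr a 0 b ha
        rw [zero_add] at this
        exact this.trans hb
      neg_mem' := fun {a} ha => by
        have := htr a 0 (-a) ha
        rw [add_neg_cancel, zero_add] at this
        exact this.symm }
  have hT : ∀ η η', S (y, η) = S (y, η') ↔ η - η' ∈ T := fun η η' => by
    constructor
    · intro h
      have := htr η η' (-η') h
      rw [add_neg_cancel, ← sub_eq_add_neg] at this
      exact this
    · intro h
      have := htr (η - η') 0 η' h
      rwa [sub_add_cancel, zero_add] at this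
  have hP : L.periodLattice ((extChartAt 𝓘(ℝ, E) q₀).symm y) = T.map (covector q₀ y) := by
    refine le_antisymm ((AddSubgroup.closure_le _).2 ?_) ?_
    · intro c hc
      obtain ⟨η, η', h1, rfl⟩ := exists_stabiliser_of_isPeriod hS hsurj hc
      exact ⟨η - η', (hT _ _).1 h1, rfl⟩
    · rintro _ ⟨η, hη, rfl⟩
      refine AddSubgroup.subset_closure (isPeriod_of_stabilises hS fun ζ => ?_)
      exact (hT _ _).2 (by rwa [add_sub_cancel_left])
  rw [hP, hT]
  constructor
  · exact fun h => ⟨_, h, rfl⟩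
  · rintro ⟨ζ, hζ, h⟩
    rwa [← covector_injective (hS 0).mem_target h]

end Sections

/-! ### Local trivialisations -/

section Trivialisations

variable {E : Type*} [NormedAddCommGroup E] [NormedSpace ℝ E]
  {Q : Type*} [TopologicalSpace Q] [ChartedSpace E Q]

/-- The differential of a real function on the base. -/
def dd (h : Q → ℝ) (x : Q) : CotangentSpace E x := mfderiv 𝓘(ℝ, E) 𝓘(ℝ, ℝ) h x

variable [IsManifold 𝓘(ℝ, E) ∞ Q]

theorem exists_covector {q₀ : Q} {y : E} (hy : y ∈ (extChartAt 𝓘(ℝ, E) q₀).target)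
    (ξ : CotangentSpace E ((extChartAt 𝓘(ℝ, E) q₀).symm y)) : ∃ η, covector q₀ y η = ξ := by
  refine ⟨(CotangentSpace.toModel ξ).comp (chartDerivSymm q₀ y), ?_⟩
  refine ContinuousLinearMap.ext fun v => ?_
  have h5 := chartDerivSymm_comp ((extChartAt 𝓘(ℝ, E) q₀).map_target hy)
  rw [(extChartAt 𝓘(ℝ, E) q₀).right_inv hy] at h5
  exact congrArg (fun l : E →L[ℝ] E => CotangentSpace.toModel ξ (l v)) h5

/-- The differential in cotangent coordinates. -/
theorem dd_eq_covector {q₀ : Q} {y : E} (hy : y ∈ (extChartAt 𝓘(ℝ, E) q₀).target) {h : Q → ℝ}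
    {f : E → ℝ} (hf : DifferentiableAt ℝ f y)
    (hfh : h =ᶠ[𝓝 ((extChartAt 𝓘(ℝ, E) q₀).symm y)] f ∘ extChartAt 𝓘(ℝ, E) q₀) :
    dd h ((extChartAt 𝓘(ℝ, E) q₀).symm y) = covector q₀ y (fderiv ℝ f y) := by
  have hs := (extChartAt 𝓘(ℝ, E) q₀).map_target hy
  have h1 : MDifferentiableAt 𝓘(ℝ, E) 𝓘(ℝ, E) (extChartAt 𝓘(ℝ, E) q₀)
      ((extChartAt 𝓘(ℝ, E) q₀).symm y) :=
    (contMDiffAt_extChartAt' (n := ∞) (by rwa [← extChartAt_source 𝓘(ℝ, E)])).mdifferentiableAt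
      (by simp)
  have h2 : MDifferentiableAt 𝓘(ℝ, E) 𝓘(ℝ, ℝ) f
      (extChartAt 𝓘(ℝ, E) q₀ ((extChartAt 𝓘(ℝ, E) q₀).symm y)) := by
    rw [(extChartAt 𝓘(ℝ, E) q₀).right_inv hy]
    exact hf.mdifferentiableAt
  have h3 := mfderiv_comp ((extChartAt 𝓘(ℝ, E) q₀).symm y) h2 h1
  refine ContinuousLinearMap.ext fun v => ?_
  refine (congrArg (fun l : E →L[ℝ] ℝ => l v) (hfh.mfderiv_eq.trans h3)).trans ?_
  have h4 : (mfderiv 𝓘(ℝ, E) 𝓘(ℝ, ℝ) f (extChartAt 𝓘(ℝ, E) q₀ ((extChartAt 𝓘(ℝ, E) q₀).symm y)) :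
      E →L[ℝ] ℝ) = fderiv ℝ f y := by
    rw [mfderiv_eq_fderiv, (extChartAt 𝓘(ℝ, E) q₀).right_inv hy]
  exact congrArg (fun l : E →L[ℝ] ℝ => l (chartDeriv q₀ ((extChartAt 𝓘(ℝ, E) q₀).symm y) v)) h4

theorem dd_eq_covector_self {q₀ : Q} {y : E} (hy : y ∈ (extChartAt 𝓘(ℝ, E) q₀).target) {h : Q → ℝ}
    (hh : ContMDiffAt 𝓘(ℝ, E) 𝓘(ℝ, ℝ) ∞ h ((extChartAt 𝓘(ℝ, E) q₀).symm y)) :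
    dd h ((extChartAt 𝓘(ℝ, E) q₀).symm y) =
      covector q₀ y (fderiv ℝ (h ∘ (extChartAt 𝓘(ℝ, E) q₀).symm) y) := by
  have hs := (contMDiffOn_extChartAt_symm (I := 𝓘(ℝ, E)) (n := ∞) q₀).contMDiffAt
    ((isOpen_extChartAt_target (I := 𝓘(ℝ, E)) q₀).mem_nhds hy)
  refine dd_eq_covector hy ((hh.comp y hs).contDiffAt.differentiableAt (by simp)) ?_
  filter_upwards [(isOpen_extChartAt_source (I := 𝓘(ℝ, E)) q₀).mem_nhds
    ((extChartAt 𝓘(ℝ, E) q₀).map_target hy)] with x hx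
  simp only [Function.comp_apply]
  rw [(extChartAt 𝓘(ℝ, E) q₀).left_inv hx]

theorem contDiffAt_comp_chart_symm {q₀ : Q} {y : E} (hy : y ∈ (extChartAt 𝓘(ℝ, E) q₀).target)
    {h : Q → ℝ} (hh : ContMDiffAt 𝓘(ℝ, E) 𝓘(ℝ, ℝ) ∞ h ((extChartAt 𝓘(ℝ, E) q₀).symm y)) :
    ContDiffAt ℝ ∞ (h ∘ (extChartAt 𝓘(ℝ, E) q₀).symm) y :=
  (hh.comp y ((contMDiffOn_extChartAt_symm (I := 𝓘(ℝ, E)) (n := ∞) q₀).contMDiffAt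
    ((isOpen_extChartAt_target (I := 𝓘(ℝ, E)) q₀).mem_nhds hy))).contDiffAt

theorem exists_coordinate {q₀ x : Q} (hx : x ∈ (extChartAt 𝓘(ℝ, E) q₀).source) :
    ∃ y ∈ (extChartAt 𝓘(ℝ, E) q₀).target, (extChartAt 𝓘(ℝ, E) q₀).symm y = x :=
  ⟨_, (extChartAt 𝓘(ℝ, E) q₀).map_source hx, (extChartAt 𝓘(ℝ, E) q₀).left_inv hx⟩

variable [FiniteDimensional ℝ E]
  {F : Type*} [NormedAddCommGroup F] [NormedSpace ℝ F] [FiniteDimensional ℝ F]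
  {F' : Type*} [NormedAddCommGroup F'] [NormedSpace ℝ F'] [FiniteDimensional ℝ F']
  {X : Type*} [TopologicalSpace X] [ChartedSpace F X] [IsManifold 𝓘(ℝ, F) ∞ X] [T2Space X]
  {X' : Type*} [TopologicalSpace X'] [ChartedSpace F' X'] [IsManifold 𝓘(ℝ, F') ∞ X'] [T2Space X']
  {L : LagrangianTorusFibration E F Q X} {L' : LagrangianTorusFibration E F' Q X'}

/-- A family of Lagrangian germs defined on whole cotangent spaces, which is onto, gives a
trivialisation. -/
def trivialisationOfSection {q₀ : Q} {S : E × (E →L[ℝ] ℝ) → X} {P : Opens Q}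
    (hP : ∀ x ∈ P, x ∈ (extChartAt 𝓘(ℝ, E) q₀).source)
    (hS : ∀ x ∈ P, ∀ η, IsLagAt L q₀ S (extChartAt 𝓘(ℝ, E) q₀ x, η))
    (hsurj : ∀ x, L.proj x ∈ P → ∃ η, S (extChartAt 𝓘(ℝ, E) q₀ (L.proj x), η) = x) :
    L.LocalTrivialisation P where
  toFun w := S (cotInv q₀ w)
  contMDiffOn w hw := (((hS _ hw (cotInv q₀ w).2).contMDiffAt.comp w
    (contMDiffAt_cotInv (hP _ hw)))).contMDiffWithinAt
  proj_comp w hw := by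
    exact (hS _ hw (cotInv q₀ w).2).proj_eq.trans ((extChartAt 𝓘(ℝ, E) q₀).left_inv (hP _ hw))
  symplectic w hw := by
    have hz : (cotInv q₀ w).1 ∈ (extChartAt 𝓘(ℝ, E) q₀).target :=
      (extChartAt 𝓘(ℝ, E) q₀).map_source (hP _ hw)
    have hLag : IsLagAt L q₀ S (cotInv q₀ w) := hS _ hw (cotInv q₀ w).2
    have hw' := cot_cotInv (hP _ hw)
    have h1 := mfderiv_comp w (hLag.contMDiffAt.mdifferentiableAt (by simp))
      ((contMDiffAt_cotInv (hP _ hw)).mdifferentiableAt (by simp))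
    have h2 := mfderiv_comp w ((contMDiffAt_cot hz).mdifferentiableAt (by simp))
      ((contMDiffAt_cotInv (hP _ hw)).mdifferentiableAt (by simp))
    -- The canonical form at w is recovered from its pullback under `cot` because the derivatives of
    -- `cot` and `cotInv` are inverse to each other.
    have h3 : cot q₀ ∘ cotInv q₀ =ᶠ[𝓝 w] id := by
      have hc : Continuous (fun w : CotangentBundle E Q => w.proj) :=
        FiberBundle.continuous_proj (E →L[ℝ] ℝ) _
      filter_upwards [hc.continuousAt.preimage_mem_nhds (P.isOpen.mem_nhds hw)] with w' hw''
      exact cot_cotInv (hP _ hw'')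
    have h4 := h2.symm.trans (h3.mfderiv_eq.trans mfderiv_id)
    let A : E × (E →L[ℝ] ℝ) →L[ℝ] E × (E →L[ℝ] ℝ) :=
      mfderiv (cotangentModel E) 𝓘(ℝ, E × (E →L[ℝ] ℝ)) (cotInv q₀) w
    ext v
    have h5 := pullback_canonicalForm_cot hz (A (v 0)) (A (v 1))
    have h6 := hLag.pullBilin_eq (A (v 0)) (A (v 1))
    rw [← h6, pullBilin_apply] at h5
    have h7 : (L.form (S (cotInv q₀ w)) : F [⋀^Fin 2]→L[ℝ] ℝ) (fun i => mfderiv (cotangentModel E)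
        𝓘(ℝ, F) (S ∘ cotInv q₀) w (v i)) = (L.form (S (cotInv q₀ w)) : F [⋀^Fin 2]→L[ℝ] ℝ)
        ![mfderiv 𝓘(ℝ, E × (E →L[ℝ] ℝ)) 𝓘(ℝ, F) S (cotInv q₀ w) (A (v 0)),
          mfderiv 𝓘(ℝ, E × (E →L[ℝ] ℝ)) 𝓘(ℝ, F) S (cotInv q₀ w) (A (v 1))] := by
      rw [h1]
      congr 1
      ext i
      fin_cases i <;> rfl
    refine h7.trans (h5.symm.trans ?_)
    let η : CotangentBundle E Q → (E × (E →L[ℝ] ℝ)) [⋀^Fin 2]→L[ℝ] ℝ := canonicalForm E Q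
    change η (cot q₀ (cotInv q₀ w)) (fun i => mfderiv 𝓘(ℝ, E × (E →L[ℝ] ℝ)) (cotangentModel E)
      (cot q₀) (cotInv q₀ w) (![A (v 0), A (v 1)] i)) = η w v
    rw [hw']
    congr 1
    ext1 i
    have h8 := fun i => congrArg (fun l : E × (E →L[ℝ] ℝ) →L[ℝ] E × (E →L[ℝ] ℝ) => l (v i)) h4
    fin_cases i
    · exact h8 0
    · exact h8 1
  surjective x hx := by
    obtain ⟨η, hη⟩ := hsurj x hx
    have ht := (extChartAt 𝓘(ℝ, E) q₀).map_source (hP _ hx)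
    refine ⟨cot q₀ (extChartAt 𝓘(ℝ, E) q₀ (L.proj x), η), ?_, ?_⟩
    · rw [cot_proj, (extChartAt 𝓘(ℝ, E) q₀).left_inv (hP _ hx)]
      exact hx
    · rw [cotInv_cot ht, hη]
  eq_iff q hq ξ ξ' := by
    obtain ⟨y, hy, rfl⟩ := exists_coordinate (hP q hq)
    obtain ⟨η, rfl⟩ := exists_covector hy ξ
    obtain ⟨η', rfl⟩ := exists_covector hy ξ'
    have e : ∀ η, cotInv q₀ ⟨(extChartAt 𝓘(ℝ, E) q₀).symm y, covector q₀ y η⟩ = (y, η) := fun η =>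
      cotInv_cot (z := (y, η)) hy
    rw [e, e, ← map_sub]
    refine mem_periodLattice_iff (fun η => ?_) (fun x hx => ?_) η η'
    · have := hS _ hq η
      rwa [(extChartAt 𝓘(ℝ, E) q₀).right_inv hy] at this
    · have := hsurj x (by rwa [hx])
      rwa [hx, (extChartAt 𝓘(ℝ, E) q₀).right_inv hy] at this

/-- The section of the action over a chart ball restricts to any smaller open set; this is stated
for all of them so that covers can be refined freely. -/
theorem LagrangianTorusFibration.exists_localTrivialisation [T2Space Q] [CompactSpace X]
    (L : LagrangianTorusFibration E F Q X) (q₀ : Q) :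
    ∃ U : Opens Q, q₀ ∈ U ∧ ∀ P ≤ U, Nonempty (L.LocalTrivialisation P) := by
  obtain ⟨r, hr, S, hrt, hS, hsurj⟩ := L.exists_section (q₀ := q₀) (mem_extChartAt_target q₀)
  let U : Opens Q := ⟨_, (continuousOn_extChartAt (I := 𝓘(ℝ, E)) q₀).isOpen_inter_preimage
    (isOpen_extChartAt_source (I := 𝓘(ℝ, E)) q₀) (Metric.isOpen_ball
      (x := extChartAt 𝓘(ℝ, E) q₀ q₀) (ε := r))⟩
  refine ⟨U, ⟨mem_extChartAt_source q₀, Metric.mem_ball_self hr⟩, fun P hP =>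
    ⟨trivialisationOfSection (q₀ := q₀) (S := S) (fun x hx => (hP hx).1)
      (fun x hx => hS _ (hP hx).2) (fun x hx => hsurj _ (hP hx).2 _
        ((extChartAt 𝓘(ℝ, E) q₀).left_inv (hP hx).1).symm)⟩⟩

theorem LagrangianTorusFibration.LocalTrivialisation.section_surjective {P : Opens Q}
    (τ : L.LocalTrivialisation P) {q₀ : Q} {y : E} (hy : y ∈ (extChartAt 𝓘(ℝ, E) q₀).target)
    (hP : (extChartAt 𝓘(ℝ, E) q₀).symm y ∈ P) (x : X)
    (hx : L.proj x = (extChartAt 𝓘(ℝ, E) q₀).symm y) : ∃ η, (τ.toFun ∘ cot q₀) (y, η) = x := by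
  obtain ⟨w, hw, rfl⟩ := τ.surjective x (by rwa [hx])
  rw [τ.proj_comp w hw] at hx
  obtain ⟨q, ξ⟩ := w
  obtain rfl : q = (extChartAt 𝓘(ℝ, E) q₀).symm y := hx
  obtain ⟨η, rfl⟩ := exists_covector hy ξ
  exact ⟨η, rfl⟩

/-- Both lattices are stabilisers, of a trivialisation and of its composite with φ. The injectivity
of φ makes them equal, without transporting loops. -/
theorem LagrangianTorusFibration.FibrewiseSymplectomorphism.periodLattice_eq [T2Space Q]
    [CompactSpace X] (φ : L.FibrewiseSymplectomorphism L') : L.periodLattice = L'.periodLattice := by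
  funext q
  obtain ⟨U, hqU, hU⟩ := L.exists_localTrivialisation q
  obtain ⟨τ⟩ := hU U le_rfl
  obtain ⟨y, hy, hyq⟩ := exists_coordinate (E := E) (mem_extChartAt_source q)
  have hyU : (extChartAt 𝓘(ℝ, E) q).symm y ∈ U := by rwa [hyq]
  rw [← hyq]
  ext ξ
  obtain ⟨η, rfl⟩ := exists_covector hy ξ
  have h1 := mem_periodLattice_iff (fun η => τ.isLagAt (z := (y, η)) hy hyU)
    (τ.section_surjective hy hyU) η 0
  have h2 := mem_periodLattice_iff (fun η => φ.isLagAt (τ.isLagAt (z := (y, η)) hy hyU))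
    (fun x' hx' => by
      obtain ⟨x, rfl⟩ := φ.toDiffeomorph.surjective x'
      obtain ⟨η, hη⟩ := τ.section_surjective hy hyU x ((φ.proj_comp x).symm.trans hx')
      exact ⟨η, congrArg φ.toDiffeomorph hη⟩) η 0
  rw [sub_zero] at h1 h2
  rw [← h1, ← h2]
  exact (φ.toDiffeomorph.injective.eq_iff (a := (τ.toFun ∘ cot q) (y, η))).symm

/-- The image of a trivialisation under a fibrewise symplectomorphism. -/
def LagrangianTorusFibration.LocalTrivialisation.map [T2Space Q] [CompactSpace X] {P : Opens Q}
    (τ : L.LocalTrivialisation P) (φ : L.FibrewiseSymplectomorphism L') :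
    L'.LocalTrivialisation P where
  toFun w := φ.toDiffeomorph (τ.toFun w)
  contMDiffOn := φ.toDiffeomorph.contMDiff.comp_contMDiffOn τ.contMDiffOn
  proj_comp w hw := by rw [φ.proj_comp, τ.proj_comp w hw]
  symplectic w hw := by
    have hopen : IsOpen {w : CotangentBundle E Q | w.proj ∈ P} :=
      P.isOpen.preimage (FiberBundle.continuous_proj (E →L[ℝ] ℝ) _)
    have h1 := mfderiv_comp w (φ.toDiffeomorph.contMDiff.mdifferentiable (by simp) (τ.toFun w))
      ((τ.contMDiffOn.contMDiffAt (hopen.mem_nhds hw)).mdifferentiableAt (by simp))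
    rw [← τ.symplectic w hw, ← φ.pullback_form]
    ext v
    unfold DiffForm.pullback
    refine (congrArg (fun l : E × (E →L[ℝ] ℝ) →L[ℝ] F' => (L'.form (φ.toDiffeomorph (τ.toFun w)) :
      F' [⋀^Fin 2]→L[ℝ] ℝ) (fun i => l (v i))) h1).trans ?_
    rfl
  surjective x' hx' := by
    obtain ⟨x, rfl⟩ := φ.toDiffeomorph.surjective x'
    obtain ⟨w, hw, rfl⟩ := τ.surjective x ((φ.proj_comp x).symm ▸ hx' : L.proj x ∈ P)
    exact ⟨w, hw, rfl⟩
  eq_iff q hq ξ ξ' := by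
    rw [← φ.periodLattice_eq, ← τ.eq_iff q hq]
    exact φ.toDiffeomorph.injective.eq_iff (a := τ.toFun ⟨q, ξ⟩)

end Trivialisations

/-! ### Comparison of trivialisations and local structure of the lattice -/

section Coordinates

variable {E : Type*} [NormedAddCommGroup E] [NormedSpace ℝ E] [FiniteDimensional ℝ E]
  {F : Type*} [NormedAddCommGroup F] [NormedSpace ℝ F] [FiniteDimensional ℝ F]
  {Q : Type*} [TopologicalSpace Q] [ChartedSpace E Q] [IsManifold 𝓘(ℝ, E) ∞ Q]
  {X : Type*} [TopologicalSpace X] [ChartedSpace F X] [IsManifold 𝓘(ℝ, F) ∞ X] [T2Space X]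
  {L : LagrangianTorusFibration E F Q X} {q₀ : Q}

theorem isOpen_image_of_isLagAt {S : E × (E →L[ℝ] ℝ) → X} {W : Set (E × (E →L[ℝ] ℝ))}
    (hW : IsOpen W) (hS : ∀ z ∈ W, IsLagAt L q₀ S z) : IsOpen (S '' W) := by
  refine isOpen_iff_mem_nhds.2 ?_
  rintro _ ⟨z, hz, rfl⟩
  obtain ⟨e, hze, heW, hes, -⟩ := (hS z hz).exists_openPartialHomeomorph (hW.mem_nhds hz)
  refine Filter.mem_of_superset (e.open_target.mem_nhds (by
    rw [← hes z hze]
    exact e.map_source hze)) fun x hx => ⟨e.symm x, heW (e.map_target hx), ?_⟩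
  rw [← hes _ (e.map_target hx)]
  exact e.right_inv hx

/-- The part of X over the closed ball of half the radius is compact, and it is covered by the
increasing open images of bounded covectors. This is uniform cocompactness of the lattices. -/
theorem exists_uniform_surjective [T2Space Q] [CompactSpace X] {S : E × (E →L[ℝ] ℝ) → X} {y₀ : E}
    {r : ℝ} (hr : 0 < r) (hS : ∀ y ∈ Metric.ball y₀ r, ∀ η, IsLagAt L q₀ S (y, η))
    (hsurj : ∀ y ∈ Metric.ball y₀ r, ∀ x, L.proj x = (extChartAt 𝓘(ℝ, E) q₀).symm y →
      ∃ η, S (y, η) = x) :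
    ∃ R : ℝ, 0 ≤ R ∧ ∀ y ∈ Metric.ball y₀ (r / 2), ∀ x, L.proj x = (extChartAt 𝓘(ℝ, E) q₀).symm y →
      ∃ η, ‖η‖ ≤ R ∧ S (y, η) = x := by
  have hsub : Metric.closedBall y₀ (r / 2) ⊆ Metric.ball y₀ r :=
    Metric.closedBall_subset_ball (half_lt_self hr)
  have hKt : Metric.closedBall y₀ (r / 2) ⊆ (extChartAt 𝓘(ℝ, E) q₀).target := fun y hy =>
    (hS y (hsub hy) 0).mem_target
  have hN : IsCompact (L.proj ⁻¹' ((extChartAt 𝓘(ℝ, E) q₀).symm '' Metric.closedBall y₀ (r / 2))) := by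
    refine IsClosed.isCompact (IsClosed.preimage L.contMDiff_proj.continuous (IsCompact.isClosed ?_))
    exact (isCompact_closedBall y₀ _).image_of_continuousOn
      ((continuousOn_extChartAt_symm q₀).mono hKt)
  obtain ⟨n, hn⟩ := hN.elim_directed_cover
    (fun n : ℕ => S '' (Metric.ball y₀ r ×ˢ Metric.ball (0 : E →L[ℝ] ℝ) n))
    (fun n => isOpen_image_of_isLagAt (Metric.isOpen_ball.prod Metric.isOpen_ball)
      fun z hz => hS z.1 hz.1 z.2) (by
      rintro x ⟨y, hy, hxy⟩
      obtain ⟨η, hη⟩ := hsurj y (hsub hy) x hxy.symm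
      obtain ⟨n, hn⟩ := exists_nat_gt ‖η‖
      exact Set.mem_iUnion.2 ⟨n, (y, η), ⟨hsub hy, by simpa using hn⟩, hη⟩)
    (Monotone.directed_le fun n m hnm => Set.image_mono (Set.prod_mono_right
      (Metric.ball_subset_ball (by exact_mod_cast hnm))))
  refine ⟨n, Nat.cast_nonneg n, fun y hy x hx => ?_⟩
  obtain ⟨⟨y', η⟩, ⟨hy', hη⟩, rfl⟩ := hn ⟨y, Metric.ball_subset_closedBall hy, hx.symm⟩
  have h1 : y' = y := by
    have h := (hS y' hy' η).fst_eq
    rw [hx, (extChartAt 𝓘(ℝ, E) q₀).right_inv (hKt (Metric.ball_subset_closedBall hy))] at h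
    exact h
  subst h1
  exact ⟨η, (by simpa using hη : ‖η‖ < n).le, rfl⟩

/-- By compactness, lattice vectors of norm at most 2R + 1 extend over a common ball. They generate
the lattice: walk from 0 to η in steps of length at most 1 and round each position to a lattice
vector with error at most R. Consecutive roundings differ by lattice vectors of norm at most 2R + 1.
-/
theorem exists_coordinate_extension [T2Space Q] [CompactSpace X] {S : E × (E →L[ℝ] ℝ) → X} {y₀ : E}
    {r : ℝ} (hr : 0 < r) (hS : ∀ y ∈ Metric.ball y₀ r, ∀ η, IsLagAt L q₀ S (y, η))
    (hsurj : ∀ y ∈ Metric.ball y₀ r, ∀ x, L.proj x = (extChartAt 𝓘(ℝ, E) q₀).symm y →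
      ∃ η, S (y, η) = x) :
    ∃ ρ > 0, ρ ≤ r ∧ ∀ y ∈ Metric.ball y₀ ρ, ∀ η, S (y, η) = S (y, 0) → ∃ f : E → ℝ,
      ContDiffOn ℝ ∞ f (Metric.ball y₀ ρ) ∧
      (∀ y' ∈ Metric.ball y₀ ρ, S (y', fderiv ℝ f y') = S (y', 0)) ∧ fderiv ℝ f y = η := by
  obtain ⟨R, hR, hRs⟩ := exists_uniform_surjective hr hS hsurj
  have htr : ∀ y ∈ Metric.ball y₀ r, ∀ η η' ζ, S (y, η) = S (y, η') →
      S (y, η + ζ) = S (y, η' + ζ) := fun y hy η η' ζ h =>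
    IsLagAt.eq_along_segment (z₁ := (y, η)) (z₂ := (y, η')) (fun _ _ => hS y hy _)
      (fun _ _ => hS y hy _) h
  have hy₀ : y₀ ∈ Metric.ball y₀ r := Metric.mem_ball_self hr
  -- small elements of the lattice extend locally
  have hloc : ∃ ρ > 0, ρ ≤ r / 2 ∧ ∀ y ∈ Metric.ball y₀ ρ,
      ∀ η ∈ Metric.closedBall (0 : E →L[ℝ] ℝ) (2 * R + 1), S (y, η) = S (y, 0) → ∃ f : E → ℝ,
        ContDiffOn ℝ ∞ f (Metric.ball y₀ ρ) ∧
        (∀ y' ∈ Metric.ball y₀ ρ, S (y', fderiv ℝ f y') = S (y', 0)) ∧ fderiv ℝ f y = η := by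
    refine (isCompact_closedBall (0 : E →L[ℝ] ℝ) (2 * R + 1)).induction_on
      (p := fun A => ∃ ρ > 0, ρ ≤ r / 2 ∧ ∀ y ∈ Metric.ball y₀ ρ, ∀ η ∈ A, S (y, η) = S (y, 0) →
        ∃ f : E → ℝ, ContDiffOn ℝ ∞ f (Metric.ball y₀ ρ) ∧
        (∀ y' ∈ Metric.ball y₀ ρ, S (y', fderiv ℝ f y') = S (y', 0)) ∧ fderiv ℝ f y = η)
      ⟨r / 2, half_pos hr, le_rfl, by simp⟩ ?_ ?_ ?_
    · rintro A B hAB ⟨ρ, hρ, hρr, h⟩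
      exact ⟨ρ, hρ, hρr, fun y hy η hη => h y hy η (hAB hη)⟩
    · rintro A B ⟨ρ, hρ, hρr, h⟩ ⟨ρ', hρ', -, h'⟩
      refine ⟨min ρ ρ', lt_min hρ hρ', (min_le_left _ _).trans hρr, fun y hy η hη hS => ?_⟩
      have s1 : Metric.ball y₀ (min ρ ρ') ⊆ Metric.ball y₀ ρ := Metric.ball_subset_ball (min_le_left _ _)
      have s2 : Metric.ball y₀ (min ρ ρ') ⊆ Metric.ball y₀ ρ' :=
        Metric.ball_subset_ball (min_le_right _ _)
      rcases hη with hη | hη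
      · obtain ⟨f, h1, h2, h3⟩ := h y (s1 hy) η hη hS
        exact ⟨f, h1.mono s1, fun y' hy' => h2 y' (s1 hy'), h3⟩
      · obtain ⟨f, h1, h2, h3⟩ := h' y (s2 hy) η hη hS
        exact ⟨f, h1.mono s2, fun y' hy' => h2 y' (s2 hy'), h3⟩
    · intro η₀ _
      -- If η₀ is in the lattice, the transition function between the germs at 0 and η₀ extends it.
      -- Local injectivity of S shows that every lattice vector near η₀ over a nearby point lies on
      -- this same extension. Otherwise, by the Hausdorff property, there are no lattice vectors
      -- nearby.
      by_cases hη₀ : S (y₀, η₀) = S (y₀, 0)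
      · obtain ⟨ρ, hρ, f, hf, hf0, hfS⟩ := (hS y₀ hy₀ 0).transition (hS y₀ hy₀ η₀) hη₀.symm
        simp only [sub_zero] at hf0
        obtain ⟨e, hze, -, hes, -⟩ := (hS y₀ hy₀ η₀).exists_openPartialHomeomorph Filter.univ_mem
        obtain ⟨δ, hδ, hball⟩ := Metric.isOpen_iff.1 e.open_source _ hze
        have hfc : ContinuousAt (fderiv ℝ f) y₀ := ((hf.contDiffAt (Metric.ball_mem_nhds _ hρ)
          ).fderiv_right (m := ∞) (by simp)).continuousAt
        obtain ⟨δ', hδ', hδf⟩ := Metric.continuousAt_iff.1 hfc δ hδ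
        let ρ' := min (min ρ (r / 2)) (min δ δ')
        have hρ' : 0 < ρ' := lt_min (lt_min hρ (half_pos hr)) (lt_min hδ hδ')
        have s1 : Metric.ball y₀ ρ' ⊆ Metric.ball y₀ ρ :=
          Metric.ball_subset_ball ((min_le_left _ _).trans (min_le_left _ _))
        have hfS' : ∀ y ∈ Metric.ball y₀ ρ', S (y, fderiv ℝ f y) = S (y, 0) := fun y hy => by
          have := hfS (y, 0) (by
            rw [← ball_prod_same]
            exact ⟨s1 hy, Metric.mem_ball_self hρ⟩)
          simpa using this.symm
        refine ⟨Metric.ball η₀ δ, mem_nhdsWithin_of_mem_nhds (Metric.ball_mem_nhds _ hδ), ρ', hρ',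
          (min_le_left _ _).trans (min_le_right _ _), fun y hy η hη hSη =>
            ⟨f, hf.mono s1, hfS', ?_⟩⟩
        have hyδ : y ∈ Metric.ball y₀ δ :=
          Metric.ball_subset_ball ((min_le_right _ _).trans (min_le_left _ _)) hy
        have m1 : ((y, η) : E × (E →L[ℝ] ℝ)) ∈ e.source := hball (by
          rw [← ball_prod_same]
          exact ⟨hyδ, hη⟩)
        have m2 : ((y, fderiv ℝ f y) : E × (E →L[ℝ] ℝ)) ∈ e.source := hball (by
          rw [← ball_prod_same]
          refine ⟨hyδ, ?_⟩
          have := hδf (Metric.ball_subset_ball ((min_le_right _ _).trans (min_le_right _ _)) hy)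
          rwa [hf0] at this)
        have := e.injOn m2 m1 (by rw [hes _ m1, hes _ m2, hfS' y hy, hSη])
        exact congrArg Prod.snd this
      · have hc1 : ContinuousAt (fun z : E × (E →L[ℝ] ℝ) => S z) (y₀, η₀) :=
          (hS y₀ hy₀ η₀).contMDiffAt.continuousAt
        have hc2 : ContinuousAt (fun z : E × (E →L[ℝ] ℝ) => S (z.1, 0)) (y₀, η₀) :=
          ContinuousAt.comp (g := S) (f := fun z : E × (E →L[ℝ] ℝ) => (z.1, 0))
            (hS y₀ hy₀ 0).contMDiffAt.continuousAt (by fun_prop)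
        obtain ⟨δ, hδ, hball⟩ := Metric.eventually_nhds_iff_ball.1
          ((hc1.prodMk hc2).preimage_mem_nhds (isClosed_diagonal.isOpen_compl.mem_nhds hη₀))
        refine ⟨Metric.ball η₀ δ, mem_nhdsWithin_of_mem_nhds (Metric.ball_mem_nhds _ hδ),
          min δ (r / 2), lt_min hδ (half_pos hr), min_le_right _ _, fun y hy η hη hSη => ?_⟩
        exact absurd hSη (hball (y, η) (by
          rw [← ball_prod_same]
          exact ⟨Metric.ball_subset_ball (min_le_left _ _) hy, hη⟩))
  obtain ⟨ρ, hρ, hρr, hext⟩ := hloc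
  refine ⟨ρ, hρ, by linarith, fun y hy => ?_⟩
  have hyr : y ∈ Metric.ball y₀ r := Metric.ball_subset_ball (by linarith) hy
  have hρr' : ∀ y ∈ Metric.ball y₀ ρ, y ∈ Metric.ball y₀ r := fun y hy =>
    Metric.ball_subset_ball (by linarith) hy
  -- Since the extendable vectors form a subgroup, it suffices to write η as a sum of small lattice
  -- vectors.
  let A : AddSubgroup (E →L[ℝ] ℝ) :=
    { carrier := {η | ∃ f : E → ℝ, ContDiffOn ℝ ∞ f (Metric.ball y₀ ρ) ∧
        (∀ y' ∈ Metric.ball y₀ ρ, S (y', fderiv ℝ f y') = S (y', 0)) ∧ fderiv ℝ f y = η}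
      zero_mem' := ⟨fun _ => 0, contDiffOn_const, fun y' _ => by simp, by simp⟩
      add_mem' := by
        rintro _ _ ⟨f, hf, hfS, rfl⟩ ⟨g, hg, hgS, rfl⟩
        have hd : ∀ y' ∈ Metric.ball y₀ ρ, fderiv ℝ (f + g) y' = fderiv ℝ f y' + fderiv ℝ g y' :=
          fun y' hy' => fderiv_add
            ((hf.contDiffAt (Metric.isOpen_ball.mem_nhds hy')).differentiableAt (by simp))
            ((hg.contDiffAt (Metric.isOpen_ball.mem_nhds hy')).differentiableAt (by simp))
        refine ⟨f + g, hf.add hg, fun y' hy' => ?_, hd y hy⟩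
        rw [hd y' hy', htr y' (hρr' y' hy') _ _ _ (hfS y' hy'), zero_add, hgS y' hy']
      neg_mem' := by
        rintro _ ⟨f, hf, hfS, rfl⟩
        have hd : ∀ y', fderiv ℝ (-f) y' = -fderiv ℝ f y' := fun y' => fderiv_neg
        refine ⟨-f, hf.neg, fun y' hy' => ?_, hd y⟩
        have := htr y' (hρr' y' hy') _ _ (-fderiv ℝ f y') (hfS y' hy')
        rw [hd, ← zero_add (-fderiv ℝ f y'), ← this, add_neg_cancel] }
  intro η hη
  change η ∈ A
  have hsmall : ∀ ζ, ‖ζ‖ ≤ 2 * R + 1 → S (y, ζ) = S (y, 0) → ζ ∈ A := fun ζ h1 h2 =>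
    hext y hy ζ (by simpa using h1) h2
  have hch : ∀ ζ, ∃ ζ', ‖ζ'‖ ≤ R ∧ S (y, ζ') = S (y, ζ) := fun ζ =>
    hRs y (Metric.ball_subset_ball hρr hy) _ (hS y hyr ζ).proj_eq
  choose c hcR hcS using hch
  obtain ⟨N, hN⟩ := exists_nat_gt ‖η‖
  have hN0 : (0 : ℝ) < N := (norm_nonneg _).trans_lt hN
  have hδ : ∀ ζ ζ', S (y, ζ) = S (y, ζ') → S (y, ζ - ζ') = S (y, 0) := fun ζ ζ' h => by
    have := htr y hyr ζ ζ' (-ζ') h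
    rwa [add_neg_cancel, ← sub_eq_add_neg] at this
  -- Here c picks a remainder of norm at most R in the same lattice coset, so the difference is the
  -- rounding of (k/N)η.
  have key : ∀ k : ℕ, ((k : ℝ) * (N : ℝ)⁻¹) • η - c (((k : ℝ) * (N : ℝ)⁻¹) • η) ∈ A := by
    intro k
    induction k with
    | zero =>
      refine hsmall _ ?_ (hδ _ _ (hcS _).symm)
      simp only [Nat.cast_zero, zero_mul, zero_smul, zero_sub, norm_neg]
      linarith [hcR 0]
    | succ k ih =>
      have h1 : ((((k + 1 : ℕ) : ℝ) * (N : ℝ)⁻¹) • η - c ((((k + 1 : ℕ) : ℝ) * (N : ℝ)⁻¹) • η)) =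
          (((k : ℝ) * (N : ℝ)⁻¹) • η - c (((k : ℝ) * (N : ℝ)⁻¹) • η)) +
          ((((((k + 1 : ℕ) : ℝ) * (N : ℝ)⁻¹) • η - c ((((k + 1 : ℕ) : ℝ) * (N : ℝ)⁻¹) • η))) -
          (((k : ℝ) * (N : ℝ)⁻¹) • η - c (((k : ℝ) * (N : ℝ)⁻¹) • η))) := by abel
      rw [h1]
      refine A.add_mem ih (hsmall _ ?_ ?_)
      · have h2 : ((((((k + 1 : ℕ) : ℝ) * (N : ℝ)⁻¹) • η - c ((((k + 1 : ℕ) : ℝ) * (N : ℝ)⁻¹) • η))) -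
          (((k : ℝ) * (N : ℝ)⁻¹) • η - c (((k : ℝ) * (N : ℝ)⁻¹) • η))) = (N : ℝ)⁻¹ • η -
            c ((((k + 1 : ℕ) : ℝ) * (N : ℝ)⁻¹) • η) + c (((k : ℝ) * (N : ℝ)⁻¹) • η) := by
          push_cast
          module
        rw [h2]
        have h3 : ‖(N : ℝ)⁻¹ • η‖ ≤ 1 := by
          rw [norm_smul, norm_inv, Real.norm_natCast, inv_mul_le_iff₀ hN0, mul_one]
          exact hN.le
        have h4 := norm_add_le ((N : ℝ)⁻¹ • η - c ((((k + 1 : ℕ) : ℝ) * (N : ℝ)⁻¹) • η))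
          (c (((k : ℝ) * (N : ℝ)⁻¹) • η))
        have h5 := norm_sub_le ((N : ℝ)⁻¹ • η) (c ((((k + 1 : ℕ) : ℝ) * (N : ℝ)⁻¹) • η))
        linarith [hcR ((((k + 1 : ℕ) : ℝ) * (N : ℝ)⁻¹) • η), hcR (((k : ℝ) * (N : ℝ)⁻¹) • η)]
      · refine hδ _ _ ((hδ _ _ (hcS _).symm).trans (hδ _ _ (hcS _).symm).symm)
  have h1 := key N
  rw [mul_inv_cancel₀ hN0.ne', one_smul] at h1
  have h2 : c η ∈ A := hsmall _ (by linarith [hcR η]) ((hcS η).trans hη)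
  have := A.add_mem h1 h2
  rwa [sub_add_cancel] at this

end Coordinates

/-! ### Integral affine functions and transition functions -/

section Transition

variable {E : Type*} [NormedAddCommGroup E] [NormedSpace ℝ E]
  {Q : Type*} [TopologicalSpace Q] [ChartedSpace E Q] {U V : Set Q} {a b h : Q → ℝ} {x : Q}

theorem mdifferentiableAt_of_contMDiffOn (ha : ContMDiffOn 𝓘(ℝ, E) 𝓘(ℝ, ℝ) ∞ a U) (hU : IsOpen U)
    (hx : x ∈ U) : MDifferentiableAt 𝓘(ℝ, E) 𝓘(ℝ, ℝ) a x :=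
  (ha.contMDiffAt (hU.mem_nhds hx)).mdifferentiableAt (by simp)

theorem dd_add (ha : MDifferentiableAt 𝓘(ℝ, E) 𝓘(ℝ, ℝ) a x)
    (hb : MDifferentiableAt 𝓘(ℝ, E) 𝓘(ℝ, ℝ) b x) :
    (dd (a + b) x : CotangentSpace E x) = dd a x + dd b x := mfderiv_add ha hb

theorem dd_sub (ha : MDifferentiableAt 𝓘(ℝ, E) 𝓘(ℝ, ℝ) a x)
    (hb : MDifferentiableAt 𝓘(ℝ, E) 𝓘(ℝ, ℝ) b x) :
    (dd (a - b) x : CotangentSpace E x) = dd a x - dd b x := mfderiv_sub ha hb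

theorem dd_add_const (c : ℝ) (ha : MDifferentiableAt 𝓘(ℝ, E) 𝓘(ℝ, ℝ) a x) :
    (dd (fun y => a y + c) x : CotangentSpace E x) = dd a x := by
  have := dd_add ha (b := fun _ => c) mdifferentiableAt_const
  have h0 : (dd (fun _ : Q => c) x : CotangentSpace E x) = 0 := mfderiv_const
  rw [h0, add_zero] at this
  exact this

theorem dd_congr (hab : a =ᶠ[𝓝 x] b) : (dd a x : CotangentSpace E x) = dd b x := hab.mfderiv_eq

/-- Integral affine functions on a subset, defined on the whole base. -/
def IsAffOn (Λ : LatticeField E Q) (U : Set Q) (a : Q → ℝ) : Prop :=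
  ContMDiffOn 𝓘(ℝ, E) 𝓘(ℝ, ℝ) ∞ a U ∧ ∀ x ∈ U, dd a x ∈ Λ x

variable [IsManifold 𝓘(ℝ, E) ∞ Q] [FiniteDimensional ℝ E]
  {F : Type*} [NormedAddCommGroup F] [NormedSpace ℝ F] [FiniteDimensional ℝ F]
  {X : Type*} [TopologicalSpace X] [ChartedSpace F X] [IsManifold 𝓘(ℝ, F) ∞ X] [T2Space X]
  {L : LagrangianTorusFibration E F Q X} {P P₁ P₂ : Opens Q}

theorem dd_eq_zero_iff {q₀ : Q} {y : E} (hy : y ∈ (extChartAt 𝓘(ℝ, E) q₀).target)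
    (ha : ContMDiffAt 𝓘(ℝ, E) 𝓘(ℝ, ℝ) ∞ a ((extChartAt 𝓘(ℝ, E) q₀).symm y)) :
    dd a ((extChartAt 𝓘(ℝ, E) q₀).symm y) = (0 : CotangentSpace E _) ↔
      fderiv ℝ (a ∘ (extChartAt 𝓘(ℝ, E) q₀).symm) y = 0 := by
  rw [dd_eq_covector_self hy ha]
  exact map_eq_zero_iff _ (covector_injective hy)

theorem continuousAt_fderiv_chart {q : Q} (ha : ContMDiffAt 𝓘(ℝ, E) 𝓘(ℝ, ℝ) ∞ a q) :
    ContinuousAt (fderiv ℝ (a ∘ (extChartAt 𝓘(ℝ, E) q).symm)) (extChartAt 𝓘(ℝ, E) q q) := by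
  have := contDiffAt_comp_chart_symm (mem_extChartAt_target (I := 𝓘(ℝ, E)) q) (h := a)
    (by rwa [extChartAt_to_inv])
  exact (this.fderiv_right (m := ∞) (by simp)).continuousAt

theorem eventually_dd_ne_zero (hU : IsOpen U) (hxU : x ∈ U)
    (ha : ContMDiffOn 𝓘(ℝ, E) 𝓘(ℝ, ℝ) ∞ a U) (h : dd a x ≠ (0 : CotangentSpace E x)) :
    ∀ᶠ y in 𝓝 x, dd a y ≠ (0 : CotangentSpace E y) := by
  have hs := (isOpen_extChartAt_source (I := 𝓘(ℝ, E)) x).mem_nhds (mem_extChartAt_source x)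
  have hz : fderiv ℝ (a ∘ (extChartAt 𝓘(ℝ, E) x).symm) (extChartAt 𝓘(ℝ, E) x x) ≠ 0 := by
    intro h0
    have := (dd_eq_zero_iff (mem_extChartAt_target (I := 𝓘(ℝ, E)) x) (by
      rw [extChartAt_to_inv]; exact ha.contMDiffAt (hU.mem_nhds hxU))).2 h0
    rw [extChartAt_to_inv] at this
    exact h this
  have hc := ContinuousAt.comp (f := extChartAt 𝓘(ℝ, E) x)
    (continuousAt_fderiv_chart (ha.contMDiffAt (hU.mem_nhds hxU))) (continuousAt_extChartAt x)
  filter_upwards [hs, hU.mem_nhds hxU, hc.eventually_ne hz] with y hy hyU hne h0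
  refine hne ((dd_eq_zero_iff ((extChartAt 𝓘(ℝ, E) x).map_source hy) ?_).1 ?_)
  · rw [(extChartAt 𝓘(ℝ, E) x).left_inv hy]
    exact ha.contMDiffAt (hU.mem_nhds hyU)
  · rwa [(extChartAt 𝓘(ℝ, E) x).left_inv hy]

/-- Discreteness of the lattice, uniformly in the base point: near x the covectors da and 0 have the
same image under a trivialisation that is injective near the zero covector. -/
theorem eventually_dd_eq_zero [T2Space Q] [CompactSpace X] (hU : IsOpen U) (hxU : x ∈ U)
    (ha : IsAffOn L.periodLattice U a) (h : dd a x = (0 : CotangentSpace E x)) :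
    ∀ᶠ y in 𝓝 x, dd a y = (0 : CotangentSpace E y) := by
  obtain ⟨P, hxP, hP⟩ := L.exists_localTrivialisation x
  obtain ⟨τ⟩ := hP P le_rfl
  have hs := (isOpen_extChartAt_source (I := 𝓘(ℝ, E)) x).mem_nhds (mem_extChartAt_source x)
  have hat : ∀ y ∈ U, y ∈ (extChartAt 𝓘(ℝ, E) x).source → ContMDiffAt 𝓘(ℝ, E) 𝓘(ℝ, ℝ) ∞ a
      ((extChartAt 𝓘(ℝ, E) x).symm (extChartAt 𝓘(ℝ, E) x y)) := fun y hyU hy => by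
    rw [(extChartAt 𝓘(ℝ, E) x).left_inv hy]
    exact ha.1.contMDiffAt (hU.mem_nhds hyU)
  have hLag : IsLagAt L x (τ.toFun ∘ cot x) (extChartAt 𝓘(ℝ, E) x x, 0) :=
    τ.isLagAt (mem_extChartAt_target (I := 𝓘(ℝ, E)) x) (by simpa using hxP)
  obtain ⟨e, hze, -, hes, -⟩ := hLag.exists_openPartialHomeomorph Filter.univ_mem
  have h0 : fderiv ℝ (a ∘ (extChartAt 𝓘(ℝ, E) x).symm) (extChartAt 𝓘(ℝ, E) x x) = 0 :=
    (dd_eq_zero_iff (mem_extChartAt_target (I := 𝓘(ℝ, E)) x)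
      (hat x hxU (mem_extChartAt_source x))).1 (by rw [extChartAt_to_inv]; exact h)
  have hc := ContinuousAt.comp (f := extChartAt 𝓘(ℝ, E) x)
    (continuousAt_fderiv_chart (ha.1.contMDiffAt (hU.mem_nhds hxU))) (continuousAt_extChartAt x)
  have hc1 : ContinuousAt (fun y => (extChartAt 𝓘(ℝ, E) x y,
      fderiv ℝ (a ∘ (extChartAt 𝓘(ℝ, E) x).symm) (extChartAt 𝓘(ℝ, E) x y))) x :=
    (continuousAt_extChartAt x).prodMk hc
  have hc2 : ContinuousAt (fun y => (extChartAt 𝓘(ℝ, E) x y, (0 : E →L[ℝ] ℝ))) x :=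
    (continuousAt_extChartAt x).prodMk continuousAt_const
  filter_upwards [hs, hU.mem_nhds hxU, P.isOpen.mem_nhds hxP,
    hc1.preimage_mem_nhds (e.open_source.mem_nhds (by rwa [h0])),
    hc2.preimage_mem_nhds (e.open_source.mem_nhds hze)] with y hy hyU hyP m1 m2
  have ht := (extChartAt 𝓘(ℝ, E) x).map_source hy
  have hl := (extChartAt 𝓘(ℝ, E) x).left_inv hy
  have h1 : dd a ((extChartAt 𝓘(ℝ, E) x).symm (extChartAt 𝓘(ℝ, E) x y)) ∈ L.periodLattice _ :=
    hl.symm ▸ ha.2 y hyU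
  rw [dd_eq_covector_self ht (hat y hyU hy)] at h1
  have h2 := (τ.eq_iff _ (by rw [hl]; exact hyP) (covector x _ (fderiv ℝ
    (a ∘ (extChartAt 𝓘(ℝ, E) x).symm) (extChartAt 𝓘(ℝ, E) x y))) (covector x _ 0)).2 (by
      rwa [map_zero, sub_zero])
  have h3 := e.injOn m1 m2 ((hes _ m1).trans (h2.trans (hes _ m2).symm))
  have h4 := (dd_eq_zero_iff ht (hat y hyU hy)).2 (congrArg Prod.snd h3)
  rwa [hl] at h4

/-- The vanishing locus of da is open because the lattice is discrete and closed because da is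
continuous. -/
theorem IsAffOn.dd_eq_zero [T2Space Q] [CompactSpace X] (ha : IsAffOn L.periodLattice U a)
    (hU : IsOpen U) (hUc : IsPreconnected U) (hx : x ∈ U) (h : dd a x = (0 : CotangentSpace E x))
    {y : Q} (hy : y ∈ U) : dd a y = (0 : CotangentSpace E y) := by
  have h1 : IsOpen (U ∩ {y | dd a y = (0 : CotangentSpace E y)}) := isOpen_iff_mem_nhds.2
    fun z hz => Filter.inter_mem (hU.mem_nhds hz.1) (eventually_dd_eq_zero hU hz.1 ha hz.2)
  have h2 : IsOpen (U ∩ {y | dd a y ≠ (0 : CotangentSpace E y)}) := isOpen_iff_mem_nhds.2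
    fun z hz => Filter.inter_mem (hU.mem_nhds hz.1) (eventually_dd_ne_zero hU hz.1 ha.1 hz.2)
  have := hUc.subset_left_of_subset_union h1 h2
    (Set.disjoint_left.2 fun z hz hz' => hz'.2 hz.2)
    (fun z hz => (em _).imp (fun h => ⟨hz, h⟩) fun h => ⟨hz, h⟩) ⟨x, hx, hx, h⟩ hy
  exact this.2

theorem eq_of_dd_eq_zero (hU : IsOpen U) (hUc : IsPreconnected U)
    (ha : ContMDiffOn 𝓘(ℝ, E) 𝓘(ℝ, ℝ) ∞ a U) (h : ∀ y ∈ U, dd a y = (0 : CotangentSpace E y))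
    {y : Q} (hx : x ∈ U) (hy : y ∈ U) : a y = a x := by
  have hloc : ∀ z ∈ U, ∀ᶠ w in 𝓝 z, a w = a z := by
    intro z hz
    have hev : ∀ᶠ w in 𝓝 (extChartAt 𝓘(ℝ, E) z z), w ∈ (extChartAt 𝓘(ℝ, E) z).target ∧
        (extChartAt 𝓘(ℝ, E) z).symm w ∈ U :=
      Filter.Eventually.and ((isOpen_extChartAt_target (I := 𝓘(ℝ, E)) z).mem_nhds
        (mem_extChartAt_target z)) ((continuousAt_extChartAt_symm z).preimage_mem_nhds (by
          rw [extChartAt_to_inv]; exact hU.mem_nhds hz))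
    obtain ⟨r, hr, hball⟩ := Metric.eventually_nhds_iff_ball.1 hev
    filter_upwards [(isOpen_extChartAt_source (I := 𝓘(ℝ, E)) z).mem_nhds (mem_extChartAt_source z),
      (continuousAt_extChartAt (I := 𝓘(ℝ, E)) z).preimage_mem_nhds (Metric.ball_mem_nhds _ hr)]
      with w hw hwr
    have := Metric.isOpen_ball.is_const_of_fderiv_eq_zero (𝕜 := ℝ)
      (f := a ∘ (extChartAt 𝓘(ℝ, E) z).symm) (convex_ball _ r).isPreconnected
      (fun v hv => ((contDiffAt_comp_chart_symm (hball v hv).1 (ha.contMDiffAt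
        (hU.mem_nhds (hball v hv).2))).differentiableAt (by simp)).differentiableWithinAt)
      (fun v hv => (dd_eq_zero_iff (hball v hv).1 (ha.contMDiffAt
        (hU.mem_nhds (hball v hv).2))).1 (h _ (hball v hv).2)) hwr (Metric.mem_ball_self hr)
    simp only [Function.comp_apply] at this
    rwa [(extChartAt 𝓘(ℝ, E) z).left_inv hw, extChartAt_to_inv] at this
  have h1 : IsOpen (U ∩ {z | a z = a x}) := isOpen_iff_mem_nhds.2 fun z hz =>
    Filter.inter_mem (hU.mem_nhds hz.1) (by
      filter_upwards [hloc z hz.1] with w hw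
      exact hw.trans hz.2)
  have h2 : IsOpen (U ∩ {z | a z ≠ a x}) := isOpen_iff_mem_nhds.2 fun z hz =>
    Filter.inter_mem (hU.mem_nhds hz.1) (by
      filter_upwards [hloc z hz.1] with w hw h0
      exact hz.2 (hw.symm.trans h0))
  exact (hUc.subset_left_of_subset_union h1 h2
    (Set.disjoint_left.2 fun z hz hz' => hz'.2 hz.2)
    (fun z hz => (em _).imp (fun h => ⟨hz, h⟩) fun h => ⟨hz, h⟩) ⟨x, hx, hx, rfl⟩ hy).2

/-- The inverse image in the base of a ball in a chart. -/
def chartBall (q : Q) (r : ℝ) : Opens Q :=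
  ⟨_, (continuousOn_extChartAt (I := 𝓘(ℝ, E)) q).isOpen_inter_preimage
    (isOpen_extChartAt_source (I := 𝓘(ℝ, E)) q)
    (Metric.isOpen_ball (x := extChartAt 𝓘(ℝ, E) q q) (ε := r))⟩

theorem mem_chartBall_self (q : Q) {r : ℝ} (hr : 0 < r) : q ∈ chartBall (E := E) q r :=
  ⟨mem_extChartAt_source q, Metric.mem_ball_self hr⟩

theorem isPreconnected_chartBall (q : Q) {r : ℝ}
    (hr : Metric.ball (extChartAt 𝓘(ℝ, E) q q) r ⊆ (extChartAt 𝓘(ℝ, E) q).target) :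
    IsPreconnected (chartBall (E := E) q r : Set Q) := by
  have : (chartBall (E := E) q r : Set Q) =
      (extChartAt 𝓘(ℝ, E) q).symm '' Metric.ball (extChartAt 𝓘(ℝ, E) q q) r := by
    rw [(extChartAt 𝓘(ℝ, E) q).symm_image_eq_source_inter_preimage hr]
    rfl
  rw [this]
  exact (convex_ball _ r).isPreconnected.image _ ((continuousOn_extChartAt_symm q).mono hr)

theorem contMDiffOn_comp_chart {q : Q} {r : ℝ} {f : E → ℝ}
    (hf : ContDiffOn ℝ ∞ f (Metric.ball (extChartAt 𝓘(ℝ, E) q q) r)) :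
    ContMDiffOn 𝓘(ℝ, E) 𝓘(ℝ, ℝ) ∞ (f ∘ extChartAt 𝓘(ℝ, E) q) (chartBall (E := E) q r : Set Q) :=
  ContMDiffOn.comp (t := Metric.ball (extChartAt 𝓘(ℝ, E) q q) r) hf.contMDiffOn
    ((contMDiffOn_extChartAt (I := 𝓘(ℝ, E))).mono fun x hx => by
      rw [← extChartAt_source 𝓘(ℝ, E)]; exact hx.1) fun x hx => hx.2

/-- Elements of the lattice extend locally, on a neighbourhood depending only on the point, to
differentials of integral affine functions. -/
theorem LagrangianTorusFibration.exists_affine_extension [T2Space Q] [CompactSpace X]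
    (L : LagrangianTorusFibration E F Q X) (q : Q) :
    ∃ ρ > 0, Metric.ball (extChartAt 𝓘(ℝ, E) q q) ρ ⊆ (extChartAt 𝓘(ℝ, E) q).target ∧
      ∀ x ∈ chartBall (E := E) q ρ, ∀ ξ ∈ L.periodLattice x, ∃ a : Q → ℝ,
        IsAffOn L.periodLattice (chartBall (E := E) q ρ) a ∧ dd a x = ξ := by
  obtain ⟨r, hr, S, hrt, hS, hsurj⟩ := L.exists_section (q₀ := q) (mem_extChartAt_target q)
  obtain ⟨ρ, hρ, hρr, h⟩ := exists_coordinate_extension hr hS hsurj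
  have hs := Metric.ball_subset_ball (x := extChartAt 𝓘(ℝ, E) q q) hρr
  have hmem : ∀ y ∈ Metric.ball (extChartAt 𝓘(ℝ, E) q q) r, ∀ η,
      S (y, η) = S (y, 0) ↔ covector q y η ∈ L.periodLattice _ := fun y hy η => by
    have := mem_periodLattice_iff (hS y hy) (hsurj y hy) η 0
    rwa [sub_zero] at this
  have hdd : ∀ f : E → ℝ, ContDiffOn ℝ ∞ f (Metric.ball (extChartAt 𝓘(ℝ, E) q q) ρ) →
      ∀ y ∈ Metric.ball (extChartAt 𝓘(ℝ, E) q q) ρ,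
      dd (f ∘ extChartAt 𝓘(ℝ, E) q) ((extChartAt 𝓘(ℝ, E) q).symm y) =
        covector q y (fderiv ℝ f y) := fun f hf y hy =>
    dd_eq_covector (hrt (hs hy)) ((hf.contDiffAt
      (Metric.isOpen_ball.mem_nhds hy)).differentiableAt (by simp)) .rfl
  refine ⟨ρ, hρ, hs.trans hrt, ?_⟩
  rintro x ⟨hx, hxρ⟩ ξ hξ
  obtain ⟨y, hy, rfl⟩ := exists_coordinate (E := E) hx
  have hyρ : y ∈ Metric.ball (extChartAt 𝓘(ℝ, E) q q) ρ := by
    rwa [Set.mem_preimage, (extChartAt 𝓘(ℝ, E) q).right_inv hy] at hxρ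
  obtain ⟨η, rfl⟩ := exists_covector hy ξ
  obtain ⟨f, hf, hfS, rfl⟩ := h y hyρ η ((hmem y (hs hyρ) η).2 hξ)
  refine ⟨f ∘ extChartAt 𝓘(ℝ, E) q, ⟨contMDiffOn_comp_chart hf, ?_⟩, hdd f hf y hyρ⟩
  rintro x' ⟨hx', hxρ'⟩
  obtain ⟨y', hy', rfl⟩ := exists_coordinate (E := E) hx'
  have hyρ' : y' ∈ Metric.ball (extChartAt 𝓘(ℝ, E) q q) ρ := by
    rwa [Set.mem_preimage, (extChartAt 𝓘(ℝ, E) q).right_inv hy'] at hxρ'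
  rw [hdd f hf y' hyρ']
  exact (hmem y' (hs hyρ') _).1 (hfS y' hyρ')

/-- The function `h` is a primitive of the change of trivialisation over `U`. -/
def IsTransition (τ₁ : L.LocalTrivialisation P₁) (τ₂ : L.LocalTrivialisation P₂) (U : Set Q)
    (h : Q → ℝ) : Prop :=
  ContMDiffOn 𝓘(ℝ, E) 𝓘(ℝ, ℝ) ∞ h U ∧
    ∀ x ∈ U, ∀ ξ : CotangentSpace E x, τ₁.toFun ⟨x, ξ⟩ = τ₂.toFun ⟨x, ξ + dd h x⟩

variable {τ₁ : L.LocalTrivialisation P₁} {τ₂ : L.LocalTrivialisation P₂}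

theorem IsTransition.mono (hh : IsTransition τ₁ τ₂ U h) (hVU : V ⊆ U) : IsTransition τ₁ τ₂ V h :=
  ⟨hh.1.mono hVU, fun x hx => hh.2 x (hVU hx)⟩

theorem IsTransition.add_aff (hh : IsTransition τ₁ τ₂ U h) (ha : IsAffOn L.periodLattice U a)
    (hU : IsOpen U) (hUP : ∀ x ∈ U, x ∈ P₂) : IsTransition τ₁ τ₂ U (h + a) := by
  refine ⟨hh.1.add ha.1, fun x hx ξ => (hh.2 x hx ξ).trans ?_⟩
  rw [dd_add (mdifferentiableAt_of_contMDiffOn hh.1 hU hx)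
    (mdifferentiableAt_of_contMDiffOn ha.1 hU hx), τ₂.eq_iff x (hUP x hx)]
  have := neg_mem (ha.2 x hx)
  convert this using 1
  abel

theorem IsTransition.add_const (hh : IsTransition τ₁ τ₂ U h) (hU : IsOpen U) (c : ℝ) :
    IsTransition τ₁ τ₂ U (fun x => h x + c) := by
  refine ⟨hh.1.add contMDiffOn_const, fun x hx ξ => (hh.2 x hx ξ).trans ?_⟩
  rw [dd_add_const c (mdifferentiableAt_of_contMDiffOn hh.1 hU hx)]

theorem IsTransition.sub {h' : Q → ℝ} (hh : IsTransition τ₁ τ₂ U h) (hh' : IsTransition τ₁ τ₂ U h')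
    (hU : IsOpen U) (hUP : ∀ x ∈ U, x ∈ P₂) : IsAffOn L.periodLattice U (h - h') := by
  refine ⟨hh.1.sub hh'.1, fun x hx => ?_⟩
  rw [dd_sub (mdifferentiableAt_of_contMDiffOn hh.1 hU hx)
    (mdifferentiableAt_of_contMDiffOn hh'.1 hU hx)]
  have := (τ₂.eq_iff x (hUP x hx) (0 + dd h x) (0 + dd h' x)).1
    ((hh.2 x hx 0).symm.trans (hh'.2 x hx 0))
  rwa [zero_add, zero_add] at this

/-- Transition functions over a connected set are determined by their first jet at a point. -/
theorem IsTransition.eqOn [T2Space Q] [CompactSpace X] {h' : Q → ℝ} (hh : IsTransition τ₁ τ₂ U h)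
    (hh' : IsTransition τ₁ τ₂ U h') (hU : IsOpen U) (hUc : IsPreconnected U)
    (hUP : ∀ x ∈ U, x ∈ P₂) (hx : x ∈ U) (h0 : h x = h' x)
    (h1 : (dd h x : CotangentSpace E x) = dd h' x) : Set.EqOn h h' U := by
  intro y hy
  have ha := hh.sub hh' hU hUP
  have h2 : dd (h - h') x = (0 : CotangentSpace E x) := by
    rw [dd_sub (mdifferentiableAt_of_contMDiffOn hh.1 hU hx)
      (mdifferentiableAt_of_contMDiffOn hh'.1 hU hx), h1, sub_self]
  have := eq_of_dd_eq_zero hU hUc ha.1 (fun z hz => ha.dd_eq_zero hU hUc hx h2 hz) hx hy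
  simp only [Pi.sub_apply, h0, sub_self] at this
  exact sub_eq_zero.1 this

/-- `IsLagAt.transition` compares the two trivialisations only near the zero covector;
`IsLagAt.eq_along_segment` carries the comparison over whole cotangent spaces. -/
theorem exists_isTransition_nhds {q : Q} (h₁ : q ∈ P₁) (h₂ : q ∈ P₂) :
    ∃ U : Opens Q, q ∈ U ∧ ∃ h, IsTransition τ₁ τ₂ U h := by
  have ht := mem_extChartAt_target (I := 𝓘(ℝ, E)) q
  have hq := extChartAt_to_inv (I := 𝓘(ℝ, E)) q
  have hL₁ : ∀ η, IsLagAt L q (τ₁.toFun ∘ cot q) (extChartAt 𝓘(ℝ, E) q q, η) := fun η =>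
    τ₁.isLagAt ht (by rw [hq]; exact h₁)
  have hL₂ : ∀ η, IsLagAt L q (τ₂.toFun ∘ cot q) (extChartAt 𝓘(ℝ, E) q q, η) := fun η =>
    τ₂.isLagAt ht (by rw [hq]; exact h₂)
  obtain ⟨η, hη⟩ := τ₂.section_surjective ht (by rw [hq]; exact h₂) _ (hL₁ 0).proj_eq
  obtain ⟨r, hr, f, hf, -, hfS⟩ := (hL₁ 0).transition (hL₂ η) hη.symm
  let U : Opens Q := chartBall (E := E) q r ⊓ P₁ ⊓ P₂
  refine ⟨U, ⟨⟨mem_chartBall_self (E := E) q hr, h₁⟩, h₂⟩, f ∘ extChartAt 𝓘(ℝ, E) q,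
    (contMDiffOn_comp_chart hf).mono fun x hx => hx.1.1, ?_⟩
  rintro x ⟨⟨⟨hx, hxr⟩, hx₁⟩, hx₂⟩ ξ
  obtain ⟨y, hy, rfl⟩ := exists_coordinate (E := E) hx
  have hyr : y ∈ Metric.ball (extChartAt 𝓘(ℝ, E) q q) r := by
    rwa [Set.mem_preimage, (extChartAt 𝓘(ℝ, E) q).right_inv hy] at hxr
  obtain ⟨ζ, rfl⟩ := exists_covector hy ξ
  rw [dd_eq_covector hy ((hf.contDiffAt (Metric.isOpen_ball.mem_nhds hyr)).differentiableAt
    (by simp)) .rfl, ← map_add]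
  have h0 := hfS (y, 0) (by
    rw [← ball_prod_same]
    exact ⟨hyr, Metric.mem_ball_self hr⟩)
  have := IsLagAt.eq_along_segment (L := L) (q₀ := q) (z₁ := (y, 0)) (z₂ := (y, 0 + fderiv ℝ f y))
    (ξ := ζ) (fun _ _ => τ₁.isLagAt hy hx₁) (fun _ _ => τ₂.isLagAt hy hx₂) h0
  simp only [zero_add] at this
  rw [add_comm ζ]
  exact this

/-- Around every point, every jet of a transition function is realised on a neighbourhood
depending only on the point. -/
theorem exists_isTransition_jet [T2Space Q] [CompactSpace X] {q : Q} (h₁ : q ∈ P₁) (h₂ : q ∈ P₂)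
    {N : Opens Q} (hN : q ∈ N) :
    ∃ U : Opens Q, q ∈ U ∧ U ≤ N ∧ IsPreconnected (U : Set Q) ∧ ∀ x ∈ U, ∀ (c : ℝ)
      (ξ : CotangentSpace E x), τ₁.toFun ⟨x, 0⟩ = τ₂.toFun ⟨x, ξ⟩ →
        ∃ h, IsTransition τ₁ τ₂ U h ∧ h x = c ∧ dd h x = ξ := by
  obtain ⟨U₀, hqU₀, h₀, hh₀⟩ := exists_isTransition_nhds (τ₁ := τ₁) (τ₂ := τ₂) h₁ h₂
  obtain ⟨ρ, hρ, hρt, hext⟩ := L.exists_affine_extension q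
  have hev : ∀ᶠ y in 𝓝 (extChartAt 𝓘(ℝ, E) q q), (extChartAt 𝓘(ℝ, E) q).symm y ∈
      (U₀ ⊓ N ⊓ P₂ : Opens Q) :=
    (continuousAt_extChartAt_symm q).preimage_mem_nhds (by
      rw [extChartAt_to_inv]
      exact (U₀ ⊓ N ⊓ P₂).isOpen.mem_nhds ⟨⟨hqU₀, hN⟩, h₂⟩)
  obtain ⟨r, hr, hball⟩ := Metric.eventually_nhds_iff_ball.1 hev
  have hsub : chartBall (E := E) q (min r ρ) ≤ chartBall q ρ := fun x hx =>
    ⟨hx.1, Metric.ball_subset_ball (min_le_right _ _) hx.2⟩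
  have hsub' : chartBall (E := E) q (min r ρ) ≤ U₀ ⊓ N ⊓ P₂ := fun x hx => by
    have := hball _ (Metric.ball_subset_ball (min_le_left _ _) hx.2)
    rwa [(extChartAt 𝓘(ℝ, E) q).left_inv hx.1] at this
  refine ⟨chartBall q (min r ρ), mem_chartBall_self q (lt_min hr hρ), fun x hx => (hsub' hx).1.2,
    isPreconnected_chartBall q ((Metric.ball_subset_ball (min_le_right _ _)).trans hρt), ?_⟩
  intro x hx c ξ hξ
  have hop := (chartBall (E := E) q (min r ρ)).isOpen
  have hh₀' : IsTransition τ₁ τ₂ (chartBall (E := E) q (min r ρ)) h₀ :=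
    hh₀.mono fun x hx => (hsub' hx).1.1
  have hmem : ξ - dd h₀ x ∈ L.periodLattice x := by
    have := (τ₂.eq_iff x (hsub' hx).2 ξ (0 + dd h₀ x)).1 (hξ.symm.trans (hh₀'.2 x hx 0))
    rwa [zero_add] at this
  obtain ⟨a, ha, hax⟩ := hext x (hsub hx) _ hmem
  have ha' : IsAffOn L.periodLattice (chartBall (E := E) q (min r ρ)) a :=
    ⟨ha.1.mono hsub, fun y hy => ha.2 y (hsub hy)⟩
  -- A fixed transition function is corrected by an integral affine function to adjust the
  -- differential at x, and then by a constant to adjust the value.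
  have hsum := hh₀'.add_aff ha' hop fun y hy => (hsub' hy).2
  refine ⟨_, hsum.add_const hop (c - (h₀ + a) x), by ring, ?_⟩
  rw [dd_add_const _ (mdifferentiableAt_of_contMDiffOn hsum.1 hop hx),
    dd_add (mdifferentiableAt_of_contMDiffOn hh₀'.1 hop hx)
      (mdifferentiableAt_of_contMDiffOn ha'.1 hop hx), hax]
  abel

end Transition

/-! ### Monodromy -/

section Monodromy

/-- A system of local sections with unique continuation and enough sections over small open sets
has a global section over a simply connected base. -/
theorem exists_global_section {B T : Type*} [TopologicalSpace B] [SimplyConnectedSpace B]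
    [LocallyPathConnectedSpace B] (R : B → T → Prop) (𝓢 : Set B → (B → T) → Prop)
    (mono : ∀ {V W s}, W ⊆ V → 𝓢 V s → 𝓢 W s) (mem : ∀ {V s}, 𝓢 V s → ∀ x ∈ V, R x (s x))
    (unique : ∀ {V s s'}, IsOpen V → IsPreconnected V → 𝓢 V s → 𝓢 V s' → ∀ x ∈ V, s x = s' x →
      Set.EqOn s s' V)
    (exists_local : ∀ x, ∃ V, IsOpen V ∧ x ∈ V ∧ IsPreconnected V ∧ ∀ y ∈ V, ∀ t, R y t →
      ∃ s, 𝓢 V s ∧ s y = t)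
    (nonempty : ∀ x, ∃ t, R x t) :
    ∃ σ : B → T, ∀ x, ∃ V, IsOpen V ∧ x ∈ V ∧ ∃ s, 𝓢 V s ∧ Set.EqOn σ s V := by
  choose V hVo hxV hVc hV using exists_local
  have heq : ∀ {V W s s'}, IsOpen V → IsOpen W → 𝓢 V s → 𝓢 W s' → ∀ x ∈ V, x ∈ W → s x = s' x →
      ∀ᶠ y in 𝓝 x, s y = s' y := by
    intro V W s s' hVo hWo hs hs' x hxV hxW hx
    obtain ⟨N, hN, hNo, hxN, hNc⟩ := locallyConnectedSpace_iff_subsets_isOpen_isConnected.1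
      (inferInstance : LocallyConnectedSpace B) x _ ((hVo.inter hWo).mem_nhds ⟨hxV, hxW⟩)
    filter_upwards [hNo.mem_nhds hxN] with y hy
    exact unique hNo hNc.isPreconnected (mono (fun z hz => (hN hz).1) hs)
      (mono (fun z hz => (hN hz).2) hs') x hxN hx hy
  -- The étale space of possible values. A set is open if with each of its points it contains the
  -- nearby graph of the chosen section through that point.
  let Z := {z : B × T // R z.1 z.2}
  choose s hs hst using fun z : Z => hV z.1.1 z.1.1 (hxV _) z.1.2 z.2
  let top : TopologicalSpace Z :=
    { IsOpen := fun A => ∀ z ∈ A, ∀ᶠ y in 𝓝 z.1.1, ∀ w : Z, w.1 = (y, s z y) → w ∈ A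
      isOpen_univ := fun z _ => .of_forall fun _ _ _ => Set.mem_univ _
      isOpen_inter := fun A A' hA hA' z hz => by
        filter_upwards [hA z hz.1, hA' z hz.2] with y h h' w hw
        exact ⟨h w hw, h' w hw⟩
      isOpen_sUnion := fun 𝒜 h𝒜 z hz => by
        obtain ⟨A, hA, hzA⟩ := hz
        filter_upwards [h𝒜 A hA z hzA] with y h w hw
        exact ⟨A, hA, h w hw⟩ }
  have hopen : ∀ A : Set Z, IsOpen A ↔
      ∀ z ∈ A, ∀ᶠ y in 𝓝 z.1.1, ∀ w : Z, w.1 = (y, s z y) → w ∈ A := fun A => Iff.rfl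
  let p : Z → B := fun z => z.1.1
  -- The graphs over V x of the sections through the points above x; they are the sheets over an
  -- evenly covered set.
  let sheet : ∀ x, {t // R x t} → Set Z := fun x t =>
    {w | w.1.1 ∈ V x ∧ w.1.2 = s ⟨(x, t.1), t.2⟩ w.1.1}
  have hsheet : ∀ x t (W : Set B), W ⊆ V x → IsOpen W → IsOpen (p ⁻¹' W ∩ sheet x t) := by
    intro x t W hWV hW
    refine (hopen _).2 fun z hz => ?_
    have h1 := heq (hVo _) (hVo _) (hs z) (hs ⟨(x, t.1), t.2⟩) z.1.1 (hxV _) hz.2.1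
      ((hst z).trans hz.2.2)
    filter_upwards [hW.mem_nhds hz.1, h1] with y hy h2 w hw
    have e1 : w.1.1 = y := congrArg Prod.fst hw
    refine ⟨?_, ?_, ?_⟩
    · change w.1.1 ∈ W
      rwa [e1]
    · rw [e1]
      exact hWV hy
    · rw [e1, ← h2]
      exact congrArg Prod.snd hw
  have hZ : Nonempty (B → Z) := by
    choose t ht using nonempty
    exact ⟨fun x => ⟨(x, t x), ht x⟩⟩
  let : ∀ x, TopologicalSpace {t // R x t} := fun _ => ⊥
  have : ∀ x, DiscreteTopology {t // R x t} := fun _ => ⟨rfl⟩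
  have : ∀ x, Nonempty {t // R x t} := fun x => let ⟨t, ht⟩ := nonempty x; ⟨⟨t, ht⟩⟩
  have hcov : IsCoveringMap p := by
    refine IsCoveringMap.mk p (fun x => {t // R x t}) (fun x =>
      IsOpen.trivializationDiscrete (sheet x) (V x) (hVo x) (fun t {W} hW => ⟨hsheet x t W hW, ?_⟩)
        ?_ ?_ ?_ ?_) fun x => hxV x
    · refine fun h => isOpen_iff_mem_nhds.2 fun y hy => ?_
      have hR := mem (hs ⟨(x, t.1), t.2⟩) y (hW hy)
      filter_upwards [(hopen _).1 h ⟨(y, s ⟨(x, t.1), t.2⟩ y), hR⟩ ⟨hy, hW hy, rfl⟩,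
        (hVo y).mem_nhds (hxV y)] with y' hy' hyV
      exact (hy' ⟨(y', _), mem (hs ⟨(y, s ⟨(x, t.1), t.2⟩ y), hR⟩) y' hyV⟩ rfl).1
    · intro t w hw w' hw' hww'
      have h1 : w.1.1 = w'.1.1 := hww'
      exact Subtype.ext (Prod.ext h1 (by rw [hw.2, hw'.2, h1]))
    · intro t y hy
      exact ⟨⟨(y, s ⟨(x, t.1), t.2⟩ y), mem (hs ⟨(x, t.1), t.2⟩) y hy⟩, ⟨hy, rfl⟩, rfl⟩
    · intro t t' htt'
      refine Set.disjoint_left.2 fun w hw hw' => htt' (Subtype.ext ?_)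
      have h1 := unique (hVo x) (hVc x) (hs ⟨(x, t.1), t.2⟩) (hs ⟨(x, t'.1), t'.2⟩) w.1.1 hw.1
        (hw.2.symm.trans hw'.2) (hxV x)
      exact (hst ⟨(x, t.1), t.2⟩).symm.trans (h1.trans (hst ⟨(x, t'.1), t'.2⟩))
    · intro w hw
      -- The sheets exhaust the preimage of V x: the section through w extends over all of V x, and
      -- its value at x names the sheet.
      obtain ⟨r, hr, hrw⟩ := hV x w.1.1 hw w.1.2 w.2
      have hRx := mem hr x (hxV x)
      refine Set.mem_iUnion.2 ⟨⟨r x, hRx⟩, hw, ?_⟩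
      rw [← hrw]
      exact unique (hVo x) (hVc x) hr (hs ⟨(x, r x), hRx⟩) x (hxV x) (hst ⟨(x, r x), hRx⟩).symm hw
  obtain ⟨x₀⟩ : Nonempty B := inferInstance
  obtain ⟨t₀, ht₀⟩ := nonempty x₀
  -- Simple connectedness enters here: the identity of B lifts to the covering.
  obtain ⟨G, ⟨-, hG⟩, -⟩ := hcov.existsUnique_continuousMap_lifts (ContinuousMap.id B) x₀
    (⟨(x₀, t₀), ht₀⟩ : Z) rfl
  have hG' : ∀ x, (G x).1.1 = x := fun x => congrFun hG x
  refine ⟨fun x => (G x).1.2, fun x => ?_⟩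
  have hRx : R x (G x).1.2 := by
    have := (G x).2
    rwa [hG'] at this
  have hop := (hsheet x ⟨_, hRx⟩ (V x) subset_rfl (hVo x)).preimage G.continuous
  refine ⟨_, hop, ⟨?_, ?_, ?_⟩, s ⟨(x, (G x).1.2), hRx⟩, mono ?_ (hs ⟨(x, (G x).1.2), hRx⟩), ?_⟩
  · change (G x).1.1 ∈ V x
    rw [hG']
    exact hxV x
  · rw [hG']
    exact hxV x
  · rw [hG']
    exact (hst ⟨(x, (G x).1.2), hRx⟩).symm
  · rintro y ⟨hy, -⟩
    have : (G y).1.1 ∈ V x := hy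
    rwa [hG'] at this
  · rintro y ⟨-, -, hy⟩
    have : (G y).1.2 = s ⟨(x, (G x).1.2), hRx⟩ (G y).1.1 := hy
    rwa [hG'] at this

variable {E : Type*} [NormedAddCommGroup E] [NormedSpace ℝ E]
  {Q : Type*} [TopologicalSpace Q] [ChartedSpace E Q] [IsManifold 𝓘(ℝ, E) ∞ Q] [FiniteDimensional ℝ E]
  {F : Type*} [NormedAddCommGroup F] [NormedSpace ℝ F] [FiniteDimensional ℝ F]
  {X : Type*} [TopologicalSpace X] [ChartedSpace F X] [IsManifold 𝓘(ℝ, F) ∞ X] [T2Space X]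
  {L : LagrangianTorusFibration E F Q X} {P₁ P₂ : Opens Q}

theorem LagrangianTorusFibration.LocalTrivialisation.exists_shift (τ₁ : L.LocalTrivialisation P₁)
    (τ₂ : L.LocalTrivialisation P₂) {x : Q} (h₁ : x ∈ P₁) (h₂ : x ∈ P₂) :
    ∃ ξ : CotangentSpace E x, τ₁.toFun ⟨x, 0⟩ = τ₂.toFun ⟨x, ξ⟩ := by
  have hp := τ₁.proj_comp ⟨x, 0⟩ h₁
  obtain ⟨⟨y, ξ⟩, hy, hyx⟩ := τ₂.surjective (τ₁.toFun ⟨x, 0⟩) (by rw [hp]; exact h₂)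
  have h3 := τ₂.proj_comp ⟨y, ξ⟩ hy
  rw [hyx, hp] at h3
  obtain rfl : x = y := h3
  exact ⟨ξ, hyx.symm⟩

/-- Over a simply connected open set two trivialisations differ by a globally defined function. -/
theorem exists_isTransition [T2Space Q] [CompactSpace X] (τ₁ : L.LocalTrivialisation P₁)
    (τ₂ : L.LocalTrivialisation P₂) (P : Opens Q) (hP₁ : P ≤ P₁) (hP₂ : P ≤ P₂)
    [SimplyConnectedSpace P] : ∃ h : Q → ℝ, IsTransition τ₁ τ₂ (P : Set Q) h := by
  have : LocallyPathConnectedSpace Q := ChartedSpace.locallyPathConnectedSpace E Q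
  have : LocallyPathConnectedSpace P := P.isOpen.locallyPathConnectedSpace
  have hemb := P.isOpen.isOpenEmbedding_subtypeVal
  -- The sections are 1-jets (h, dh). Values alone would not give unique continuation, because
  -- transition functions may differ by integral affine functions.
  obtain ⟨σ, hσ⟩ := exists_global_section (B := P) (T := ℝ × (E →L[ℝ] ℝ))
    (fun x t => τ₁.toFun ⟨x, 0⟩ = τ₂.toFun ⟨x, (t.2 : CotangentSpace E (x : Q))⟩)
    (fun V s => ∃ h, IsTransition τ₁ τ₂ (Subtype.val '' V) h ∧
      ∀ x ∈ V, s x = (h x, (dd h (x : Q) : CotangentSpace E (x : Q))))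
    (fun hVW ⟨h, hh, hs⟩ => ⟨h, hh.mono (Set.image_mono hVW), fun x hx => hs x (hVW hx)⟩)
    (by
      rintro V s ⟨h, hh, hs⟩ x hx
      have := hh.2 x ⟨x, hx, rfl⟩ 0
      rw [zero_add] at this
      rw [hs x hx]
      exact this)
    (by
      rintro V s s' hVo hVc ⟨h, hh, hs⟩ ⟨h', hh', hs'⟩ x hx hxs y hy
      have hVo' := hemb.isOpenMap V hVo
      rw [hs x hx, hs' x hx] at hxs
      have e := hh.eqOn hh' hVo' (hVc.image _ continuous_subtype_val.continuousOn)
        (by rintro _ ⟨z, -, rfl⟩; exact hP₂ z.2) ⟨x, hx, rfl⟩ (congrArg Prod.fst hxs)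
        (congrArg Prod.snd hxs)
      have hyV : (y : Q) ∈ Subtype.val '' V := ⟨y, hy, rfl⟩
      rw [hs y hy, hs' y hy]
      exact Prod.ext (e hyV) (dd_congr (e.eventuallyEq_of_mem (hVo'.mem_nhds hyV))))
    (by
      intro x
      obtain ⟨U, hxU, hUP, hUc, hU⟩ := exists_isTransition_jet (τ₁ := τ₁) (τ₂ := τ₂) (hP₁ x.2)
        (hP₂ x.2) x.2
      have hUr : (U : Set Q) ⊆ Set.range (Subtype.val : P → Q) := fun y hy => ⟨⟨y, hUP hy⟩, rfl⟩
      have himg : Subtype.val '' (Subtype.val ⁻¹' (U : Set Q) : Set P) = U :=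
        Set.image_preimage_eq_of_subset hUr
      refine ⟨Subtype.val ⁻¹' (U : Set Q), U.isOpen.preimage continuous_subtype_val, hxU,
        hUc.preimage_of_isOpenMap Subtype.val_injective hemb.isOpenMap hUr, ?_⟩
      rintro y hy ⟨c, ξ⟩ hR
      obtain ⟨h, hh, rfl, hξ⟩ := hU y hy c ξ hR
      refine ⟨fun x => (h x, (dd h (x : Q) : CotangentSpace E (x : Q))), ⟨h, himg.symm ▸ hh,
        fun _ _ => rfl⟩, Prod.ext rfl hξ⟩)
    (fun x => by
      obtain ⟨ξ, hξ⟩ := τ₁.exists_shift τ₂ (hP₁ x.2) (hP₂ x.2)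
      exact ⟨(0, ξ), hξ⟩)
  let g : P → ℝ := fun x => (σ x).1
  have hloc : ∀ x : P, ∃ W : Opens Q, (x : Q) ∈ W ∧ ∃ h, IsTransition τ₁ τ₂ (W : Set Q) h ∧
      Set.EqOn (zeroExt g) h W := by
    intro x
    obtain ⟨V, hVo, hxV, s, ⟨h, hh, hs⟩, hσs⟩ := hσ x
    refine ⟨⟨_, hemb.isOpenMap V hVo⟩, ⟨x, hxV, rfl⟩, h, hh, ?_⟩
    rintro _ ⟨y, hy, rfl⟩
    rw [zeroExt_apply]
    change (σ y).1 = _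
    rw [hσs hy, hs y hy]
  refine ⟨zeroExt g, fun x hx => ?_, fun x hx ξ => ?_⟩
  · obtain ⟨W, hxW, h, hh, hgh⟩ := hloc ⟨x, hx⟩
    exact ((hh.1.contMDiffAt (W.isOpen.mem_nhds hxW)).congr_of_eventuallyEq
      (hgh.eventuallyEq_of_mem (W.isOpen.mem_nhds hxW))).contMDiffWithinAt
  · obtain ⟨W, hxW, h, hh, hgh⟩ := hloc ⟨x, hx⟩
    rw [dd_congr (hgh.eventuallyEq_of_mem (W.isOpen.mem_nhds hxW))]
    exact hh.2 x hxW ξ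

end Monodromy

/-! ### Integral affine charts -/

section AffineCharts

variable {E : Type*} [NormedAddCommGroup E] [NormedSpace ℝ E] [FiniteDimensional ℝ E]
  {F : Type*} [NormedAddCommGroup F] [NormedSpace ℝ F] [FiniteDimensional ℝ F]
  {Q : Type*} [TopologicalSpace Q] [ChartedSpace E Q] [IsManifold 𝓘(ℝ, E) ∞ Q]
  {X : Type*} [TopologicalSpace X] [ChartedSpace F X] [IsManifold 𝓘(ℝ, F) ∞ X] [T2Space X]

/-- If G did not span, a nonzero linear functional would vanish on it. Each vector is within R of G,
so the functional would be bounded on V, which is absurd. A discrete spanning subgroup has an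
integral basis of the right rank. -/
theorem AddSubgroup.exists_basis_of_discrete_of_cobounded {V : Type*} [NormedAddCommGroup V]
    [NormedSpace ℝ V] [FiniteDimensional ℝ V] {n : ℕ} (hn : Module.finrank ℝ V = n)
    (G : AddSubgroup V) {δ R : ℝ} (hδ : 0 < δ) (hG : ∀ v ∈ G, ‖v‖ < δ → v = 0)
    (hR : ∀ v, ∃ g ∈ G, ‖v - g‖ ≤ R) :
    ∃ b : Module.Basis (Fin n) ℝ V, (∀ i, b i ∈ G) ∧
      ∀ v ∈ G, ∃ c : Fin n → ℤ, v = ∑ i, (c i : ℝ) • b i := by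
  let M : Submodule ℤ V := AddSubgroup.toIntSubmodule G
  have hM : ∀ v, v ∈ M ↔ v ∈ G := fun v => Iff.rfl
  have hdisc : DiscreteTopology M := by
    refine discreteTopology_of_isOpen_singleton_zero (Metric.isOpen_iff.2 ?_)
    rintro x rfl
    refine ⟨δ, hδ, fun y hy => ?_⟩
    have : ‖(y : V)‖ < δ := by simpa using hy
    exact Subtype.ext (hG y y.2 this)
  have hspan : Submodule.span ℝ (M : Set V) = ⊤ := by
    by_contra hne
    obtain ⟨v, -, hv⟩ := SetLike.exists_of_lt (lt_top_iff_ne_top.2 hne)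
    obtain ⟨f, hfv, hf⟩ := Submodule.exists_le_ker_of_notMem hv
    let f' : V →L[ℝ] ℝ := LinearMap.toContinuousLinearMap f
    have hbound : ∀ t : ℝ, |t * f v| ≤ ‖f'‖ * R := fun t => by
      obtain ⟨g, hg, hgR⟩ := hR (t • v)
      have h1 : f g = 0 := hf (Submodule.subset_span hg)
      have h2 := (f'.le_opNorm (t • v - g)).trans
        (mul_le_mul_of_nonneg_left hgR (norm_nonneg _))
      have h3 : f' (t • v - g) = t * f v := by
        change f (t • v - g) = _
        rw [map_sub, h1, sub_zero, map_smul, smul_eq_mul]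
      rwa [h3] at h2
    have := hbound ((‖f'‖ * R + 1) / f v)
    rw [div_mul_cancel₀ _ hfv] at this
    linarith [le_abs_self (‖f'‖ * R + 1)]
  have : IsZLattice ℝ M := ⟨hspan⟩
  let b₀ := Module.finBasisOfFinrankEq ℤ M ((ZLattice.rank ℝ M).trans hn)
  refine ⟨b₀.ofZLatticeBasis ℝ M, fun i => ?_, fun v hv => ⟨b₀.repr ⟨v, hv⟩, ?_⟩⟩
  · rw [Module.Basis.ofZLatticeBasis_apply]
    exact (b₀ i).2
  · have h1 := (b₀.ofZLatticeBasis ℝ M).sum_repr v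
    have h2 := fun i => b₀.ofZLatticeBasis_repr_apply ℝ M ⟨v, hv⟩ i
    simp only [h2] at h1
    exact h1.symm

theorem finrank_clm_real {n : ℕ} (hn : Module.finrank ℝ E = n) :
    Module.finrank ℝ (E →L[ℝ] ℝ) = n := by
  rw [← (LinearMap.toContinuousLinearMap (𝕜 := ℝ) (E := E) (F' := ℝ)).finrank_eq,
    Subspace.dual_finrank_eq, hn]

/-- A basis of the lattice at a point. -/
theorem LagrangianTorusFibration.exists_lattice_basis [T2Space Q] [CompactSpace X]
    (L : LagrangianTorusFibration E F Q X) (q : Q) {n : ℕ} (hn : Module.finrank ℝ E = n) :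
    ∃ b : Module.Basis (Fin n) ℝ (E →L[ℝ] ℝ),
      (∀ i, covector q (extChartAt 𝓘(ℝ, E) q q) (b i) ∈ L.periodLattice _) ∧
      ∀ η, covector q (extChartAt 𝓘(ℝ, E) q q) η ∈ L.periodLattice _ →
        ∃ c : Fin n → ℤ, η = ∑ i, (c i : ℝ) • b i := by
  obtain ⟨r, hr, S, hrt, hS, hsurj⟩ := L.exists_section (q₀ := q) (mem_extChartAt_target q)
  obtain ⟨R, hR, hRs⟩ := exists_uniform_surjective hr hS hsurj
  have h0 : extChartAt 𝓘(ℝ, E) q q ∈ Metric.ball (extChartAt 𝓘(ℝ, E) q q) r :=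
    Metric.mem_ball_self hr
  have hmem : ∀ η η', S (extChartAt 𝓘(ℝ, E) q q, η) = S (extChartAt 𝓘(ℝ, E) q q, η') ↔
      covector q (extChartAt 𝓘(ℝ, E) q q) (η - η') ∈ L.periodLattice _ :=
    mem_periodLattice_iff (hS _ h0) (hsurj _ h0)
  obtain ⟨e, hze, -, hes, -⟩ := (hS _ h0 0).exists_openPartialHomeomorph Filter.univ_mem
  obtain ⟨δ, hδ, hball⟩ := Metric.isOpen_iff.1 e.open_source _ hze
  exact AddSubgroup.exists_basis_of_discrete_of_cobounded (finrank_clm_real hn)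
    ((L.periodLattice _).comap (covector q (extChartAt 𝓘(ℝ, E) q q))) hδ
    (fun η hη hηδ => by
      have h1 : S (extChartAt 𝓘(ℝ, E) q q, η) = S (extChartAt 𝓘(ℝ, E) q q, 0) :=
        (hmem η 0).2 (by rw [sub_zero]; exact hη)
      have m1 : ((extChartAt 𝓘(ℝ, E) q q, η) : E × (E →L[ℝ] ℝ)) ∈ e.source := hball (by
        rw [← ball_prod_same]
        exact ⟨Metric.mem_ball_self hδ, by simpa using hηδ⟩)
      exact congrArg Prod.snd (e.injOn m1 hze ((hes _ m1).trans (h1.trans (hes _ hze).symm))))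
    (fun η => by
      obtain ⟨η', hη', h⟩ := hRs _ (Metric.mem_ball_self (half_pos hr)) _ (hS _ h0 η).proj_eq
      exact ⟨η - η', (hmem η η').1 h.symm, by simpa using hη'⟩)

theorem mdifferentiableAt_sum {ι : Type*} (s : Finset ι) {a : ι → Q → ℝ} {x : Q} (c : ι → ℝ)
    (ha : ∀ i, MDifferentiableAt 𝓘(ℝ, E) 𝓘(ℝ, ℝ) (a i) x) :
    MDifferentiableAt 𝓘(ℝ, E) 𝓘(ℝ, ℝ) (fun y => ∑ i ∈ s, c i * a i y) x ∧
    (dd (fun y => ∑ i ∈ s, c i * a i y) x : CotangentSpace E x) = ∑ i ∈ s, c i • dd (a i) x := by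
  classical
  induction s using Finset.induction_on with
  | empty =>
    simp only [Finset.sum_empty]
    exact ⟨mdifferentiableAt_const, mfderiv_const⟩
  | insert i s hi ih =>
    simp only [Finset.sum_insert hi]
    have h1 : MDifferentiableAt 𝓘(ℝ, E) 𝓘(ℝ, ℝ) (fun y => c i * a i y) x := (ha i).const_smul (c i)
    have h2 : (dd (fun y => c i * a i y) x : CotangentSpace E x) = c i • dd (a i) x :=
      const_smul_mfderiv (ha i) (c i)
    exact ⟨h1.add ih.1, (dd_add h1 ih.1).trans (by rw [h2, ih.2])⟩

theorem IsAffOn.sum {Λ : LatticeField E Q} {U : Set Q} (hU : IsOpen U) {ι : Type*} [Fintype ι]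
    {a : ι → Q → ℝ} (ha : ∀ i, IsAffOn Λ U (a i)) (c : ι → ℤ) :
    IsAffOn Λ U (fun y => ∑ i, (c i : ℝ) * a i y) := by
  refine ⟨contMDiffOn_finsetSum fun i _ => contMDiffOn_const.mul (ha i).1, fun x hx => ?_⟩
  rw [(mdifferentiableAt_sum Finset.univ (fun i => (c i : ℝ)) fun i =>
    mdifferentiableAt_of_contMDiffOn (ha i).1 hU hx).2]
  refine AddSubgroup.sum_mem _ fun i _ => ?_
  rw [Int.cast_smul_eq_zsmul ℝ (c i) (dd (a i) x)]
  exact AddSubgroup.zsmul_mem _ ((ha i).2 x hx) _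

theorem IsAffOn.sub {Λ : LatticeField E Q} {U : Set Q} (hU : IsOpen U) {a b : Q → ℝ}
    (ha : IsAffOn Λ U a) (hb : IsAffOn Λ U b) : IsAffOn Λ U (a - b) := by
  refine ⟨ha.1.sub hb.1, fun x hx => ?_⟩
  rw [dd_sub (mdifferentiableAt_of_contMDiffOn ha.1 hU hx)
    (mdifferentiableAt_of_contMDiffOn hb.1 hU hx)]
  exact sub_mem (ha.2 x hx) (hb.2 x hx)

/-- Integral affine charts: their coordinates are integral affine functions, the differentials of
which generate the lattice at every point. -/
theorem LagrangianTorusFibration.exists_affine_chart [T2Space Q] [CompactSpace X]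
    (L : LagrangianTorusFibration E F Q X) (q : Q) {n : ℕ} (hn : Module.finrank ℝ E = n)
    {N : Opens Q} (hN : q ∈ N) :
    ∃ ψ : OpenPartialHomeomorph Q (Fin n → ℝ), q ∈ ψ.source ∧ (∀ x ∈ ψ.source, x ∈ N) ∧
      (∀ i, IsAffOn L.periodLattice ψ.source fun x => ψ x i) ∧
      ∀ x ∈ ψ.source, ∀ ξ ∈ L.periodLattice x, ∃ c : Fin n → ℤ,
        ξ = ∑ i, (c i : ℝ) • dd (fun x => ψ x i) x := by
  obtain ⟨ρ, hρ, hρt, hext⟩ := L.exists_affine_extension q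
  obtain ⟨b, hb, hgen⟩ := L.exists_lattice_basis q hn
  set y₀ := extChartAt 𝓘(ℝ, E) q q with hy₀
  have ht : y₀ ∈ (extChartAt 𝓘(ℝ, E) q).target := mem_extChartAt_target q
  have hq : (extChartAt 𝓘(ℝ, E) q).symm y₀ = q := extChartAt_to_inv q
  set x₀ := (extChartAt 𝓘(ℝ, E) q).symm y₀ with hx₀
  set B := chartBall (E := E) q ρ with hB
  have hx₀B : x₀ ∈ B := by
    rw [hq]
    exact mem_chartBall_self q hρ
  choose a ha hax using fun i => hext x₀ hx₀B _ (hb i)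
  have hda : ∀ i, ∀ x ∈ B, MDifferentiableAt 𝓘(ℝ, E) 𝓘(ℝ, ℝ) (a i) x := fun i x hx =>
    mdifferentiableAt_of_contMDiffOn (ha i).1 B.isOpen hx
  have hcd : ∀ i, ContMDiffAt 𝓘(ℝ, E) 𝓘(ℝ, ℝ) ∞ (a i) x₀ := fun i =>
    (ha i).1.contMDiffAt (B.isOpen.mem_nhds hx₀B)
  have hfd : ∀ i, fderiv ℝ (a i ∘ (extChartAt 𝓘(ℝ, E) q).symm) y₀ = b i := fun i =>
    covector_injective ht ((dd_eq_covector_self ht (hcd i)).symm.trans (hax i))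
  -- Extend ξ to an integral affine function and expand its differential at x₀ in the basis. The
  -- difference from the integer combination of the a_i is integral affine with zero differential at
  -- x₀, hence has zero differential on the connected ball.
  have hgenB : ∀ x ∈ B, ∀ ξ ∈ L.periodLattice x, ∃ c : Fin n → ℤ,
      ξ = ∑ i, (c i : ℝ) • dd (a i) x := by
    intro x hx ξ hξ
    obtain ⟨f, hf, rfl⟩ := hext x hx ξ hξ
    obtain ⟨η, hη⟩ := exists_covector ht (dd f x₀)
    obtain ⟨c, rfl⟩ := hgen η (hη ▸ hf.2 x₀ hx₀B)
    have hs := IsAffOn.sum B.isOpen ha c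
    have hd := IsAffOn.sub B.isOpen hf hs
    have hs' := fun x hx => mdifferentiableAt_sum Finset.univ (fun i => (c i : ℝ))
      fun i => hda i x hx
    have hz : dd (f - fun y => ∑ i, (c i : ℝ) * a i y) x₀ = (0 : CotangentSpace E x₀) := by
      rw [dd_sub (mdifferentiableAt_of_contMDiffOn hf.1 B.isOpen hx₀B) (hs' x₀ hx₀B).1,
        (hs' x₀ hx₀B).2, ← hη, map_sum, sub_eq_zero]
      refine Finset.sum_congr rfl fun i _ => ?_
      rw [hax i]
      rfl
    have := hd.dd_eq_zero B.isOpen (isPreconnected_chartBall q hρt) hx₀B hz hx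
    rw [dd_sub (mdifferentiableAt_of_contMDiffOn hf.1 B.isOpen hx) (hs' x hx).1,
      (hs' x hx).2, sub_eq_zero] at this
    exact ⟨c, this⟩
  have : CompleteSpace E := FiniteDimensional.complete ℝ E
  let G : E → Fin n → ℝ := fun y i => a i ((extChartAt 𝓘(ℝ, E) q).symm y)
  let A : E →L[ℝ] (Fin n → ℝ) := ContinuousLinearMap.pi fun i => b i
  have hAinj : Function.Injective A := by
    refine (injective_iff_map_eq_zero A).2 fun v hv => ?_
    have h1 : ∀ i, b i v = 0 := fun i => congrFun hv i
    by_contra hne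
    -- A norming functional for v is a combination of the b_i, all of which vanish on v.
    obtain ⟨g, -, hg⟩ := exists_dual_vector ℝ v (norm_ne_zero_iff.2 hne)
    have h2 := congrArg (fun l : E →L[ℝ] ℝ => l v) (b.sum_repr g)
    simp only [FunLike.coe_sum, Finset.sum_apply, FunLike.coe_smul,
      Pi.smul_apply, h1, smul_zero, Finset.sum_const_zero] at h2
    rw [hg] at h2
    exact hne (norm_eq_zero.1 (by simpa using h2.symm))
  let e' : E ≃L[ℝ] (Fin n → ℝ) :=
    (LinearMap.linearEquivOfInjective A.toLinearMap hAinj (by simp [hn])).toContinuousLinearEquiv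
  have hGd : ContDiffAt ℝ ∞ G y₀ := contDiffAt_pi.2 fun i => contDiffAt_comp_chart_symm ht (hcd i)
  have hG : HasFDerivAt G (e' : E →L[ℝ] (Fin n → ℝ)) y₀ := by
    have : (e' : E →L[ℝ] (Fin n → ℝ)) = A := by ext; rfl
    rw [this]
    refine hasFDerivAt_pi.2 fun i => ?_
    rw [← hfd i]
    exact ((contDiffAt_comp_chart_symm ht (hcd i)).differentiableAt (by simp)).hasFDerivAt
  let e := hGd.toOpenPartialHomeomorph G hG (by simp)
  let ψ := ((chartAt E q).trans e).restrOpen (B ⊓ N : Opens Q) (B ⊓ N).isOpen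
  have hψs : ∀ x ∈ ψ.source, x ∈ (chartAt E q).source ∧ x ∈ B ∧ x ∈ N := fun x hx => by
    have : x ∈ ((chartAt E q).trans e).source ∩ (B ⊓ N : Opens Q) := hx
    exact ⟨this.1.1, this.2⟩
  have hψ : ∀ i, Set.EqOn (fun x => ψ x i) (a i) ψ.source := fun i x hx => by
    have h1 := (chartAt E q).left_inv (hψs x hx).1
    change a i ((extChartAt 𝓘(ℝ, E) q).symm (chartAt E q x)) = a i x
    refine congrArg (a i) ?_
    simpa using h1
  have hψd : ∀ i, ∀ x ∈ ψ.source, (dd (fun x => ψ x i) x : CotangentSpace E x) = dd (a i) x :=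
    fun i x hx => dd_congr ((hψ i).eventuallyEq_of_mem (ψ.open_source.mem_nhds hx))
  refine ⟨ψ, ⟨⟨mem_chart_source E q, ?_⟩, by rw [← hq]; exact hx₀B, hN⟩, fun x hx => (hψs x hx).2.2,
    fun i => ⟨((ha i).1.mono fun x hx => (hψs x hx).2.1).congr (hψ i), fun x hx => ?_⟩,
    fun x hx ξ hξ => ?_⟩
  · have : y₀ ∈ e.source := hGd.mem_toOpenPartialHomeomorph_source hG (by simp)
    exact this
  · rw [hψd i x hx]
    exact (ha i).2 x (hψs x hx).2.1
  · obtain ⟨c, hc⟩ := hgenB x (hψs x hx).2.1 ξ hξ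
    refine ⟨c, hc.trans (Finset.sum_congr rfl fun i _ => ?_)⟩
    rw [hψd i x hx]

/-- Changes of integral affine charts are affine over connected sets. -/
theorem exists_affineMap_of_affine_charts [T2Space Q] [CompactSpace X]
    {L : LagrangianTorusFibration E F Q X} {n : ℕ} {ψ ψ' : OpenPartialHomeomorph Q (Fin n → ℝ)}
    (hψ : ∀ i, IsAffOn L.periodLattice ψ.source fun x => ψ x i)
    (hgen : ∀ x ∈ ψ.source, ∀ ξ ∈ L.periodLattice x, ∃ c : Fin n → ℤ,
        ξ = ∑ i, (c i : ℝ) • dd (fun x => ψ x i) x)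
    (hψ' : ∀ i, IsAffOn L.periodLattice ψ'.source fun x => ψ' x i) {W : Set Q} (hW : IsOpen W)
    (hWc : IsPreconnected W) (hWs : W ⊆ ψ.source) (hWs' : W ⊆ ψ'.source) :
    ∃ T : (Fin n → ℝ) →ᵃ[ℝ] (Fin n → ℝ), Set.EqOn ψ' (T ∘ ψ) W := by
  rcases W.eq_empty_or_nonempty with rfl | ⟨x₀, hx₀⟩
  · exact ⟨AffineMap.id ℝ _, Set.eqOn_empty _ _⟩
  -- The integer coefficients found at one point remain valid over the connected set, so each
  -- coordinate differs from a linear combination by a constant.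
  choose c hc using fun j => hgen x₀ (hWs hx₀) _ ((hψ' j).2 x₀ (hWs' hx₀))
  have hψW : ∀ i, IsAffOn L.periodLattice W fun x => ψ x i := fun i =>
    ⟨(hψ i).1.mono hWs, fun x hx => (hψ i).2 x (hWs hx)⟩
  have hψW' : ∀ i, IsAffOn L.periodLattice W fun x => ψ' x i := fun i =>
    ⟨(hψ' i).1.mono hWs', fun x hx => (hψ' i).2 x (hWs' hx)⟩
  have hd := fun j => IsAffOn.sub hW (hψW' j) (IsAffOn.sum hW hψW (c j))
  have hs := fun j => mdifferentiableAt_sum (E := E) (x := x₀) Finset.univ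
    (a := fun i x => ψ x i) (fun i => (c j i : ℝ)) fun i =>
      mdifferentiableAt_of_contMDiffOn (hψW i).1 hW hx₀
  have hz : ∀ j, dd ((fun x => ψ' x j) - fun y => ∑ i, (c j i : ℝ) * ψ y i) x₀ =
      (0 : CotangentSpace E x₀) := fun j => by
    rw [dd_sub (mdifferentiableAt_of_contMDiffOn (hψW' j).1 hW hx₀) (hs j).1, (hs j).2, hc j,
      sub_self]
  have hconst : ∀ j, ∀ x ∈ W, ψ' x j - ∑ i, (c j i : ℝ) * ψ x i =
      ψ' x₀ j - ∑ i, (c j i : ℝ) * ψ x₀ i := fun j x hx =>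
    eq_of_dd_eq_zero hW hWc (hd j).1 (fun y hy => (hd j).dd_eq_zero hW hWc hx₀ (hz j) hy) hx₀ hx
  let M : (Fin n → ℝ) →ₗ[ℝ] (Fin n → ℝ) := Matrix.toLin' (Matrix.of fun j i => (c j i : ℝ))
  refine ⟨M.toAffineMap + AffineMap.const ℝ _
    (fun j => ψ' x₀ j - ∑ i, (c j i : ℝ) * ψ x₀ i), fun x hx => funext fun j => ?_⟩
  have : M (ψ x) j = ∑ i, (c j i : ℝ) * ψ x i := by
    simp [M, Matrix.mulVec, dotProduct]
  change _ = M (ψ x) j + (ψ' x₀ j - ∑ i, (c j i : ℝ) * ψ x₀ i)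
  rw [this, ← hconst j x hx]
  ring

end AffineCharts

/-! ### Good covers -/

section GoodCover

/-- A compact metrizable space with charts, the changes of which are affine over connected sets,
has good covers. -/
theorem exists_isGoodCover {Q V : Type*} [TopologicalSpace Q] [CompactSpace Q] [MetrizableSpace Q]
    [NormedAddCommGroup V] [NormedSpace ℝ V] (ψ : Q → OpenPartialHomeomorph Q V)
    (hψ : ∀ q, q ∈ (ψ q).source)
    (haff : ∀ q q' (W : Set Q), IsOpen W → IsPreconnected W → W ⊆ (ψ q).source →
      W ⊆ (ψ q').source → ∃ T : V →ᵃ[ℝ] V, Set.EqOn (ψ q') (T ∘ ψ q) W) :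
    ∃ (m : ℕ) (P : Fin m → Opens Q), IsGoodCover P ∧ ∀ i, ∃ q, (P i : Set Q) ⊆ (ψ q).source := by
  let _ := metrizableSpaceMetric Q
  -- A Lebesgue number for the chart domains: around every q one chart, indexed by c(q), contains
  -- the whole δ-ball.
  obtain ⟨δ, hδ, hL⟩ := lebesgue_number_lemma_of_metric (isCompact_univ (X := Q))
    (fun q => (ψ q).open_source) fun q _ => Set.mem_iUnion.2 ⟨q, hψ q⟩
  choose c hc using fun q => hL q (Set.mem_univ q)
  have hcq : ∀ q, q ∈ (ψ (c q)).source := fun q => hc q (Metric.mem_ball_self hδ)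
  have hr : ∀ q, ∃ r > 0, ∀ v ∈ Metric.ball (ψ (c q) q) r, v ∈ (ψ (c q)).target ∧
      (ψ (c q)).symm v ∈ Metric.ball q (δ / 4) := by
    intro q
    have ht := (ψ (c q)).map_source (hcq q)
    have hcont := ((ψ (c q)).continuousOn_symm.continuousAt
      ((ψ (c q)).open_target.mem_nhds ht)).preimage_mem_nhds (t := Metric.ball q (δ / 4)) (by
        rw [(ψ (c q)).left_inv (hcq q)]
        exact Metric.ball_mem_nhds _ (by positivity))
    obtain ⟨r, hr, h⟩ := Metric.mem_nhds_iff.1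
      (Filter.inter_mem ((ψ (c q)).open_target.mem_nhds ht) hcont)
    exact ⟨r, hr, fun v hv => h hv⟩
  choose r hr0 hr using hr
  let B : Q → Opens Q := fun q => ⟨(ψ (c q)).source ∩ ψ (c q) ⁻¹' Metric.ball (ψ (c q) q) (r q),
    (ψ (c q)).isOpen_inter_preimage Metric.isOpen_ball⟩
  have hB : ∀ q, (B q : Set Q) = (ψ (c q)).symm '' Metric.ball (ψ (c q) q) (r q) := fun q =>
    ((ψ (c q)).symm_image_eq_source_inter_preimage fun v hv => (hr q v hv).1).symm
  have hBc : ∀ q, IsPreconnected (B q : Set Q) := fun q => by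
    rw [hB]
    exact (convex_ball _ _).isPreconnected.image _
      ((ψ (c q)).continuousOn_symm.mono fun v hv => (hr q v hv).1)
  have hBδ : ∀ q, (B q : Set Q) ⊆ Metric.ball q (δ / 4) := fun q x hx => by
    have := (hr q _ hx.2).2
    rwa [(ψ (c q)).left_inv hx.1] at this
  have hqB : ∀ q, q ∈ B q := fun q => ⟨hcq q, Metric.mem_ball_self (hr0 q)⟩
  -- Each B q lies in the ball of radius δ/4 about q, so a set meeting B q stays within 3δ/4 of q.
  have hsub : ∀ q q', ((B q : Set Q) ∩ B q').Nonempty → (B q' : Set Q) ⊆ (ψ (c q)).source := by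
    rintro q q' ⟨y, hy, hy'⟩ x hx
    refine hc q ?_
    have h1 := Metric.mem_ball.1 (hBδ q hy)
    have h2 := Metric.mem_ball.1 (hBδ q' hy')
    have h3 := Metric.mem_ball.1 (hBδ q' hx)
    rw [Metric.mem_ball]
    have h4 := dist_triangle x q' q
    have h5 := dist_triangle q' y q
    rw [dist_comm q' y] at h5
    linarith
  -- In a neighbouring chart a chart ball is the affine image of a ball. Hence in one chart all sets
  -- with a common point are convex, and so is their intersection.
  have hconv : ∀ q q', ((B q : Set Q) ∩ B q').Nonempty → Convex ℝ (ψ (c q) '' B q') := by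
    intro q q' h
    obtain ⟨T, hT⟩ := haff (c q') (c q) (B q') (B q').isOpen (hBc q') (fun x hx => hx.1)
      (hsub q q' h)
    have h1 : ψ (c q') '' B q' = Metric.ball (ψ (c q') q') (r q') := by
      rw [hB, ← Set.image_comp]
      refine Set.EqOn.image_eq_self fun v hv => (ψ (c q')).right_inv (hr q' v hv).1
    rw [hT.image_eq, Set.image_comp, h1]
    exact (convex_ball _ _).affine_image T
  obtain ⟨t, ht⟩ := (isCompact_univ (X := Q)).elim_finite_subcover (fun q => (B q : Set Q))
    (fun q => (B q).isOpen) fun q _ => Set.mem_iUnion.2 ⟨q, hqB q⟩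
  let e := t.equivFin
  let P : Fin t.card → Opens Q := fun i => B (e.symm i)
  refine ⟨t.card, P, ⟨fun q => ?_, fun s hs hne => ?_⟩, fun i => ⟨_, fun x hx => hx.1⟩⟩
  · obtain ⟨q', hq', hq⟩ := Set.mem_iUnion₂.1 (ht (Set.mem_univ q))
    exact ⟨e ⟨q', hq'⟩, by simpa [P] using hq⟩
  · obtain ⟨i₀, hi₀⟩ := hs
    obtain ⟨y, hy⟩ := hne
    have hyi := Set.mem_iInter₂.1 hy
    have hni : ∀ i ∈ s, ((P i₀ : Set Q) ∩ P i).Nonempty := fun i hi => ⟨y, hyi i₀ hi₀, hyi i hi⟩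
    let φ := ψ (c (e.symm i₀ : Q))
    have hs0 : ∀ i ∈ s, (P i : Set Q) ⊆ φ.source := fun i hi => hsub _ _ (hni i hi)
    have hS : (⋂ i ∈ s, (P i : Set Q)) ⊆ φ.source := fun x hx =>
      hs0 i₀ hi₀ (Set.mem_iInter₂.1 hx i₀ hi₀)
    have himg : φ '' (⋂ i ∈ s, (P i : Set Q)) = ⋂ i ∈ s, φ '' P i := by
      refine subset_antisymm (Set.image_iInter₂_subset _ _) fun v hv => ?_
      have hv' := Set.mem_iInter₂.1 hv
      obtain ⟨x, hx, rfl⟩ := hv' i₀ hi₀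
      refine ⟨x, Set.mem_iInter₂.2 fun i hi => ?_, rfl⟩
      obtain ⟨x', hx', hxx'⟩ := hv' i hi
      rwa [φ.injOn (hs0 i hi hx') (hs0 i₀ hi₀ hx) hxx'] at hx'
    have hcv : Convex ℝ (φ '' (⋂ i ∈ s, (P i : Set Q))) := by
      rw [himg]
      exact convex_iInter₂ fun i hi => hconv _ _ (hni i hi)
    have := hcv.contractibleSpace ⟨φ y, y, hy, rfl⟩
    exact (φ.homeomorphOfImageSubsetSource hS rfl).contractibleSpace

variable {E : Type*} [NormedAddCommGroup E] [NormedSpace ℝ E] [FiniteDimensional ℝ E]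
  {F : Type*} [NormedAddCommGroup F] [NormedSpace ℝ F] [FiniteDimensional ℝ F]
  {F' : Type*} [NormedAddCommGroup F'] [NormedSpace ℝ F'] [FiniteDimensional ℝ F']
  {Q : Type*} [TopologicalSpace Q] [T2Space Q] [ChartedSpace E Q] [IsManifold 𝓘(ℝ, E) ∞ Q]
  {X : Type*} [TopologicalSpace X] [ChartedSpace F X] [IsManifold 𝓘(ℝ, F) ∞ X] [T2Space X]
  [CompactSpace X]
  {X' : Type*} [TopologicalSpace X'] [ChartedSpace F' X'] [IsManifold 𝓘(ℝ, F') ∞ X'] [T2Space X']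
  [CompactSpace X'] {m : ℕ} {P : Fin m → Opens Q}

theorem IsGoodCover.contractibleSpace_inf (hP : IsGoodCover P) (i j : Fin m)
    (hne : ((P i ⊓ P j : Opens Q) : Set Q).Nonempty) : ContractibleSpace (P i ⊓ P j : Opens Q) := by
  have h : (⋂ k ∈ ({i, j} : Finset (Fin m)), (P k : Set Q)) = (P i ⊓ P j : Opens Q) := by
    ext x
    simp
  have := hP.contractible {i, j} (by simp) (by rwa [h])
  rwa [h] at this

theorem IsGoodCover.contractibleSpace (hP : IsGoodCover P) (i : Fin m)
    (hne : (P i : Set Q).Nonempty) : ContractibleSpace (P i) := by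
  have h : (⋂ k ∈ ({i} : Finset (Fin m)), (P k : Set Q)) = P i := by
    ext x
    simp
  have := hP.contractible {i} (by simp) (by rwa [h])
  rwa [h] at this

theorem zeroExt_restrict_univ_eventuallyEq (U : Opens Q) (h : Q → ℝ) {x : Q} (hx : x ∈ U) :
    zeroExt (fun y : U => h y) =ᶠ[𝓝 x] h := by
  filter_upwards [U.isOpen.mem_nhds hx] with y hy
  exact zeroExt_apply (fun y : U => h y) ⟨y, hy⟩

/-- Nonempty double intersections are contractible, hence simply connected, so changes of
trivialisation have global primitives there. -/
theorem LagrangianTorusFibration.nonempty_trivialisationData (L : LagrangianTorusFibration E F Q X)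
    (hP : IsGoodCover P) (hτ : ∀ i, Nonempty (L.LocalTrivialisation (P i))) :
    Nonempty (TrivialisationData L P) := by
  have hτ' := fun i => (hτ i).some
  have h : ∀ i j, ∃ h : Q → ℝ, IsTransition (hτ' i) (hτ' j) (P i ⊓ P j : Opens Q) h := by
    intro i j
    rcases ((P i ⊓ P j : Opens Q) : Set Q).eq_empty_or_nonempty with he | hne
    · rw [he]
      exact ⟨0, contMDiffOn_empty, fun x hx => hx.elim⟩
    · have := hP.contractibleSpace_inf i j hne
      exact exists_isTransition _ _ (P i ⊓ P j) inf_le_left inf_le_right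
  choose h hh using h
  refine ⟨⟨hτ', fun i j _ x => h i j x, fun i j _ x hx => ?_, fun i j _ x ξ => ?_⟩⟩
  · exact (((hh i j).1.contMDiffAt ((P i ⊓ P j).isOpen.mem_nhds hx)).congr_of_eventuallyEq
      (zeroExt_restrict_univ_eventuallyEq _ _ hx)).contMDiffWithinAt
  · have h1 : differential E (fun x : (P i ⊓ P j : Opens Q) => h i j x) x = dd (h i j) (x : Q) :=
      dd_congr (zeroExt_restrict_univ_eventuallyEq _ _ x.2)
    rw [h1]
    exact (hh i j).2 x x.2 ξ

theorem LagrangianTorusFibration.proj_surjective (L : LagrangianTorusFibration E F Q X) :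
    Function.Surjective L.proj := fun q => (L.connected_fibre q).nonempty

theorem LagrangianTorusFibration.compactSpace_base (L : LagrangianTorusFibration E F Q X) :
    CompactSpace Q :=
  ⟨by
    rw [← L.proj_surjective.range_eq]
    exact isCompact_range L.contMDiff_proj.continuous⟩

/-- Integral affine charts of L are taken inside neighbourhoods over which both fibrations
trivialise. The good cover built from them is subordinate to these neighbourhoods. -/
theorem exists_isGoodCover_trivialisationData (L : LagrangianTorusFibration E F Q X)
    (L' : LagrangianTorusFibration E F' Q X') :
    ∃ (m : ℕ) (P : Fin m → Opens Q), IsGoodCover P ∧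
      Nonempty (TrivialisationData L P) ∧ Nonempty (TrivialisationData L' P) := by
  have := L.compactSpace_base
  have : MetrizableSpace Q := Manifold.metrizableSpace 𝓘(ℝ, E) Q
  choose U hU hUτ using L.exists_localTrivialisation
  choose U' hU' hUτ' using L'.exists_localTrivialisation
  choose ψ hψ hψU hψa hψg using fun q => L.exists_affine_chart q rfl
    (show q ∈ U q ⊓ U' q from ⟨hU q, hU' q⟩)
  obtain ⟨m, P, hP, hPψ⟩ := exists_isGoodCover ψ hψ fun q q' W hW hWc hWs hWs' =>
    exists_affineMap_of_affine_charts (hψa q) (hψg q) (hψa q') hW hWc hWs hWs'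
  choose q hq using hPψ
  exact ⟨m, P, hP, L.nonempty_trivialisationData hP fun i =>
    hUτ (q i) (P i) fun x hx => (hψU _ x (hq i hx)).1, L'.nonempty_trivialisationData hP fun i =>
    hUτ' (q i) (P i) fun x hx => (hψU _ x (hq i hx)).2⟩

end GoodCover

/-! ### Gluing fibrewise symplectomorphisms -/

section Gluing

variable {E : Type*} [NormedAddCommGroup E] [NormedSpace ℝ E] [FiniteDimensional ℝ E]
  {F : Type*} [NormedAddCommGroup F] [NormedSpace ℝ F] [FiniteDimensional ℝ F]
  {F' : Type*} [NormedAddCommGroup F'] [NormedSpace ℝ F'] [FiniteDimensional ℝ F']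
  {Q : Type*} [TopologicalSpace Q] [ChartedSpace E Q] [IsManifold 𝓘(ℝ, E) ∞ Q]
  {X : Type*} [TopologicalSpace X] [ChartedSpace F X] [IsManifold 𝓘(ℝ, F) ∞ X]
  {X' : Type*} [TopologicalSpace X'] [ChartedSpace F' X'] [IsManifold 𝓘(ℝ, F') ∞ X']
  {L : LagrangianTorusFibration E F Q X} {L' : LagrangianTorusFibration E F' Q X'}

/-- A map which matches two Lagrangian germs is smooth and symplectic. -/
theorem IsLagAt.symplectic_of_comp_eq {q₀ : Q} {S : E × (E →L[ℝ] ℝ) → X}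
    {S' : E × (E →L[ℝ] ℝ) → X'} {z : E × (E →L[ℝ] ℝ)} (h : IsLagAt L q₀ S z)
    (h' : IsLagAt L' q₀ S' z) {φ : X → X'} (hφ : ∀ᶠ z' in 𝓝 z, φ (S z') = S' z') :
    ContMDiffAt 𝓘(ℝ, F) 𝓘(ℝ, F') ∞ φ (S z) ∧
      DiffForm.pullback 𝓘(ℝ, F) 𝓘(ℝ, F') L'.form φ (S z) = L.form (S z) := by
  obtain ⟨e, hze, heN, hes, hsm⟩ := h.exists_openPartialHomeomorph hφ
  have hx : S z ∈ e.target := hes z hze ▸ e.map_source hze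
  have hez : e.symm (S z) = z := by
    rw [← hes z hze]
    exact e.left_inv hze
  have h1 : φ =ᶠ[𝓝 (S z)] S' ∘ e.symm := by
    filter_upwards [e.open_target.mem_nhds hx] with x hx'
    have h2 := heN (e.map_target hx')
    have h3 := hes _ (e.map_target hx')
    rw [e.right_inv hx'] at h3
    rw [Function.comp_apply, ← h2, ← h3]
  have h2 : S ∘ e.symm =ᶠ[𝓝 (S z)] id := by
    filter_upwards [e.open_target.mem_nhds hx] with x hx'
    have h3 := hes _ (e.map_target hx')
    rw [e.right_inv hx'] at h3
    exact h3.symm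
  have hS' : ContMDiffAt 𝓘(ℝ, E × (E →L[ℝ] ℝ)) 𝓘(ℝ, F') ∞ S' (e.symm (S z)) := by
    rw [hez]
    exact h'.contMDiffAt
  have hS : ContMDiffAt 𝓘(ℝ, E × (E →L[ℝ] ℝ)) 𝓘(ℝ, F) ∞ S (e.symm (S z)) := by
    rw [hez]
    exact h.contMDiffAt
  refine ⟨(hS'.comp _ (hsm _ hx)).congr_of_eventuallyEq h1, ?_⟩
  -- With A the derivative of the local inverse of S, the derivative of φ is DS' ∘ A while DS ∘ A is
  -- the identity. Both forms thus become the standard form evaluated on A.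
  let A : F →L[ℝ] E × (E →L[ℝ] ℝ) := mfderiv 𝓘(ℝ, F) 𝓘(ℝ, E × (E →L[ℝ] ℝ)) e.symm (S z)
  have d1 := h1.mfderiv_eq.trans (mfderiv_comp (S z) (hS'.mdifferentiableAt (by simp))
    ((hsm _ hx).mdifferentiableAt (by simp)))
  have d2 := (mfderiv_comp (S z) (hS.mdifferentiableAt (by simp))
    ((hsm _ hx).mdifferentiableAt (by simp))).symm.trans (h2.mfderiv_eq.trans mfderiv_id)
  have e1 : (mfderiv 𝓘(ℝ, F) 𝓘(ℝ, F') φ (S z) : F →L[ℝ] F') =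
      (mfderiv 𝓘(ℝ, E × (E →L[ℝ] ℝ)) 𝓘(ℝ, F') S' z : E × (E →L[ℝ] ℝ) →L[ℝ] F').comp A := by
    refine d1.trans ?_
    rw [hez]
    rfl
  have e2 : (mfderiv 𝓘(ℝ, E × (E →L[ℝ] ℝ)) 𝓘(ℝ, F) S z : E × (E →L[ℝ] ℝ) →L[ℝ] F).comp A =
      ContinuousLinearMap.id ℝ F := by
    refine Eq.trans ?_ d2
    rw [hez]
    rfl
  have hval : φ (S z) = S' z := h1.self_of_nhds.trans (by rw [Function.comp_apply, hez])
  have key : ∀ (x' y' : X') (B C : F →L[ℝ] F') (u w : F), x' = y' → B = C →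
      (L'.form x' : F' [⋀^Fin 2]→L[ℝ] ℝ) ![B u, B w] =
        (L'.form y' : F' [⋀^Fin 2]→L[ℝ] ℝ) ![C u, C w] := by
    rintro x' _ B _ u w rfl rfl
    rfl
  have key' : ∀ (B : F →L[ℝ] F) (u w : F), B = ContinuousLinearMap.id ℝ F →
      (L.form (S z) : F [⋀^Fin 2]→L[ℝ] ℝ) ![B u, B w] =
        (L.form (S z) : F [⋀^Fin 2]→L[ℝ] ℝ) ![u, w] := by
    rintro _ u w rfl
    rfl
  ext v
  have p1 := h'.pullBilin_eq (A (v 0)) (A (v 1))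
  have p2 := h.pullBilin_eq (A (v 0)) (A (v 1))
  rw [pullBilin_apply] at p1 p2
  have p3 := key' _ (v 0) (v 1) e2
  have p4 := key _ _ _ _ (v 0) (v 1) hval e1
  have hv : v = ![v 0, v 1] := by
    ext i
    fin_cases i <;> rfl
  have hl : DiffForm.pullback 𝓘(ℝ, F) 𝓘(ℝ, F') L'.form φ (S z) v =
      (L'.form (φ (S z)) : F' [⋀^Fin 2]→L[ℝ] ℝ)
        ![(mfderiv 𝓘(ℝ, F) 𝓘(ℝ, F') φ (S z) : F →L[ℝ] F') (v 0),
          (mfderiv 𝓘(ℝ, F) 𝓘(ℝ, F') φ (S z) : F →L[ℝ] F') (v 1)] := by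
    change (L'.form (φ (S z)) : F' [⋀^Fin 2]→L[ℝ] ℝ)
      (fun i => (mfderiv 𝓘(ℝ, F) 𝓘(ℝ, F') φ (S z) : F →L[ℝ] F') (v i)) = _
    congr 1
    ext i
    fin_cases i <;> rfl
  refine hl.trans (p4.trans ((p1.trans p2.symm).trans (p3.trans ?_)))
  exact congrArg (L.form (S z) : F [⋀^Fin 2]→L[ℝ] ℝ) hv.symm

/-- A bijective correspondence which locally matches Lagrangian germs is a fibrewise
symplectomorphism. -/
theorem nonempty_fibrewiseSymplectomorphism (R : X → X' → Prop) (left : ∀ x, ∃ x', R x x')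
    (right : ∀ x', ∃ x, R x x') (functional : ∀ x x' y', R x x' → R x y' → x' = y')
    (injective : ∀ x y x', R x x' → R y x' → x = y)
    (germ : ∀ x x', R x x' → ∃ (q : Q) (S : E × (E →L[ℝ] ℝ) → X) (S' : E × (E →L[ℝ] ℝ) → X')
      (z : E × (E →L[ℝ] ℝ)), S z = x ∧ S' z = x' ∧ IsLagAt L q S z ∧ IsLagAt L' q S' z ∧
        ∀ᶠ z' in 𝓝 z, R (S z') (S' z')) :
    Nonempty (L.FibrewiseSymplectomorphism L') := by
  choose φ hφ using left
  choose χ hχ using right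
  have hφs : ∀ x, ContMDiffAt 𝓘(ℝ, F) 𝓘(ℝ, F') ∞ φ x ∧ L'.proj (φ x) = L.proj x ∧
      DiffForm.pullback 𝓘(ℝ, F) 𝓘(ℝ, F') L'.form φ x = L.form x := by
    intro x
    obtain ⟨q, S, S', z, rfl, hz', hS, hS', hR⟩ := germ x _ (hφ x)
    obtain ⟨h1, h2⟩ := hS.symplectic_of_comp_eq hS' (φ := φ) (by
      filter_upwards [hR] with z' hz'
      exact functional _ _ _ (hφ _) hz')
    exact ⟨h1, by rw [← hz', hS'.proj_eq, hS.proj_eq], h2⟩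
  have hχs : ∀ x', ContMDiffAt 𝓘(ℝ, F') 𝓘(ℝ, F) ∞ χ x' := by
    intro x'
    obtain ⟨q, S, S', z, -, rfl, hS, hS', hR⟩ := germ _ x' (hχ x')
    exact (hS'.symplectic_of_comp_eq hS (φ := χ) (by
      filter_upwards [hR] with z' hz'
      exact injective _ _ _ (hχ _) hz')).1
  exact ⟨{
    toDiffeomorph :=
      { toFun := φ
        invFun := χ
        left_inv := fun x => injective _ _ _ (hχ _) (hφ x)
        right_inv := fun x' => functional _ _ _ (hφ _) (hχ x')
        contMDiff_toFun := fun x => (hφs x).1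
        contMDiff_invFun := hχs }
    proj_comp := fun x => (hφs x).2.1
    pullback_form := funext fun x => (hφs x).2.2 }⟩

variable {ι : Type*} {P : ι → Opens Q}

/-- Trivialisations of two fibrations over the sets of a cover, with the same changes of
trivialisation up to fibrewise addition of differentials, give a fibrewise symplectomorphism. -/
theorem nonempty_fibrewiseSymplectomorphism_of_trivialisations
    (hcov : ∀ q, ∃ i, q ∈ P i) (τ : ∀ i, L.LocalTrivialisation (P i))
    (τ' : ∀ i, L'.LocalTrivialisation (P i)) {h : ι → Q → ℝ}
    (hh : ∀ i, ContMDiffOn 𝓘(ℝ, E) 𝓘(ℝ, ℝ) ∞ (h i) (P i))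
    (hc : ∀ i j, ∀ x ∈ P i, x ∈ P j → ∀ ξ ξ' : CotangentSpace E x,
      (τ i).toFun ⟨x, ξ⟩ = (τ j).toFun ⟨x, ξ'⟩ ↔
        (τ' i).toFun ⟨x, ξ + dd (h i) x⟩ = (τ' j).toFun ⟨x, ξ' + dd (h j) x⟩) :
    Nonempty (L.FibrewiseSymplectomorphism L') := by
  -- The correspondence matches τ_i at ξ with τ'_i at ξ + dh_i; the hypothesis on overlaps makes it
  -- single-valued and injective.
  refine nonempty_fibrewiseSymplectomorphism (fun x x' => ∃ i, ∃ q ∈ P i,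
    ∃ ξ : CotangentSpace E q, (τ i).toFun ⟨q, ξ⟩ = x ∧ (τ' i).toFun ⟨q, ξ + dd (h i) q⟩ = x')
    ?_ ?_ ?_ ?_ ?_
  · intro x
    obtain ⟨i, hi⟩ := hcov (L.proj x)
    obtain ⟨⟨q, ξ⟩, hq, rfl⟩ := (τ i).surjective x hi
    exact ⟨_, i, q, hq, ξ, rfl, rfl⟩
  · intro x'
    obtain ⟨i, hi⟩ := hcov (L'.proj x')
    obtain ⟨⟨q, ξ⟩, hq, rfl⟩ := (τ' i).surjective x' hi
    exact ⟨_, i, q, hq, ξ - dd (h i) q, rfl, by rw [sub_add_cancel]⟩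
  · rintro x x' y' ⟨i, q, hq, ξ, h1, rfl⟩ ⟨j, q', hq', ξ', h2, rfl⟩
    have e := (τ i).proj_comp ⟨q, ξ⟩ hq
    rw [h1, ← h2, (τ j).proj_comp ⟨q', ξ'⟩ hq'] at e
    obtain rfl : q' = q := e
    exact (hc i j q' hq hq' ξ ξ').1 (h1.trans h2.symm)
  · rintro x y x' ⟨i, q, hq, ξ, rfl, h1⟩ ⟨j, q', hq', ξ', rfl, h2⟩
    have e := (τ' i).proj_comp ⟨q, ξ + dd (h i) q⟩ hq
    rw [h1, ← h2, (τ' j).proj_comp ⟨q', ξ' + dd (h j) q'⟩ hq'] at e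
    obtain rfl : q' = q := e
    exact (hc i j q' hq hq' ξ ξ').2 (h1.trans h2.symm)
  · rintro _ _ ⟨i, q, hq, ξ, rfl, rfl⟩
    have hqs := mem_extChartAt_source (I := 𝓘(ℝ, E)) q
    have hcot := cot_cotInv (E := E) (q₀ := q) (w := ⟨q, ξ⟩) hqs
    let z := cotInv (E := E) q ⟨q, ξ⟩
    have hz1 : z.1 = extChartAt 𝓘(ℝ, E) q q := rfl
    have ht : z.1 ∈ (extChartAt 𝓘(ℝ, E) q).target := mem_extChartAt_target q
    have hzq : (extChartAt 𝓘(ℝ, E) q).symm z.1 = q := extChartAt_to_inv q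
    have hev : ∀ᶠ y in 𝓝 z.1, y ∈ (extChartAt 𝓘(ℝ, E) q).target ∧
        (extChartAt 𝓘(ℝ, E) q).symm y ∈ P i :=
      Filter.Eventually.and ((isOpen_extChartAt_target (I := 𝓘(ℝ, E)) q).mem_nhds ht)
        ((continuousAt_extChartAt_symm'' ht).preimage_mem_nhds (by
          rw [hzq]; exact (P i).isOpen.mem_nhds hq))
    have hcd : ∀ y, (extChartAt 𝓘(ℝ, E) q).symm y ∈ P i →
        ContMDiffAt 𝓘(ℝ, E) 𝓘(ℝ, ℝ) ∞ (h i) ((extChartAt 𝓘(ℝ, E) q).symm y) := fun y hy =>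
      (hh i).contMDiffAt ((P i).isOpen.mem_nhds hy)
    -- The trivialisation τ'_i translated by dh_i, in cotangent coordinates; the summand 0 is the
    -- constant of `IsLagAt.comp_translation`.
    let S' : E × (E →L[ℝ] ℝ) → X' := fun z => ((τ' i).toFun ∘ cot q)
      (z.1, z.2 + (fderiv ℝ (h i ∘ (extChartAt 𝓘(ℝ, E) q).symm) z.1 + 0))
    have hS' : ∀ z : E × (E →L[ℝ] ℝ), z.1 ∈ (extChartAt 𝓘(ℝ, E) q).target →
        (extChartAt 𝓘(ℝ, E) q).symm z.1 ∈ P i → S' z = (τ' i).toFun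
          ⟨(cot q z).proj, (cot q z).snd + dd (h i) (cot q z).proj⟩ := by
      rintro ⟨y, η⟩ hy hyP
      change (τ' i).toFun ⟨(extChartAt 𝓘(ℝ, E) q).symm y, covector q y
        (η + (fderiv ℝ (h i ∘ (extChartAt 𝓘(ℝ, E) q).symm) y + 0))⟩ = (τ' i).toFun
        ⟨(extChartAt 𝓘(ℝ, E) q).symm y, covector q y η + dd (h i) ((extChartAt 𝓘(ℝ, E) q).symm y)⟩
      rw [dd_eq_covector_self (y := y) hy (hcd y hyP), add_zero, map_add]
      rfl
    refine ⟨q, (τ i).toFun ∘ cot q, S', z, congrArg (τ i).toFun hcot, ?_,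
      (τ i).isLagAt ht (by rwa [hzq]), ?_, ?_⟩
    · rw [hS' z ht (by rwa [hzq])]
      exact congrArg (fun w : CotangentBundle E Q =>
        (τ' i).toFun ⟨w.proj, w.snd + dd (h i) w.proj⟩) hcot
    · refine IsLagAt.comp_translation ?_ ((τ' i).isLagAt ht (by rwa [hzq]))
      filter_upwards [hev] with y hy
      exact contDiffAt_comp_chart_symm hy.1 (hcd y hy.2)
    · filter_upwards [continuous_fst.continuousAt.eventually hev] with z' hz'
      exact ⟨i, _, hz'.2, (cot q z').snd, rfl, (hS' z' hz'.1 hz'.2).symm⟩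

/-- Smooth `1`-cocycles are coboundaries. -/
theorem exists_smooth_primitive [T2Space Q] [CompactSpace Q] [Fintype ι]
    (hcov : ∀ q, ∃ i, q ∈ P i) {G : ι → ι → Q → ℝ}
    (hG : ∀ i j, ContMDiffOn 𝓘(ℝ, E) 𝓘(ℝ, ℝ) ∞ (G i j) (P i ⊓ P j : Opens Q))
    (hc : ∀ i j k, ∀ x ∈ P i, x ∈ P j → x ∈ P k → G i j x + G j k x = G i k x) :
    ∃ h : ι → Q → ℝ, (∀ i, ContMDiffOn 𝓘(ℝ, E) 𝓘(ℝ, ℝ) ∞ (h i) (P i)) ∧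
      ∀ i j, ∀ x ∈ P i, x ∈ P j → h j x - h i x = G i j x := by
  obtain ⟨ρ, hρ⟩ := SmoothPartitionOfUnity.exists_isSubordinate 𝓘(ℝ, E) isClosed_univ
    (fun i => (P i : Set Q)) (fun i => (P i).isOpen) fun q _ => Set.mem_iUnion.2 (hcov q)
  -- The usual partition of unity formula; outside the support of ρ_k the values of G_kj are
  -- irrelevant.
  refine ⟨fun j x => ∑ k, ρ k x * G k j x, fun j => contMDiffOn_finsetSum fun k _ x hx => ?_,
    fun i j x hi hj => ?_⟩
  · refine ContMDiffAt.contMDiffWithinAt ?_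
    by_cases hxk : x ∈ tsupport (ρ k)
    · exact (ρ k).contMDiff.contMDiffAt.mul ((hG k j).contMDiffAt
        ((P k ⊓ P j).isOpen.mem_nhds ⟨hρ k hxk, hx⟩))
    · refine contMDiffAt_const (c := (0 : ℝ)).congr_of_eventuallyEq ?_
      filter_upwards [(isClosed_tsupport _).isOpen_compl.mem_nhds hxk] with y hy
      rw [image_eq_zero_of_notMem_tsupport hy, zero_mul]
  · have hsum : ∑ k, ρ k x = 1 := by
      rw [← finsum_eq_sum_of_fintype]
      exact ρ.sum_eq_one (Set.mem_univ x)
    rw [← Finset.sum_sub_distrib, ← one_mul (G i j x), ← hsum, Finset.sum_mul]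
    refine Finset.sum_congr rfl fun k _ => ?_
    by_cases hk : ρ k x = 0
    · simp [hk]
    · have := hc k i j x (hρ k (subset_tsupport _ hk)) hi hj
      rw [← this]
      ring

end Gluing

/-! ### The class determines the fibration -/

section Classification

variable {E : Type*} [NormedAddCommGroup E] [NormedSpace ℝ E] [FiniteDimensional ℝ E]
  {F : Type*} [NormedAddCommGroup F] [NormedSpace ℝ F] [FiniteDimensional ℝ F]
  {F' : Type*} [NormedAddCommGroup F'] [NormedSpace ℝ F'] [FiniteDimensional ℝ F']
  {Q : Type*} [TopologicalSpace Q] [T2Space Q] [ChartedSpace E Q] [IsManifold 𝓘(ℝ, E) ∞ Q]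
  {X : Type*} [TopologicalSpace X] [ChartedSpace F X] [IsManifold 𝓘(ℝ, F) ∞ X] [T2Space X]
  [CompactSpace X]
  {X' : Type*} [TopologicalSpace X'] [ChartedSpace F' X'] [IsManifold 𝓘(ℝ, F') ∞ X'] [T2Space X']
  [CompactSpace X'] {L : LagrangianTorusFibration E F Q X} {L' : LagrangianTorusFibration E F' Q X'}
  {m : ℕ} {P : Fin m → Opens Q}

/-- The two classes live in cohomology groups depending on the lattice. The coboundary condition is
therefore stated through the values of functions, which makes sense before the lattices are
identified. -/
theorem sigma_cechH2_eq_iff {Λ Λ' : LatticeField E Q} (a : (cechD2 Λ P).ker)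
    (a' : (cechD2 Λ' P).ker) :
    (⟨Λ, QuotientAddGroup.mk a⟩ : Σ Λ : LatticeField E Q, CechH2 Λ P) =
        ⟨Λ', QuotientAddGroup.mk a'⟩ ↔
      Λ = Λ' ∧ ∃ b : CechC1 Λ' P, ∀ (s : Triples m) (x : inter3 P s),
        (cechD1 Λ' P b s).1 x = (a'.1 s).1 x - (a.1 s).1 x := by
  have key : ∀ (a a' : (cechD2 Λ P).ker),
      (QuotientAddGroup.mk a : CechH2 Λ P) = QuotientAddGroup.mk a' ↔ ∃ b : CechC1 Λ P, ∀ (s : Triples m) (x : inter3 P s),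
        (cechD1 Λ P b s).1 x = (a'.1 s).1 x - (a.1 s).1 x := by
    intro a a'
    rw [QuotientAddGroup.eq, AddSubgroup.mem_addSubgroupOf, AddMonoidHom.mem_range]
    refine exists_congr fun b => ⟨fun h s x => ?_, fun h => funext fun s => Subtype.ext
      (funext fun x => (h s x).trans ?_)⟩
    · rw [h]
      change -(a.1 s).1 x + (a'.1 s).1 x = _
      ring
    · change _ = -(a.1 s).1 x + (a'.1 s).1 x
      ring
  constructor
  · intro h
    obtain rfl : Λ = Λ' := congrArg Sigma.fst h
    exact ⟨rfl, (key a a').1 (eq_of_heq (Sigma.mk.inj h).2)⟩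
  · rintro ⟨rfl, hb⟩
    rw [(key a a').2 hb]

/-- Equality of the invariants in terms of the functions `f_{ij}`. -/
theorem TrivialisationData.invariant_eq_iff (D : TrivialisationData L P)
    (D' : TrivialisationData L' P) : D.invariant = D'.invariant ↔
      L.periodLattice = L'.periodLattice ∧ ∃ b : ∀ i j : Fin m, i < j → (P i ⊓ P j : Opens Q) → ℝ,
        (∀ i j h, b i j h ∈ Aff L'.periodLattice (P i ⊓ P j)) ∧
        ∀ i j k (hij : i < j) (hjk : j < k) (x : Q) (hi : x ∈ P i) (hj : x ∈ P j) (hk : x ∈ P k),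
          b i j hij ⟨x, hi, hj⟩ + b j k hjk ⟨x, hj, hk⟩ - b i k (hij.trans hjk) ⟨x, hi, hk⟩ =
          (D'.primitive i j hij ⟨x, hi, hj⟩ + D'.primitive j k hjk ⟨x, hj, hk⟩ -
            D'.primitive i k (hij.trans hjk) ⟨x, hi, hk⟩) -
          (D.primitive i j hij ⟨x, hi, hj⟩ + D.primitive j k hjk ⟨x, hj, hk⟩ -
            D.primitive i k (hij.trans hjk) ⟨x, hi, hk⟩) := by
  refine (sigma_cechH2_eq_iff ⟨D.alpha, D.alpha_mem_ker⟩ ⟨D'.alpha, D'.alpha_mem_ker⟩).trans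
    (and_congr_right fun _ => ?_)
  have h1 : ∀ (b : CechC1 L'.periodLattice P) i j k (hij : i < j) (hjk : j < k) (x : Q)
      (hi : x ∈ P i) (hj : x ∈ P j) (hk : x ∈ P k),
      (cechD1 L'.periodLattice P b ⟨(i, j, k), hij, hjk⟩).1 ⟨x, ⟨hi, hj⟩, hk⟩ =
        (b ⟨(j, k), hjk⟩).1 ⟨x, hj, hk⟩ - (b ⟨(i, k), hij.trans hjk⟩).1 ⟨x, hi, hk⟩ +
        (b ⟨(i, j), hij⟩).1 ⟨x, hi, hj⟩ := fun _ _ _ _ _ _ _ _ _ _ => rfl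
  have h2 : ∀ i j k (hij : i < j) (hjk : j < k) (x : Q)
      (hi : x ∈ P i) (hj : x ∈ P j) (hk : x ∈ P k),
      (D.alpha ⟨(i, j, k), hij, hjk⟩).1 ⟨x, ⟨hi, hj⟩, hk⟩ =
        D.primitive i j hij ⟨x, hi, hj⟩ + D.primitive j k hjk ⟨x, hj, hk⟩ +
          -D.primitive i k (hij.trans hjk) ⟨x, hi, hk⟩ := fun _ _ _ _ _ _ _ _ _ => rfl
  have h3 : ∀ i j k (hij : i < j) (hjk : j < k) (x : Q)
      (hi : x ∈ P i) (hj : x ∈ P j) (hk : x ∈ P k),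
      (D'.alpha ⟨(i, j, k), hij, hjk⟩).1 ⟨x, ⟨hi, hj⟩, hk⟩ =
        D'.primitive i j hij ⟨x, hi, hj⟩ + D'.primitive j k hjk ⟨x, hj, hk⟩ +
          -D'.primitive i k (hij.trans hjk) ⟨x, hi, hk⟩ := fun _ _ _ _ _ _ _ _ _ => rfl
  constructor
  · rintro ⟨b, hb⟩
    refine ⟨fun i j h => b ⟨(i, j), h⟩, fun i j h => (b ⟨(i, j), h⟩).2,
      fun i j k hij hjk x hi hj hk => ?_⟩
    have := hb ⟨(i, j, k), hij, hjk⟩ ⟨x, ⟨hi, hj⟩, hk⟩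
    rw [h1 b i j k hij hjk x hi hj hk] at this
    refine Eq.trans ?_ (this.trans (congrArg₂ (· - ·) (h3 i j k hij hjk x hi hj hk)
      (h2 i j k hij hjk x hi hj hk)))
    ring
  · rintro ⟨b, hbA, hb⟩
    refine ⟨fun s => ⟨b s.1.1 s.1.2 s.2, hbA _ _ _⟩, ?_⟩
    rintro ⟨⟨i, j, k⟩, hij, hjk⟩ ⟨x, ⟨hi, hj⟩, hk⟩
    refine (h1 _ i j k hij hjk x hi hj hk).trans (Eq.trans ?_ (congrArg₂ (· - ·)
      (h3 i j k hij hjk x hi hj hk) (h2 i j k hij hjk x hi hj hk)).symm)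
    have := hb i j k hij hjk x hi hj hk
    change b j k hjk ⟨x, hj, hk⟩ - b i k _ ⟨x, hi, hk⟩ + b i j hij ⟨x, hi, hj⟩ = _
    linarith

/-- Over the contractible P_i the trivialisations φ ∘ τ_i and τ'_i differ by some dh_i. The cochain
b_ij = f'_ij + h_i - f_ij - h_j has coboundary α' - α because the h_i cancel. -/
theorem invariant_eq_of_fibrewiseSymplectomorphism (hP : IsGoodCover P)
    (D : TrivialisationData L P) (D' : TrivialisationData L' P)
    (φ : L.FibrewiseSymplectomorphism L') : D.invariant = D'.invariant := by
  refine (D.invariant_eq_iff D').2 ⟨φ.periodLattice_eq, ?_⟩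
  have hh : ∀ i, ∃ h : Q → ℝ, IsTransition ((D.triv i).map φ) (D'.triv i) (P i : Set Q) h := by
    intro i
    rcases (P i : Set Q).eq_empty_or_nonempty with he | hne
    · rw [he]
      exact ⟨0, contMDiffOn_empty, fun x hx => hx.elim⟩
    · have := hP.contractibleSpace i hne
      exact exists_isTransition _ _ (P i) le_rfl le_rfl
  choose h hh using hh
  have hsm : ∀ i j, IsSmoothFun E (fun x : (P i ⊓ P j : Opens Q) => h i x) ∧
      ∀ x : (P i ⊓ P j : Opens Q),
        differential E (fun x : (P i ⊓ P j : Opens Q) => h i x) x = dd (h i) (x : Q) := fun i j =>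
    ⟨fun x hx => (((hh i).1.contMDiffAt ((P i).isOpen.mem_nhds hx.1)).congr_of_eventuallyEq
      (zeroExt_restrict_univ_eventuallyEq _ _ hx)).contMDiffWithinAt,
      fun x => dd_congr (zeroExt_restrict_univ_eventuallyEq _ _ x.2)⟩
  have hsm' : ∀ i j, IsSmoothFun E (fun x : (P i ⊓ P j : Opens Q) => h j x) ∧
      ∀ x : (P i ⊓ P j : Opens Q),
        differential E (fun x : (P i ⊓ P j : Opens Q) => h j x) x = dd (h j) (x : Q) := fun i j =>
    ⟨fun x hx => (((hh j).1.contMDiffAt ((P j).isOpen.mem_nhds hx.2)).congr_of_eventuallyEq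
      (zeroExt_restrict_univ_eventuallyEq _ _ hx)).contMDiffWithinAt,
      fun x => dd_congr (zeroExt_restrict_univ_eventuallyEq _ _ x.2)⟩
  refine ⟨fun i j hij => D'.primitive i j hij + (fun x : (P i ⊓ P j : Opens Q) => h i x) +
    -(D.primitive i j hij + fun x : (P i ⊓ P j : Opens Q) => h j x), fun i j hij => ?_,
    fun i j k hij hjk x hi hj hk => ?_⟩
  · have s1 := (D'.isSmooth_primitive i j hij).add (hsm i j).1
    have s2 := (D.isSmooth_primitive i j hij).add (hsm' i j).1
    refine ⟨s1.add s2.neg, fun x => ?_⟩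
    rw [differential_add s1 s2.neg, differential_neg,
      differential_add (D'.isSmooth_primitive i j hij) (hsm i j).1,
      differential_add (D.isSmooth_primitive i j hij) (hsm' i j).1, (hsm i j).2, (hsm' i j).2,
      ← sub_eq_add_neg]
    -- Two ways from φ ∘ τ_i to τ'_j, through τ'_i and through φ ∘ τ_j, shift the zero covector by
    -- dh_i + df'_ij and by df_ij + dh_j. Their difference db_ij lies in the lattice.
    refine ((D'.triv j).eq_iff x x.2.2 _ _).1 ?_
    have t1 := (hh i).2 x x.2.1 0
    have t2 := D'.transition i j hij x (0 + dd (h i) (x : Q))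
    have t3 : ((D.triv i).map φ).toFun ⟨x, 0⟩ = ((D.triv j).map φ).toFun ⟨x,
        0 + differential E (D.primitive i j hij) x⟩ :=
      congrArg φ.toDiffeomorph (D.transition i j hij x 0)
    have t4 := (hh j).2 x x.2.2 (0 + differential E (D.primitive i j hij) x)
    rw [zero_add] at t1 t2 t3 t4
    rw [add_comm (differential E (D'.primitive i j hij) x)]
    exact t2.symm.trans (t1.symm.trans (t3.trans t4))
  · simp only [Pi.add_apply, Pi.neg_apply]
    ring

/-- If α' - α is the coboundary of b, then f' - f - b is a cocycle of smooth functions, so it equals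
p_j - p_i. Translating τ'_i by dp_i matches the changes of trivialisation up to db, which lies in
the lattice and is invisible in the fibres. -/
theorem nonempty_fibrewiseSymplectomorphism_of_invariant_eq (hP : IsGoodCover P)
    (D : TrivialisationData L P) (D' : TrivialisationData L' P) (h : D.invariant = D'.invariant) :
    Nonempty (L.FibrewiseSymplectomorphism L') := by
  have := L.compactSpace_base
  obtain ⟨hΛ, b, hb, hc⟩ := (D.invariant_eq_iff D').1 h
  -- the corrected difference of the primitives
  let g : ∀ i j : Fin m, i < j → (P i ⊓ P j : Opens Q) → ℝ := fun i j hij =>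
    D'.primitive i j hij + -(D.primitive i j hij + b i j hij)
  have hgs : ∀ i j hij, IsSmoothFun E (g i j hij) := fun i j hij =>
    (D'.isSmooth_primitive i j hij).add ((D.isSmooth_primitive i j hij).add (hb i j hij).1).neg
  -- The cocycle is given for i < j only. It is extended antisymmetrically to all pairs, as the
  -- partition of unity formula sums over every index.
  let G : Fin m → Fin m → Q → ℝ := fun i j =>
    if hij : i < j then zeroExt (g i j hij) else if hji : j < i then -zeroExt (g j i hji) else 0
  have hGlt : ∀ i j (hij : i < j), G i j = zeroExt (g i j hij) := fun i j hij => dif_pos hij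
  have hGgt : ∀ i j (hji : j < i), G i j = -zeroExt (g j i hji) := fun i j hji => by
    simp only [G]
    rw [dif_neg hji.not_gt, dif_pos hji]
  have hGself : ∀ i, G i i = 0 := fun i => by simp [G]
  have hganti : ∀ i j x, G i j x = -G j i x := by
    intro i j x
    rcases lt_trichotomy i j with hij | rfl | hij
    · rw [hGlt i j hij, hGgt j i hij, Pi.neg_apply, neg_neg]
    · simp [hGself]
    · rw [hGlt j i hij, hGgt i j hij, Pi.neg_apply]
  have hlt : ∀ i j k, i < j → j < k → ∀ x ∈ P i, x ∈ P j → x ∈ P k →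
      G i j x + G j k x = G i k x := by
    intro i j k hij hjk x hi hj hk
    have e := hc i j k hij hjk x hi hj hk
    rw [hGlt i j hij, hGlt j k hjk, hGlt i k (hij.trans hjk),
      zeroExt_apply (g i j hij) ⟨x, hi, hj⟩, zeroExt_apply (g j k hjk) ⟨x, hj, hk⟩,
      zeroExt_apply (g i k (hij.trans hjk)) ⟨x, hi, hk⟩]
    simp only [g, Pi.add_apply, Pi.neg_apply]
    linarith
  have hcoc : ∀ i j k, ∀ x ∈ P i, x ∈ P j → x ∈ P k → G i j x + G j k x = G i k x := by
    intro i j k x hi hj hk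
    have a1 := hganti i j x
    have a2 := hganti j k x
    have a3 := hganti i k x
    rcases lt_trichotomy i j with hij | rfl | hij
    · rcases lt_trichotomy j k with hjk | rfl | hjk
      · exact hlt i j k hij hjk x hi hj hk
      · simp [hGself]
      · rcases lt_trichotomy i k with hik | rfl | hik
        · linarith [hlt i k j hik hjk x hi hk hj]
        · simp only [hGself, Pi.zero_apply]
          linarith
        · linarith [hlt k i j hik hij x hk hi hj]
    · simp [hGself]
    · rcases lt_trichotomy j k with hjk | rfl | hjk
      · rcases lt_trichotomy i k with hik | rfl | hik
        · linarith [hlt j i k hij hik x hj hi hk]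
        · simp only [hGself, Pi.zero_apply]
          linarith
        · linarith [hlt j k i hjk hik x hj hk hi]
      · simp [hGself]
      · linarith [hlt k j i hjk hij x hk hj hi]
  have hGs : ∀ i j, ContMDiffOn 𝓘(ℝ, E) 𝓘(ℝ, ℝ) ∞ (G i j) (P i ⊓ P j : Opens Q) := by
    intro i j
    rcases lt_trichotomy i j with hij | rfl | hij
    · rw [hGlt i j hij]
      exact hgs i j hij
    · rw [hGself]
      exact contMDiffOn_const
    · rw [hGgt i j hij]
      exact ContMDiffOn.neg (ContMDiffOn.mono (hgs j i hij) fun x hx => ⟨hx.2, hx.1⟩)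
  obtain ⟨p, hp, hpG⟩ := exists_smooth_primitive hP.covers hGs hcoc
  have hpd : ∀ i, ∀ x ∈ P i, MDifferentiableAt 𝓘(ℝ, E) 𝓘(ℝ, ℝ) (p i) x := fun i x hx =>
    mdifferentiableAt_of_contMDiffOn (hp i) (P i).isOpen hx
  have hdiff : ∀ i j (hij : i < j) (x : (P i ⊓ P j : Opens Q)),
      dd (p j) (x : Q) - dd (p i) (x : Q) = differential E (D'.primitive i j hij) x -
        (differential E (D.primitive i j hij) x + differential E (b i j hij) x) := by
    intro i j hij x
    have e : p j - p i =ᶠ[𝓝 (x : Q)] zeroExt (g i j hij) := by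
      filter_upwards [(P i ⊓ P j).isOpen.mem_nhds x.2] with y hy
      rw [← hGlt i j hij]
      exact hpG i j y hy.1 hy.2
    rw [← dd_sub (hpd j x x.2.2) (hpd i x x.2.1), dd_congr e]
    change differential E (g i j hij) x = _
    have s := (D.isSmooth_primitive i j hij).add (hb i j hij).1
    rw [differential_add (D'.isSmooth_primitive i j hij) s.neg, differential_neg,
      differential_add (D.isSmooth_primitive i j hij) (hb i j hij).1, ← sub_eq_add_neg]
  have hlt' : ∀ i j (_ : i < j), ∀ x ∈ P i, x ∈ P j → ∀ ξ ξ' : CotangentSpace E x,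
      (D.triv i).toFun ⟨x, ξ⟩ = (D.triv j).toFun ⟨x, ξ'⟩ ↔
        (D'.triv i).toFun ⟨x, ξ + dd (p i) x⟩ = (D'.triv j).toFun ⟨x, ξ' + dd (p j) x⟩ := by
    intro i j hij x hi hj ξ ξ'
    have t1 := D.transition i j hij ⟨x, hi, hj⟩ ξ
    have t2 := D'.transition i j hij ⟨x, hi, hj⟩ (ξ + dd (p i) x)
    have hbx : differential E (b i j hij) ⟨x, hi, hj⟩ ∈ L'.periodLattice x :=
      (hb i j hij).2 ⟨x, hi, hj⟩
    have hd := hdiff i j hij ⟨x, hi, hj⟩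
    simp only at t1 t2 hd
    rw [t1, t2, (D.triv j).eq_iff x hj, (D'.triv j).eq_iff x hj, hΛ,
      ← AddSubgroup.add_mem_cancel_right _ hbx]
    have e : ξ + differential E (D.primitive i j hij) ⟨x, hi, hj⟩ - ξ' +
        differential E (b i j hij) ⟨x, hi, hj⟩ = ξ + dd (p i) x +
        differential E (D'.primitive i j hij) ⟨x, hi, hj⟩ - (ξ' + dd (p j) x) := by
      rw [sub_eq_iff_eq_add] at hd
      rw [hd]
      abel
    rw [e]
  refine nonempty_fibrewiseSymplectomorphism_of_trivialisations hP.covers D.triv D'.triv hp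
    fun i j x hi hj ξ ξ' => ?_
  rcases lt_trichotomy i j with hij | rfl | hij
  · exact hlt' i j hij x hi hj ξ ξ'
  · rw [(D.triv i).eq_iff x hi, (D'.triv i).eq_iff x hi, hΛ, add_sub_add_right_eq_sub]
  · rw [eq_comm, hlt' j i hij x hj hi ξ' ξ, eq_comm]

end Classification

end LagrangianFibrations

end

theorem mainTheorem3
    {E : Type*} [NormedAddCommGroup E] [NormedSpace ℝ E] [FiniteDimensional ℝ E]
    {F : Type*} [NormedAddCommGroup F] [NormedSpace ℝ F] [FiniteDimensional ℝ F]
    {F' : Type*} [NormedAddCommGroup F'] [NormedSpace ℝ F'] [FiniteDimensional ℝ F']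
    {Q : Type*} [TopologicalSpace Q] [T2Space Q] [ChartedSpace E Q] [IsManifold 𝓘(ℝ, E) ∞ Q]
    {X : Type*} [TopologicalSpace X] [T2Space X] [CompactSpace X] [ChartedSpace F X]
    [IsManifold 𝓘(ℝ, F) ∞ X]
    {X' : Type*} [TopologicalSpace X'] [T2Space X'] [CompactSpace X'] [ChartedSpace F' X']
    [IsManifold 𝓘(ℝ, F') ∞ X']
    (L : LagrangianFibrations.LagrangianTorusFibration E F Q X)
    (L' : LagrangianFibrations.LagrangianTorusFibration E F' Q X') :
    (L.periodLattice = L'.periodLattice →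
      ∃ (m : ℕ) (P : Fin m → TopologicalSpace.Opens Q), LagrangianFibrations.IsGoodCover P ∧
        Nonempty (LagrangianFibrations.TrivialisationData L P) ∧
        Nonempty (LagrangianFibrations.TrivialisationData L' P)) ∧
    ∀ (m : ℕ) (P : Fin m → TopologicalSpace.Opens Q), LagrangianFibrations.IsGoodCover P →
      ∀ (D : LagrangianFibrations.TrivialisationData L P)
        (D' : LagrangianFibrations.TrivialisationData L' P),
        Nonempty (L.FibrewiseSymplectomorphism L') ↔ D.invariant = D'.invariant := by
  refine ⟨fun _ => LagrangianFibrations.exists_isGoodCover_trivialisationData L L', fun m P hP D D' =>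
    ⟨fun ⟨φ⟩ => LagrangianFibrations.invariant_eq_of_fibrewiseSymplectomorphism hP D D' φ, fun h =>
      LagrangianFibrations.nonempty_fibrewiseSymplectomorphism_of_invariant_eq hP D D' h⟩⟩
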